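/- **Theorem (Full Preservation).** Fix an infinite set $\mathcal L$ of location names and a local language over $\mathcal L$: local types and expressions with substitution; a confluent small-step semantics in which values, which are closed, do not step; a kinding and a typing judgment, both stable under substitution, for which type preservation and progress hold; and types $\mathsf{loc}_\rho$, $\mathsf{locset}_\rho$ whose values represent, respectively, locations in $\rho$ and finite sets of locations in $\rho$, every location having a representation. Consider the choreographic language over it with (type-)functions, pairs, sums, recursive types, sends, selections, first-class location names, process forking $\mathsf{let}\ (\alpha,x) := \ell.\mathsf{fork}()\ \mathsf{in}\ C$ and its run-time form $\mathsf{kill\text{-}after}\ L\ C$. Write $\Gamma \vdash^{+} C : \tau \rhd \rho$ for the augmented typing judgment: $C$ has type $\tau$ and participants $\rho$, where $\rho ::= \varnothing \mid \alpha \mid \{\ell\} \mid \rho \cup \rho \mid \top$. Let $\mathrm{NL}(\rho)$ be the set of names $A\in\mathcal L$ such that $\{A\}$ occurs in $\rho$ (so $\mathrm{NL}(\top)=\varnothing$), and let $\mathrm{SN}(C)$, the spawned locations of $C$, be the set of names $A$ such that $\mathsf{kill\text{-}after}\ A$ occurs in $C$. Let $\langle C,\Omega\rangle \Longrightarrow \langle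 C',\Omega'\rangle$ be the (out-of-order) reduction of choreographies together with a set $\Omega\subseteq\mathcal L$ of running locations: a fork adds to $\Omega$ the name of the spawned location, which is not in $\Omega$; killing a location removes its name from $\Omega$. Suppose that $\Gamma \vdash^{+} C : \tau \rhd \rho$, that $\mathrm{NL}(\rho)\subseteq\Omega$, and that $\langle C,\Omega\rangle \Longrightarrow^{*} \langle C',\Omega'\rangle$ by a reduction sequence in which newly spawned locations get fresh names, i.e. the name chosen in a step from $\langle C_1,\Omega_1\rangle$ is not in $\Omega_1$ and does not occur in the location annotations of $\Gamma$, $\tau$ or $C_1$ (nor as a name in a $\mathsf{kill\text{-}after}$ of $C_1$). Then there is a $\rho'$ such that all of the following hold: 1. $\Gamma \vdash^{+} C' : \tau \rhd \rho'$; 2. $\mathrm{NL}(\rho')\subseteq\Omega'$; 3. $\mathrm{SN}(C')\setminus \mathrm{SN}(C) = \Omega'\setminus\Omega$; 4. $\mathrm{SN}(C)\setminus \mathrm{SN}(C') = \Omega\setminus\Omega'$; 5. $\mathrm{NL}(\rho')\setminus \mathrm{NL}(\rho) \subseteq \Omega'\setminus\Omega$; 6. $\Omega\setminus\Omega' \subseteq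 \mathrm{NL}(\rho)\setminus \mathrm{NL}(\rho')$. -/

import Mathlib

universe u v w

namespace LambdaFork

/-! ## Locations and location sets -/

/-- A location `ℓ`: a location variable (de Bruijn index) or a concrete name in `L`. -/
inductive LocE (L : Type u) : Type u
  | var (n : ℕ)
  | const (A : L)

/-- A location set `ρ ::= ∅ | α | {ℓ} | ρ ∪ ρ | ⊤`, possibly open.  Location-set variables
are de Bruijn indices in a scope of their own. -/
inductive LocSet (L : Type u) : Type u
  | empty
  | var (n : ℕ)
  | sng (ℓ : LocE L)
  | union (ρ₁ ρ₂ : LocSet L)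
  | top

/-- The two kinds of location sets, `*_locset` and `*_finlocset`. -/
inductive SetKind
  | locset
  | finlocset

/-- Extend a sequence by a new entry at index `0`. -/
def scons {α : Type u} (a : α) (f : ℕ → α) : ℕ → α
  | 0 => a
  | n + 1 => f n

/-- Substitution of locations for location variables. -/
def LocE.subst {L : Type u} (l : ℕ → LocE L) : LocE L → LocE L
  | .var n => l n
  | .const A => .const A

namespace LocSet

variable {L : Type u}

/-- Simultaneous substitution for location and location-set variables. -/
def subst (l : ℕ → LocE L) (s : ℕ → LocSet L) : LocSet L → LocSet L
  | .empty => .empty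
  | .var n => s n
  | .sng ℓ => .sng (ℓ.subst l)
  | .union ρ₁ ρ₂ => .union (subst l s ρ₁) (subst l s ρ₂)
  | .top => .top

/-- Containment `ℓ ∈ ρ`. -/
inductive Mem : LocE L → LocSet L → Prop
  | sng (ℓ : LocE L) : Mem ℓ (.sng ℓ)
  | left {ℓ : LocE L} {ρ₁ ρ₂ : LocSet L} : Mem ℓ ρ₁ → Mem ℓ (.union ρ₁ ρ₂)
  | right {ℓ : LocE L} {ρ₁ ρ₂ : LocSet L} : Mem ℓ ρ₂ → Mem ℓ (.union ρ₁ ρ₂)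
  | top (ℓ : LocE L) : Mem ℓ .top

/-- Disjointness `ρ₁ ∩ ρ₂ = ∅`. -/
def Disj (ρ₁ ρ₂ : LocSet L) : Prop := ∀ ℓ : LocE L, ¬ (Mem ℓ ρ₁ ∧ Mem ℓ ρ₂)

/-- The subset relation `ρ₁ ⊆ ρ₂`. -/
inductive Sub : LocSet L → LocSet L → Prop
  | empty (ρ : LocSet L) : Sub .empty ρ
  | var (n : ℕ) : Sub (.var n) (.var n)
  | sng {ℓ : LocE L} {ρ : LocSet L} : Mem ℓ ρ → Sub (.sng ℓ) ρ
  | left {ρ ρ₁ ρ₂ : LocSet L} : Sub ρ ρ₁ → Sub ρ (.union ρ₁ ρ₂)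
  | right {ρ ρ₁ ρ₂ : LocSet L} : Sub ρ ρ₂ → Sub ρ (.union ρ₁ ρ₂)
  | union {ρ ρ₁ ρ₂ : LocSet L} : Sub ρ₁ ρ → Sub ρ₂ ρ → Sub (.union ρ₁ ρ₂) ρ
  | top (ρ : LocSet L) : Sub ρ .top

/-- The components of a location set: the variables `α`, singletons `{ℓ}` and occurrences of
`⊤` of which it is the union. -/
def comps : LocSet L → Set (LocSet L)
  | .empty => ∅
  | .var n => {.var n}
  | .sng ℓ => {.sng ℓ}
  | .union ρ₁ ρ₂ => comps ρ₁ ∪ comps ρ₂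
  | .top => {.top}

/-- `ρ ∖ {α}` for the innermost location variable `α`, as a set in the scope without `α`. -/
def dropLoc : LocSet L → LocSet L
  | .empty => .empty
  | .var n => .var n
  | .sng (.var 0) => .empty
  | .sng (.var (n + 1)) => .sng (.var n)
  | .sng (.const A) => .sng (.const A)
  | .union ρ₁ ρ₂ => .union (dropLoc ρ₁) (dropLoc ρ₂)
  | .top => .top

/-- `ρ ∖ α` for the innermost location-set variable `α`, as a set in the scope without `α`. -/
def dropSet : LocSet L → LocSet L
  | .empty => .empty
  | .var 0 => .empty
  | .var (n + 1) => .var n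
  | .sng ℓ => .sng ℓ
  | .union ρ₁ ρ₂ => .union (dropSet ρ₁) (dropSet ρ₂)
  | .top => .top

/-- A finite set of concrete locations as a location set. -/
noncomputable def ofFinset (S : Finset L) : LocSet L :=
  S.toList.foldr (fun A ρ => .union (.sng (.const A)) ρ) .empty

end LocSet

/-- Named locations `NL(ℓ)`. -/
def LocE.nl {L : Type u} : LocE L → Set L
  | .var _ => ∅
  | .const A => {A}

/-- Named locations `NL(ρ)`; in particular `NL(⊤) = ∅`. -/
def LocSet.nl {L : Type u} : LocSet L → Set L
  | .empty => ∅
  | .var _ => ∅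
  | .sng ℓ => ℓ.nl
  | .union ρ₁ ρ₂ => LocSet.nl ρ₁ ∪ LocSet.nl ρ₂
  | .top => ∅

/-! ## Kinding contexts visible to local programs -/

/-- The part of a kinding context that local programs see: `locs` variables of kind `*_loc`,
location-set variables with their kinds, and `ltys` variables of the kind `*_e`. -/
structure TyCtx where
  locs : ℕ
  sets : List SetKind
  ltys : ℕ

/-- `Γ ⊢ ℓ :: *_loc`. -/
def LocE.Kinded {L : Type u} (Γ : TyCtx) : LocE L → Prop
  | .var n => n < Γ.locs
  | .const _ => True

/-- `Γ ⊢ ρ :: *_locset` and `Γ ⊢ ρ :: *_finlocset`.  The set `⊤` is not finite. -/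
inductive LocSet.Kinded {L : Type u} (Γ : TyCtx) : LocSet L → SetKind → Prop
  | var {n : ℕ} {k : SetKind} : Γ.sets[n]? = some k → LocSet.Kinded Γ (.var n) k
  | subVar {n : ℕ} : Γ.sets[n]? = some .finlocset → LocSet.Kinded Γ (.var n) .locset
  | empty (k : SetKind) : LocSet.Kinded Γ .empty k
  | sng {ℓ : LocE L} (k : SetKind) : ℓ.Kinded Γ → LocSet.Kinded Γ (.sng ℓ) k
  | union {ρ₁ ρ₂ : LocSet L} {k : SetKind} : LocSet.Kinded Γ ρ₁ k → LocSet.Kinded Γ ρ₂ k →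
      LocSet.Kinded Γ (.union ρ₁ ρ₂) k
  | top : LocSet.Kinded Γ .top .locset

/-! ## The local language -/

/-- `(l, s, t)` is a well-formed substitution of locations, location sets and local types
from `Γ` to `Γ'`, relative to a kinding judgment for local types. -/
def WfTypeSubst {L : Type u} {T : Type v} (kinded : TyCtx → T → Prop) (Γ Γ' : TyCtx)
    (l : ℕ → LocE L) (s : ℕ → LocSet L) (t : ℕ → T) : Prop :=
  (∀ n, n < Γ.locs → (l n).Kinded Γ') ∧
  (∀ n k, Γ.sets[n]? = some k → (s n).Kinded Γ' k) ∧
  (∀ n, n < Γ.ltys → kinded Γ' (t n))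

/-- A local language over the location names `L`: types and expressions (with de Bruijn
variables and simultaneous substitution), a small-step semantics, values, a kinding and a
typing judgment, sum-like types, and first-class location names, subject to the
requirements that choreographies place on it.  A local typing context is a partial map from
variables to types. -/
structure LocalLang (L : Type u) where
  Ty : Type v
  Expr : Type w
  /-- local type variables -/
  tvar : ℕ → Ty
  /-- substitution of locations, location sets and local types in local types -/
  tsub : (ℕ → LocE L) → (ℕ → LocSet L) → (ℕ → Ty) → Ty → Ty
  /-- local variables -/
  var : ℕ → Expr
  /-- substitution of locations, location sets, local types and local expressions in local
  expressions -/
  esub : (ℕ → LocE L) → (ℕ → LocSet L) → (ℕ → Ty) → (ℕ → Expr) → Expr → Expr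
  tsub_var : ∀ l s t n, tsub l s t (tvar n) = t n
  tsub_id : ∀ a, tsub LocE.var LocSet.var tvar a = a
  tsub_tsub : ∀ l s t l' s' t' a, tsub l' s' t' (tsub l s t a) =
    tsub (fun n => (l n).subst l') (fun n => (s n).subst l' s') (fun n => tsub l' s' t' (t n)) a
  esub_var : ∀ l s t x n, esub l s t x (var n) = x n
  esub_id : ∀ e, esub LocE.var LocSet.var tvar var e = e
  esub_esub : ∀ l s t x l' s' t' x' e, esub l' s' t' x' (esub l s t x e) =
    esub (fun n => (l n).subst l') (fun n => (s n).subst l' s') (fun n => tsub l' s' t' (t n))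
      (fun n => esub l' s' t' x' (x n)) e
  /-- the small-step semantics -/
  Step : Expr → Expr → Prop
  /-- the values -/
  Val : Expr → Prop
  /-- values cannot step -/
  val_not_step : ∀ e e', Val e → ¬ Step e e'
  /-- the semantics is confluent -/
  confluent : ∀ e₁ e₂ e₃, Relation.ReflTransGen Step e₁ e₂ → Relation.ReflTransGen Step e₁ e₃ →
    ∃ e₄, Relation.ReflTransGen Step e₂ e₄ ∧ Relation.ReflTransGen Step e₃ e₄
  /-- values are stable under substitution -/
  val_esub : ∀ l s t x e, Val e → Val (esub l s t x e)
  /-- substitutions of locations and types, and renamings of variables, reflect values -/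
  val_of_esub : ∀ l s t (ξ : ℕ → ℕ) e, Val (esub l s t (fun n => var (ξ n)) e) → Val e
  /-- the kinding judgment `Γ ⊩ t :: *_e` -/
  Kinded : TyCtx → Ty → Prop
  /-- the typing judgment `Γ; Δ ⊩ e : t` -/
  Typed : TyCtx → (ℕ → Option Ty) → Expr → Ty → Prop
  kinded_tvar : ∀ Γ n, n < Γ.ltys → Kinded Γ (tvar n)
  kinded_tsub : ∀ Γ Γ' l s t a, Kinded Γ a → WfTypeSubst Kinded Γ Γ' l s t →
    Kinded Γ' (tsub l s t a)
  typed_var : ∀ Γ Δ n a, Δ n = some a → Typed Γ Δ (var n) a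
  typed_esub : ∀ Γ Γ' Δ Δ' l s t x e a, Typed Γ Δ e a → WfTypeSubst Kinded Γ Γ' l s t →
    (∀ n b, Δ n = some b → Typed Γ' Δ' (x n) (tsub l s t b)) →
    Typed Γ' Δ' (esub l s t x e) (tsub l s t a)
  /-- values have no free variables -/
  val_closed : ∀ Γ Δ e a, Val e → Typed Γ Δ e a → Typed Γ (fun _ => none) e a
  preservation : ∀ Γ Δ e e' a, Typed Γ Δ e a → Step e e' → Typed Γ Δ e' a
  progress : ∀ e a, Typed ⟨0, [], 0⟩ (fun _ => none) e a → Val e ∨ ∃ e', Step e e'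
  /-- every value of type `s` can be interpreted as a value of type `t₁` or of type `t₂` -/
  IsSum : Ty → Ty → Ty → Prop
  isSum_tsub : ∀ l s t a a₁ a₂, IsSum a a₁ a₂ →
    IsSum (tsub l s t a) (tsub l s t a₁) (tsub l s t a₂)
  /-- the extraction function -/
  getCase : Expr → Option (Expr ⊕ Expr)
  getCase_spec : ∀ Γ e a a₁ a₂, IsSum a a₁ a₂ → Val e → Typed Γ (fun _ => none) e a →
    (∃ e₁, getCase e = some (.inl e₁) ∧ Val e₁ ∧ Typed Γ (fun _ => none) e₁ a₁) ∨
    (∃ e₂, getCase e = some (.inr e₂) ∧ Val e₂ ∧ Typed Γ (fun _ => none) e₂ a₂)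
  /-- the type `loc_ρ` of (representations of) locations in `ρ` -/
  locTy : LocSet L → Ty
  /-- the type `locset_ρ` of (representations of) sets of locations in `ρ` -/
  locsetTy : LocSet L → Ty
  tsub_locTy : ∀ l s t ρ, tsub l s t (locTy ρ) = locTy (ρ.subst l s)
  tsub_locsetTy : ∀ l s t ρ, tsub l s t (locsetTy ρ) = locsetTy (ρ.subst l s)
  kinded_locTy : ∀ Γ ρ, ρ.Kinded Γ .locset → Kinded Γ (locTy ρ)
  kinded_locsetTy : ∀ Γ ρ, ρ.Kinded Γ .locset → Kinded Γ (locsetTy ρ)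
  /-- `LocRep e A`: the expression `e` represents the location `A` -/
  LocRep : Expr → L → Prop
  /-- `SetRep e S`: the expression `e` represents the set `S` of locations -/
  SetRep : Expr → Finset L → Prop
  locRep_val : ∀ e A, LocRep e A → Val e
  setRep_val : ∀ e S, SetRep e S → Val e
  locRep_unique : ∀ e A B, LocRep e A → LocRep e B → A = B
  setRep_unique : ∀ e S S', SetRep e S → SetRep e S' → S = S'
  locRep_typed : ∀ Γ e A, LocRep e A → Typed Γ (fun _ => none) e (locTy (.sng (.const A)))
  /-- every location has a representation -/
  exists_locRep : ∀ A, ∃ e, LocRep e A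
  /-- soundness of `loc_ρ` -/
  locTy_sound : ∀ Γ e ρ, Val e → Typed Γ (fun _ => none) e (locTy ρ) →
    ∃ A, LocRep e A ∧ LocSet.Mem (.const A) ρ
  /-- soundness of `locset_ρ` -/
  locsetTy_sound : ∀ Γ e ρ, Val e → Typed Γ (fun _ => none) e (locsetTy ρ) →
    ∃ S, SetRep e S ∧ ∀ A ∈ S, LocSet.Mem (.const A) ρ

/-! ## Types and choreographies -/

/-- Kinds of type variables: `*_loc`, `*_locset` or `*_finlocset`, `*_e` (local types), and
`*_ρ` (program types whose values are owned by `ρ`). -/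
inductive Kind (L : Type u) : Type u
  | loc
  | set (k : SetKind)
  | lty
  | prog (ρ : LocSet L)

/-- Choreographic types `τ`; `T` is the type of local types.
In `mu ρ τ` and `all κ ρ τ` a type variable is bound in `τ`, and in `all κ ρ τ` also in `ρ`. -/
inductive CTy (L : Type u) (T : Type v) : Type (max u v)
  | var (n : ℕ)
  /-- `t @ ρ` -/
  | located (t : T) (ρ : LocSet L)
  /-- `τ₁ →[ρ] τ₂` with latent participants `ρ` -/
  | arr (τ₁ : CTy L T) (ρ : LocSet L) (τ₂ : CTy L T)
  /-- `τ₁ +_ρ τ₂` -/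
  | sum (ρ : LocSet L) (τ₁ τ₂ : CTy L T)
  /-- `τ₁ × τ₂` -/
  | prod (τ₁ τ₂ : CTy L T)
  /-- `μ_ρ α. τ` -/
  | mu (ρ : LocSet L) (τ : CTy L T)
  /-- `∀ α :: κ [ρ]. τ` with latent participants `ρ` -/
  | all (κ : Kind L) (ρ : LocSet L) (τ : CTy L T)

/-- Arguments of type applications: a location, a location set, a local type, or a program
type. -/
inductive TArg (L : Type u) (T : Type v) : Type (max u v)
  | loc (ℓ : LocE L)
  | set (ρ : LocSet L)
  | lty (t : T)
  | prog (τ : CTy L T)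

/-- Selection directions. -/
inductive Dir
  | left
  | right

/-- Choreographies; `T` and `E` are the local types and local expressions. -/
inductive Chor (L : Type u) (T : Type v) (E : Type w) : Type (max u v w)
  | var (n : ℕ)
  /-- `ρ.e` -/
  | done (ρ : LocSet L) (e : E)
  /-- `fun_ρ F(X) := C`; in `C`, index `0` is `X` and index `1` is `F` -/
  | lam (ρ : LocSet L) (C : Chor L T E)
  /-- `C₁ ·_ρ C₂` -/
  | app (C₁ : Chor L T E) (ρ : LocSet L) (C₂ : Chor L T E)
  /-- `tfun F(α :: κ) := C`, binding `F` and `α` -/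
  | tlam (κ : Kind L) (C : Chor L T E)
  /-- `C ·_ρ t` -/
  | tapp (C : Chor L T E) (ρ : LocSet L) (a : TArg L T)
  | fold (ρ : LocSet L) (C : Chor L T E)
  | unfold (ρ : LocSet L) (C : Chor L T E)
  | pair (ρ : LocSet L) (C₁ C₂ : Chor L T E)
  | fst (ρ : LocSet L) (C : Chor L T E)
  | snd (ρ : LocSet L) (C : Chor L T E)
  | inl (ρ : LocSet L) (C : Chor L T E)
  | inr (ρ : LocSet L) (C : Chor L T E)
  /-- `case_ρ C of inl X ⇒ C₁ | inr Y ⇒ C₂`, binding a program variable in each branch -/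
  | caseOf (ρ : LocSet L) (C C₁ C₂ : Chor L T E)
  /-- `localCase_ρ C of inl x ⇒ C₁ | inr y ⇒ C₂`, binding a local variable in each branch -/
  | localCase (ρ : LocSet L) (C C₁ C₂ : Chor L T E)
  /-- `let ρ.x : t := C₁ in C₂` -/
  | letLocal (ρ : LocSet L) (t : T) (C₁ C₂ : Chor L T E)
  /-- `let ρ.α :: *_loc := C₁ in C₂` -/
  | letLoc (ρ : LocSet L) (C₁ C₂ : Chor L T E)
  /-- `let ρ.α :: k := C₁ in C₂` with `α` a location-set variable -/
  | letSet (ρ : LocSet L) (k : SetKind) (C₁ C₂ : Chor L T E)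
  /-- `C ⇝[ℓ] ρ` -/
  | send (C : Chor L T E) (ℓ : LocE L) (ρ : LocSet L)
  /-- `ℓ[d] ⇝ ρ ; C` -/
  | sync (ℓ : LocE L) (d : Dir) (ρ : LocSet L) (C : Chor L T E)
  /-- `let (α, x) := ℓ.fork() in C`, binding a location variable `α` and a local variable `x` -/
  | fork (ℓ : LocE L) (C : Chor L T E)
  /-- `kill-after A C` -/
  | killAfter (A : L) (C : Chor L T E)

/-! ## Renaming and substitution -/

/-- A renaming of the six sorts of variables: locations, location sets, local types, program
types, local variables, program variables. -/
structure Ren where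
  loc : ℕ → ℕ
  set : ℕ → ℕ
  lty : ℕ → ℕ
  ty : ℕ → ℕ
  ex : ℕ → ℕ
  ch : ℕ → ℕ

/-- The sorts of variables. -/
inductive VSort
  | loc
  | set
  | lty
  | ty
  | ex
  | ch

/-- The sort of the variables of a given kind. -/
def Kind.sort {L : Type u} : Kind L → VSort
  | .loc => .loc
  | .set _ => .set
  | .lty => .lty
  | .prog _ => .ty

/-- Lift a renaming of indices under a binder. -/
def liftNat (f : ℕ → ℕ) : ℕ → ℕ
  | 0 => 0
  | n + 1 => f n + 1

namespace Ren

/-- The identity renaming. -/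
def id : Ren := ⟨fun n => n, fun n => n, fun n => n, fun n => n, fun n => n, fun n => n⟩

/-- Apply `f` to the index maps of the sort `s`. -/
def modify (f : (ℕ → ℕ) → ℕ → ℕ) (ξ : Ren) : VSort → Ren
  | .loc => { ξ with loc := f ξ.loc }
  | .set => { ξ with set := f ξ.set }
  | .lty => { ξ with lty := f ξ.lty }
  | .ty => { ξ with ty := f ξ.ty }
  | .ex => { ξ with ex := f ξ.ex }
  | .ch => { ξ with ch := f ξ.ch }

/-- Lift a renaming under a binder of sort `s`. -/
def up (ξ : Ren) (s : VSort) : Ren := ξ.modify liftNat s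

/-- Weakening by one variable of sort `s`. -/
def shift (s : VSort) : Ren := id.modify (fun _ => Nat.succ) s

/-- The left inverse `n + 1 ↦ n` of weakening by one variable of sort `s`. -/
def lower (s : VSort) : Ren := id.modify (fun _ => Nat.pred) s

end Ren

/-- Renaming in a location. -/
def LocE.ren {L : Type u} (ξ : Ren) (ℓ : LocE L) : LocE L :=
  ℓ.subst (fun n => .var (ξ.loc n))

/-- Renaming in a location set. -/
def LocSet.ren {L : Type u} (ξ : Ren) (ρ : LocSet L) : LocSet L :=
  ρ.subst (fun n => .var (ξ.loc n)) (fun n => .var (ξ.set n))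

/-- Renaming in a kind. -/
def Kind.ren {L : Type u} (ξ : Ren) : Kind L → Kind L
  | .loc => .loc
  | .set k => .set k
  | .lty => .lty
  | .prog ρ => .prog (ρ.ren ξ)

/-- Substitution in a kind. -/
def Kind.subst {L : Type u} (l : ℕ → LocE L) (s : ℕ → LocSet L) : Kind L → Kind L
  | .loc => .loc
  | .set k => .set k
  | .lty => .lty
  | .prog ρ => .prog (ρ.subst l s)

section Substitution

variable {L : Type u} (𝓛 : LocalLang.{u, v, w} L)

/-- Renaming in a local type. -/
def LocalLang.tren (ξ : Ren) (t : 𝓛.Ty) : 𝓛.Ty :=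
  𝓛.tsub (fun n => .var (ξ.loc n)) (fun n => .var (ξ.set n)) (fun n => 𝓛.tvar (ξ.lty n)) t

/-- Renaming in a local expression. -/
def LocalLang.eren (ξ : Ren) (e : 𝓛.Expr) : 𝓛.Expr :=
  𝓛.esub (fun n => .var (ξ.loc n)) (fun n => .var (ξ.set n)) (fun n => 𝓛.tvar (ξ.lty n))
    (fun n => 𝓛.var (ξ.ex n)) e

/-- Renaming in a choreographic type. -/
def CTy.ren : Ren → CTy L 𝓛.Ty → CTy L 𝓛.Ty
  | ξ, .var n => .var (ξ.ty n)
  | ξ, .located t ρ => .located (𝓛.tren ξ t) (ρ.ren ξ)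
  | ξ, .arr τ₁ ρ τ₂ => .arr (CTy.ren ξ τ₁) (ρ.ren ξ) (CTy.ren ξ τ₂)
  | ξ, .sum ρ τ₁ τ₂ => .sum (ρ.ren ξ) (CTy.ren ξ τ₁) (CTy.ren ξ τ₂)
  | ξ, .prod τ₁ τ₂ => .prod (CTy.ren ξ τ₁) (CTy.ren ξ τ₂)
  | ξ, .mu ρ τ => .mu (ρ.ren ξ) (CTy.ren (ξ.up .ty) τ)
  | ξ, .all κ ρ τ => .all (κ.ren ξ) (ρ.ren (ξ.up κ.sort)) (CTy.ren (ξ.up κ.sort) τ)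

/-- Renaming in a type argument. -/
def TArg.ren (ξ : Ren) : TArg L 𝓛.Ty → TArg L 𝓛.Ty
  | .loc ℓ => .loc (ℓ.ren ξ)
  | .set ρ => .set (ρ.ren ξ)
  | .lty t => .lty (𝓛.tren ξ t)
  | .prog τ => .prog (τ.ren 𝓛 ξ)

/-- Renaming in a choreography. -/
def Chor.ren : Ren → Chor L 𝓛.Ty 𝓛.Expr → Chor L 𝓛.Ty 𝓛.Expr
  | ξ, .var n => .var (ξ.ch n)
  | ξ, .done ρ e => .done (ρ.ren ξ) (𝓛.eren ξ e)
  | ξ, .lam ρ C => .lam (ρ.ren ξ) (Chor.ren ((ξ.up .ch).up .ch) C)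
  | ξ, .app C₁ ρ C₂ => .app (Chor.ren ξ C₁) (ρ.ren ξ) (Chor.ren ξ C₂)
  | ξ, .tlam κ C => .tlam (κ.ren ξ) (Chor.ren ((ξ.up .ch).up κ.sort) C)
  | ξ, .tapp C ρ a => .tapp (Chor.ren ξ C) (ρ.ren ξ) (a.ren 𝓛 ξ)
  | ξ, .fold ρ C => .fold (ρ.ren ξ) (Chor.ren ξ C)
  | ξ, .unfold ρ C => .unfold (ρ.ren ξ) (Chor.ren ξ C)
  | ξ, .pair ρ C₁ C₂ => .pair (ρ.ren ξ) (Chor.ren ξ C₁) (Chor.ren ξ C₂)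
  | ξ, .fst ρ C => .fst (ρ.ren ξ) (Chor.ren ξ C)
  | ξ, .snd ρ C => .snd (ρ.ren ξ) (Chor.ren ξ C)
  | ξ, .inl ρ C => .inl (ρ.ren ξ) (Chor.ren ξ C)
  | ξ, .inr ρ C => .inr (ρ.ren ξ) (Chor.ren ξ C)
  | ξ, .caseOf ρ C C₁ C₂ => .caseOf (ρ.ren ξ) (Chor.ren ξ C) (Chor.ren (ξ.up .ch) C₁)
      (Chor.ren (ξ.up .ch) C₂)
  | ξ, .localCase ρ C C₁ C₂ => .localCase (ρ.ren ξ) (Chor.ren ξ C) (Chor.ren (ξ.up .ex) C₁)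
      (Chor.ren (ξ.up .ex) C₂)
  | ξ, .letLocal ρ t C₁ C₂ => .letLocal (ρ.ren ξ) (𝓛.tren ξ t) (Chor.ren ξ C₁)
      (Chor.ren (ξ.up .ex) C₂)
  | ξ, .letLoc ρ C₁ C₂ => .letLoc (ρ.ren ξ) (Chor.ren ξ C₁) (Chor.ren (ξ.up .loc) C₂)
  | ξ, .letSet ρ k C₁ C₂ => .letSet (ρ.ren ξ) k (Chor.ren ξ C₁) (Chor.ren (ξ.up .set) C₂)
  | ξ, .send C ℓ ρ => .send (Chor.ren ξ C) (ℓ.ren ξ) (ρ.ren ξ)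
  | ξ, .sync ℓ d ρ C => .sync (ℓ.ren ξ) d (ρ.ren ξ) (Chor.ren ξ C)
  | ξ, .fork ℓ C => .fork (ℓ.ren ξ) (Chor.ren ((ξ.up .loc).up .ex) C)
  | ξ, .killAfter A C => .killAfter A (Chor.ren ξ C)

/-- A simultaneous substitution for the four sorts of type variables. -/
structure TSubst where
  loc : ℕ → LocE L
  set : ℕ → LocSet L
  lty : ℕ → 𝓛.Ty
  ty : ℕ → CTy L 𝓛.Ty

/-- The identity substitution on types. -/
def TSubst.id : TSubst 𝓛 := ⟨.var, .var, 𝓛.tvar, .var⟩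

variable {𝓛}

/-- Rename the images of a substitution. -/
def TSubst.ren (σ : TSubst 𝓛) (ξ : Ren) : TSubst 𝓛 where
  loc n := (σ.loc n).ren ξ
  set n := (σ.set n).ren ξ
  lty n := 𝓛.tren ξ (σ.lty n)
  ty n := (σ.ty n).ren 𝓛 ξ

/-- Map the innermost variable of sort `s` to itself and the others as before. -/
def TSubst.consVar (σ : TSubst 𝓛) : VSort → TSubst 𝓛
  | .loc => { σ with loc := scons (.var 0) σ.loc }
  | .set => { σ with set := scons (.var 0) σ.set }
  | .lty => { σ with lty := scons (𝓛.tvar 0) σ.lty }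
  | .ty => { σ with ty := scons (.var 0) σ.ty }
  | .ex => σ
  | .ch => σ

/-- Lift a substitution under a binder of sort `s`. -/
def TSubst.up (σ : TSubst 𝓛) (s : VSort) : TSubst 𝓛 := (σ.ren (Ren.shift s)).consVar s

/-- Map the innermost variable (of the sort of `a`) to `a` and the others as before. -/
def TSubst.cons (σ : TSubst 𝓛) : TArg L 𝓛.Ty → TSubst 𝓛
  | .loc ℓ => { σ with loc := scons ℓ σ.loc }
  | .set ρ => { σ with set := scons ρ σ.set }
  | .lty t => { σ with lty := scons t σ.lty }
  | .prog τ => { σ with ty := scons τ σ.ty }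

/-- The substitution `[α ↦ a]` for the innermost variable `α` (of the sort of `a`). -/
def TSubst.inst (a : TArg L 𝓛.Ty) : TSubst 𝓛 := (TSubst.id 𝓛).cons a

/-- Substitution in a choreographic type. -/
def CTy.subst : TSubst 𝓛 → CTy L 𝓛.Ty → CTy L 𝓛.Ty
  | σ, .var n => σ.ty n
  | σ, .located t ρ => .located (𝓛.tsub σ.loc σ.set σ.lty t) (ρ.subst σ.loc σ.set)
  | σ, .arr τ₁ ρ τ₂ => .arr (CTy.subst σ τ₁) (ρ.subst σ.loc σ.set) (CTy.subst σ τ₂)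
  | σ, .sum ρ τ₁ τ₂ => .sum (ρ.subst σ.loc σ.set) (CTy.subst σ τ₁) (CTy.subst σ τ₂)
  | σ, .prod τ₁ τ₂ => .prod (CTy.subst σ τ₁) (CTy.subst σ τ₂)
  | σ, .mu ρ τ => .mu (ρ.subst σ.loc σ.set) (CTy.subst (σ.up .ty) τ)
  | σ, .all κ ρ τ => .all (κ.subst σ.loc σ.set)
      (ρ.subst (σ.up κ.sort).loc (σ.up κ.sort).set) (CTy.subst (σ.up κ.sort) τ)

/-- Substitution in a type argument. -/
def TArg.subst (σ : TSubst 𝓛) : TArg L 𝓛.Ty → TArg L 𝓛.Ty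
  | .loc ℓ => .loc (ℓ.subst σ.loc)
  | .set ρ => .set (ρ.subst σ.loc σ.set)
  | .lty t => .lty (𝓛.tsub σ.loc σ.set σ.lty t)
  | .prog τ => .prog (τ.subst σ)

variable (𝓛) in
/-- A simultaneous substitution for all six sorts of variables. -/
structure Subst where
  tsubst : TSubst 𝓛
  ex : ℕ → 𝓛.Expr
  ch : ℕ → Chor L 𝓛.Ty 𝓛.Expr

namespace Subst

variable (𝓛) in
/-- The identity substitution. -/
def id : Subst 𝓛 := ⟨TSubst.id 𝓛, 𝓛.var, .var⟩

/-- Rename the images of a substitution. -/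
def ren (σ : Subst 𝓛) (ξ : Ren) : Subst 𝓛 where
  tsubst := σ.tsubst.ren ξ
  ex n := 𝓛.eren ξ (σ.ex n)
  ch n := (σ.ch n).ren 𝓛 ξ

/-- Map the innermost variable of sort `s` to itself and the others as before. -/
def consVar (σ : Subst 𝓛) : VSort → Subst 𝓛
  | .ex => { σ with ex := scons (𝓛.var 0) σ.ex }
  | .ch => { σ with ch := scons (.var 0) σ.ch }
  | s => { σ with tsubst := σ.tsubst.consVar s }

/-- Lift a substitution under a binder of sort `s`. -/
def up (σ : Subst 𝓛) (s : VSort) : Subst 𝓛 := (σ.ren (Ren.shift s)).consVar s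

/-- Map the innermost program variable to `C` and the others as before. -/
def consCh (σ : Subst 𝓛) (C : Chor L 𝓛.Ty 𝓛.Expr) : Subst 𝓛 := { σ with ch := scons C σ.ch }

/-- Map the innermost local variable to `e` and the others as before. -/
def consEx (σ : Subst 𝓛) (e : 𝓛.Expr) : Subst 𝓛 := { σ with ex := scons e σ.ex }

/-- Map the innermost type variable (of the sort of `a`) to `a` and the others as before. -/
def consTy (σ : Subst 𝓛) (a : TArg L 𝓛.Ty) : Subst 𝓛 := { σ with tsubst := σ.tsubst.cons a }

end Subst

/-- Substitution in a choreography. -/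
def Chor.subst : Subst 𝓛 → Chor L 𝓛.Ty 𝓛.Expr → Chor L 𝓛.Ty 𝓛.Expr
  | σ, .var n => σ.ch n
  | σ, .done ρ e => .done (ρ.subst σ.tsubst.loc σ.tsubst.set)
      (𝓛.esub σ.tsubst.loc σ.tsubst.set σ.tsubst.lty σ.ex e)
  | σ, .lam ρ C => .lam (ρ.subst σ.tsubst.loc σ.tsubst.set) (Chor.subst ((σ.up .ch).up .ch) C)
  | σ, .app C₁ ρ C₂ => .app (Chor.subst σ C₁) (ρ.subst σ.tsubst.loc σ.tsubst.set)
      (Chor.subst σ C₂)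
  | σ, .tlam κ C => .tlam (κ.subst σ.tsubst.loc σ.tsubst.set)
      (Chor.subst ((σ.up .ch).up κ.sort) C)
  | σ, .tapp C ρ a => .tapp (Chor.subst σ C) (ρ.subst σ.tsubst.loc σ.tsubst.set)
      (a.subst σ.tsubst)
  | σ, .fold ρ C => .fold (ρ.subst σ.tsubst.loc σ.tsubst.set) (Chor.subst σ C)
  | σ, .unfold ρ C => .unfold (ρ.subst σ.tsubst.loc σ.tsubst.set) (Chor.subst σ C)
  | σ, .pair ρ C₁ C₂ => .pair (ρ.subst σ.tsubst.loc σ.tsubst.set) (Chor.subst σ C₁)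
      (Chor.subst σ C₂)
  | σ, .fst ρ C => .fst (ρ.subst σ.tsubst.loc σ.tsubst.set) (Chor.subst σ C)
  | σ, .snd ρ C => .snd (ρ.subst σ.tsubst.loc σ.tsubst.set) (Chor.subst σ C)
  | σ, .inl ρ C => .inl (ρ.subst σ.tsubst.loc σ.tsubst.set) (Chor.subst σ C)
  | σ, .inr ρ C => .inr (ρ.subst σ.tsubst.loc σ.tsubst.set) (Chor.subst σ C)
  | σ, .caseOf ρ C C₁ C₂ => .caseOf (ρ.subst σ.tsubst.loc σ.tsubst.set) (Chor.subst σ C)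
      (Chor.subst (σ.up .ch) C₁) (Chor.subst (σ.up .ch) C₂)
  | σ, .localCase ρ C C₁ C₂ => .localCase (ρ.subst σ.tsubst.loc σ.tsubst.set) (Chor.subst σ C)
      (Chor.subst (σ.up .ex) C₁) (Chor.subst (σ.up .ex) C₂)
  | σ, .letLocal ρ t C₁ C₂ => .letLocal (ρ.subst σ.tsubst.loc σ.tsubst.set)
      (𝓛.tsub σ.tsubst.loc σ.tsubst.set σ.tsubst.lty t) (Chor.subst σ C₁)
      (Chor.subst (σ.up .ex) C₂)
  | σ, .letLoc ρ C₁ C₂ => .letLoc (ρ.subst σ.tsubst.loc σ.tsubst.set) (Chor.subst σ C₁)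
      (Chor.subst (σ.up .loc) C₂)
  | σ, .letSet ρ k C₁ C₂ => .letSet (ρ.subst σ.tsubst.loc σ.tsubst.set) k (Chor.subst σ C₁)
      (Chor.subst (σ.up .set) C₂)
  | σ, .send C ℓ ρ => .send (Chor.subst σ C) (ℓ.subst σ.tsubst.loc)
      (ρ.subst σ.tsubst.loc σ.tsubst.set)
  | σ, .sync ℓ d ρ C => .sync (ℓ.subst σ.tsubst.loc) d (ρ.subst σ.tsubst.loc σ.tsubst.set)
      (Chor.subst σ C)
  | σ, .fork ℓ C => .fork (ℓ.subst σ.tsubst.loc) (Chor.subst ((σ.up .loc).up .ex) C)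
  | σ, .killAfter A C => .killAfter A (Chor.subst σ C)

end Substitution

/-! ## Named locations, spawned locations, blocked locations -/

/-- Names occurring in a kind. -/
def Kind.names {L : Type u} : Kind L → Set L
  | .prog ρ => ρ.nl
  | _ => ∅

/-- Named locations `NL(τ)`. -/
def CTy.nl {L : Type u} {T : Type v} : CTy L T → Set L
  | .var _ => ∅
  | .located _ ρ => ρ.nl
  | .arr τ₁ ρ τ₂ => CTy.nl τ₁ ∪ CTy.nl τ₂ ∪ ρ.nl
  | .sum ρ τ₁ τ₂ => CTy.nl τ₁ ∪ CTy.nl τ₂ ∪ ρ.nl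
  | .prod τ₁ τ₂ => CTy.nl τ₁ ∪ CTy.nl τ₂
  | .mu ρ τ => ρ.nl ∪ CTy.nl τ
  | .all _ ρ τ => ρ.nl ∪ CTy.nl τ

/-- The names occurring in a type, including those in the kinds of its bound variables. -/
def CTy.names {L : Type u} {T : Type v} : CTy L T → Set L
  | .var _ => ∅
  | .located _ ρ => ρ.nl
  | .arr τ₁ ρ τ₂ => CTy.names τ₁ ∪ CTy.names τ₂ ∪ ρ.nl
  | .sum ρ τ₁ τ₂ => CTy.names τ₁ ∪ CTy.names τ₂ ∪ ρ.nl
  | .prod τ₁ τ₂ => CTy.names τ₁ ∪ CTy.names τ₂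
  | .mu ρ τ => ρ.nl ∪ CTy.names τ
  | .all κ ρ τ => κ.names ∪ ρ.nl ∪ CTy.names τ

/-- The names occurring in a type argument. -/
def TArg.names {L : Type u} {T : Type v} : TArg L T → Set L
  | .loc ℓ => ℓ.nl
  | .set ρ => ρ.nl
  | .lty _ => ∅
  | .prog τ => τ.names

namespace Chor

variable {L : Type u} {T : Type v} {E : Type w}

/-- The names occurring in a choreography: in its location and location-set annotations, type
arguments, kind annotations and `kill-after` expressions. -/
def names : Chor L T E → Set L
  | .var _ => ∅
  | .done ρ _ => ρ.nl
  | .lam ρ C => ρ.nl ∪ names C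
  | .app C₁ ρ C₂ => ρ.nl ∪ names C₁ ∪ names C₂
  | .tlam κ C => κ.names ∪ names C
  | .tapp C ρ a => names C ∪ ρ.nl ∪ a.names
  | .fold ρ C => ρ.nl ∪ names C
  | .unfold ρ C => ρ.nl ∪ names C
  | .pair ρ C₁ C₂ => ρ.nl ∪ names C₁ ∪ names C₂
  | .fst ρ C => ρ.nl ∪ names C
  | .snd ρ C => ρ.nl ∪ names C
  | .inl ρ C => ρ.nl ∪ names C
  | .inr ρ C => ρ.nl ∪ names C
  | .caseOf ρ C C₁ C₂ => ρ.nl ∪ names C ∪ names C₁ ∪ names C₂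
  | .localCase ρ C C₁ C₂ => ρ.nl ∪ names C ∪ names C₁ ∪ names C₂
  | .letLocal ρ _ C₁ C₂ => ρ.nl ∪ names C₁ ∪ names C₂
  | .letLoc ρ C₁ C₂ => ρ.nl ∪ names C₁ ∪ names C₂
  | .letSet ρ _ C₁ C₂ => ρ.nl ∪ names C₁ ∪ names C₂
  | .send C ℓ ρ => ℓ.nl ∪ ρ.nl ∪ names C
  | .sync ℓ _ ρ C => ℓ.nl ∪ ρ.nl ∪ names C
  | .fork ℓ C => ℓ.nl ∪ names C
  | .killAfter A C => {A} ∪ names C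

/-- Spawned locations `SN(C)`. -/
def spawned : Chor L T E → Set L
  | .var _ => ∅
  | .done _ _ => ∅
  | .lam _ C => spawned C
  | .app C₁ _ C₂ => spawned C₁ ∪ spawned C₂
  | .tlam _ C => spawned C
  | .tapp C _ _ => spawned C
  | .fold _ C => spawned C
  | .unfold _ C => spawned C
  | .pair _ C₁ C₂ => spawned C₁ ∪ spawned C₂
  | .fst _ C => spawned C
  | .snd _ C => spawned C
  | .inl _ C => spawned C
  | .inr _ C => spawned C
  | .caseOf _ C C₁ C₂ => spawned C ∪ spawned C₁ ∪ spawned C₂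
  | .localCase _ C C₁ C₂ => spawned C ∪ spawned C₁ ∪ spawned C₂
  | .letLocal _ _ C₁ C₂ => spawned C₁ ∪ spawned C₂
  | .letLoc _ C₁ C₂ => spawned C₁ ∪ spawned C₂
  | .letSet _ _ C₁ C₂ => spawned C₁ ∪ spawned C₂
  | .send C _ _ => spawned C
  | .sync _ _ _ C => spawned C
  | .fork _ C => spawned C
  | .killAfter A C => {A} ∪ spawned C

/-- Blocked locations of a choreography. -/
def cloc : Chor L T E → LocSet L
  | .var _ => .empty
  | .done ρ _ => ρ
  | .lam _ _ => .empty
  | .app C₁ ρ C₂ => .union (.union (cloc C₁) (cloc C₂)) ρ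
  | .tlam _ _ => .empty
  | .tapp C ρ _ => .union (cloc C) ρ
  | .fold _ C => cloc C
  | .unfold ρ C => .union (cloc C) ρ
  | .pair _ C₁ C₂ => .union (cloc C₁) (cloc C₂)
  | .fst ρ C => .union (cloc C) ρ
  | .snd ρ C => .union (cloc C) ρ
  | .inl _ C => cloc C
  | .inr _ C => cloc C
  | .caseOf ρ C C₁ C₂ => .union (.union (.union (cloc C) (cloc C₁)) (cloc C₂)) ρ
  | .localCase ρ C C₁ C₂ => .union (.union (.union (cloc C) (cloc C₁)) (cloc C₂)) ρ
  | .letLocal ρ _ C₁ C₂ => .union (.union (cloc C₁) (cloc C₂)) ρ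
  | .letLoc ρ C₁ C₂ => .union (.union (cloc C₁) (cloc C₂).dropLoc) ρ
  | .letSet ρ _ C₁ C₂ => .union (.union (cloc C₁) (cloc C₂).dropSet) ρ
  | .send C ℓ ρ => .union (.union (cloc C) (.sng ℓ)) ρ
  | .sync ℓ _ ρ C => .union (.union (.sng ℓ) ρ) (cloc C)
  | .fork ℓ C => .union (.sng ℓ) (cloc C).dropLoc
  | .killAfter A C => .union (.sng (.const A)) (cloc C)

end Chor

/-- Choreography values. -/
inductive Chor.IsVal {L : Type u} (𝓛 : LocalLang.{u, v, w} L) : Chor L 𝓛.Ty 𝓛.Expr → Prop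
  | done {ρ : LocSet L} {e : 𝓛.Expr} : 𝓛.Val e → IsVal 𝓛 (.done ρ e)
  | lam {ρ : LocSet L} {C : Chor L 𝓛.Ty 𝓛.Expr} : IsVal 𝓛 (.lam ρ C)
  | tlam {κ : Kind L} {C : Chor L 𝓛.Ty 𝓛.Expr} : IsVal 𝓛 (.tlam κ C)
  | pair {ρ : LocSet L} {V₁ V₂ : Chor L 𝓛.Ty 𝓛.Expr} : IsVal 𝓛 V₁ → IsVal 𝓛 V₂ →
      IsVal 𝓛 (.pair ρ V₁ V₂)
  | inl {ρ : LocSet L} {V : Chor L 𝓛.Ty 𝓛.Expr} : IsVal 𝓛 V → IsVal 𝓛 (.inl ρ V)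
  | inr {ρ : LocSet L} {V : Chor L 𝓛.Ty 𝓛.Expr} : IsVal 𝓛 V → IsVal 𝓛 (.inr ρ V)
  | fold {ρ : LocSet L} {V : Chor L 𝓛.Ty 𝓛.Expr} : IsVal 𝓛 V → IsVal 𝓛 (.fold ρ V)

/-! ## Kinding -/

/-- A kinding context: the part that is visible to local programs, and the owners `ρ` of the
program-type variables `α :: *_ρ`. -/
structure KCtx (L : Type u) extends TyCtx where
  progs : List (LocSet L)

/-- Extension of a kinding context by a type variable. -/
def KCtx.ext {L : Type u} (Γ : KCtx L) : Kind L → KCtx L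
  | .loc => { Γ with locs := Γ.locs + 1, progs := Γ.progs.map (LocSet.ren (Ren.shift .loc)) }
  | .set k => { Γ with sets := k :: Γ.sets, progs := Γ.progs.map (LocSet.ren (Ren.shift .set)) }
  | .lty => { Γ with ltys := Γ.ltys + 1 }
  | .prog ρ => { Γ with progs := ρ :: Γ.progs }

/-- Kinds of locations and location sets. -/
def Kind.IsLoc {L : Type u} : Kind L → Prop
  | .loc => True
  | .set _ => True
  | .lty => False
  | .prog _ => False

/-- Well-formed kinds. -/
def Kind.Wf {L : Type u} (Γ : KCtx L) : Kind L → Prop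
  | .prog ρ => ρ.Kinded Γ.toTyCtx .locset
  | _ => True

section Judgments

variable {L : Type u} (𝓛 : LocalLang.{u, v, w} L)

/-- The kinding judgment `Γ ⊢ τ :: *_ρ` for program types.  Here `ρ` is the set of locations
that own the values of type `τ`. -/
inductive CTy.Kinded : KCtx L → CTy L 𝓛.Ty → LocSet L → Prop
  | var {Γ : KCtx L} {n : ℕ} {ρ : LocSet L} : Γ.progs[n]? = some ρ → CTy.Kinded Γ (.var n) ρ
  | located {Γ : KCtx L} {t : 𝓛.Ty} {ρ : LocSet L} : 𝓛.Kinded Γ.toTyCtx t →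
      ρ.Kinded Γ.toTyCtx .finlocset → CTy.Kinded Γ (.located t ρ) ρ
  | arr {Γ : KCtx L} {τ₁ τ₂ : CTy L 𝓛.Ty} {ρ ρ₁ ρ₂ : LocSet L} : CTy.Kinded Γ τ₁ ρ₁ →
      CTy.Kinded Γ τ₂ ρ₂ → ρ.Kinded Γ.toTyCtx .locset →
      CTy.Kinded Γ (.arr τ₁ ρ τ₂) (.union (.union ρ₁ ρ₂) ρ)
  | prod {Γ : KCtx L} {τ₁ τ₂ : CTy L 𝓛.Ty} {ρ₁ ρ₂ : LocSet L} : CTy.Kinded Γ τ₁ ρ₁ →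
      CTy.Kinded Γ τ₂ ρ₂ → CTy.Kinded Γ (.prod τ₁ τ₂) (.union ρ₁ ρ₂)
  | sum {Γ : KCtx L} {τ₁ τ₂ : CTy L 𝓛.Ty} {ρ ρ₁ ρ₂ : LocSet L} : CTy.Kinded Γ τ₁ ρ₁ →
      CTy.Kinded Γ τ₂ ρ₂ → ρ.Kinded Γ.toTyCtx .locset → LocSet.Sub (.union ρ₁ ρ₂) ρ →
      CTy.Kinded Γ (.sum ρ τ₁ τ₂) ρ
  | mu {Γ : KCtx L} {τ : CTy L 𝓛.Ty} {ρ ρ' : LocSet L} : ρ.Kinded Γ.toTyCtx .locset →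
      CTy.Kinded (Γ.ext (.prog ρ)) τ ρ' → LocSet.Sub ρ' ρ → CTy.Kinded Γ (.mu ρ τ) ρ
  | allLoc {Γ : KCtx L} {κ : Kind L} {τ : CTy L 𝓛.Ty} {ρ ρ' : LocSet L} : κ.IsLoc →
      ρ.Kinded (Γ.ext κ).toTyCtx .locset → CTy.Kinded (Γ.ext κ) τ ρ' →
      CTy.Kinded Γ (.all κ ρ τ) .top
  | all {Γ : KCtx L} {κ : Kind L} {τ : CTy L 𝓛.Ty} {ρ ρ' : LocSet L} : ¬ κ.IsLoc → κ.Wf Γ →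
      ρ.Kinded (Γ.ext κ).toTyCtx .locset → CTy.Kinded (Γ.ext κ) τ ρ' →
      CTy.Kinded Γ (.all κ ρ τ) (.union ρ ρ')

/-- The kinding judgment `Γ ⊢ t :: κ` for the arguments of type applications. -/
inductive TArg.Kinded (Γ : KCtx L) : TArg L 𝓛.Ty → Kind L → Prop
  | loc {ℓ : LocE L} : ℓ.Kinded Γ.toTyCtx → TArg.Kinded Γ (.loc ℓ) .loc
  | set {ρ : LocSet L} {k : SetKind} : ρ.Kinded Γ.toTyCtx k → TArg.Kinded Γ (.set ρ) (.set k)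
  | lty {t : 𝓛.Ty} : 𝓛.Kinded Γ.toTyCtx t → TArg.Kinded Γ (.lty t) .lty
  | prog {τ : CTy L 𝓛.Ty} {ρ : LocSet L} : CTy.Kinded 𝓛 Γ τ ρ →
      TArg.Kinded Γ (.prog τ) (.prog ρ)

/-! ## The augmented type system -/

/-- A typing context: a kinding context, the local variables `ρ.x : t`, and the program
variables `X : τ`. -/
structure Ctx where
  kctx : KCtx L
  locals : List (LocSet L × 𝓛.Ty)
  vars : List (CTy L 𝓛.Ty)

variable {𝓛}

namespace Ctx

/-- Extension by a type variable. -/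
def extTy (Γ : Ctx 𝓛) (κ : Kind L) : Ctx 𝓛 where
  kctx := Γ.kctx.ext κ
  locals := Γ.locals.map fun p => (p.1.ren (Ren.shift κ.sort), 𝓛.tren (Ren.shift κ.sort) p.2)
  vars := Γ.vars.map (CTy.ren 𝓛 (Ren.shift κ.sort))

/-- Extension by a local variable `ρ.x : t`. -/
def extLocal (Γ : Ctx 𝓛) (ρ : LocSet L) (t : 𝓛.Ty) : Ctx 𝓛 :=
  { Γ with locals := (ρ, t) :: Γ.locals }

/-- Extension by a program variable `X : τ`. -/
def extVar (Γ : Ctx 𝓛) (τ : CTy L 𝓛.Ty) : Ctx 𝓛 := { Γ with vars := τ :: Γ.vars }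

open scoped Classical in
/-- The projection of the local variables to `ρ`: only the variables `ρ'.x : t` with `ρ ⊆ ρ'`
are kept. -/
noncomputable def proj (Γ : Ctx 𝓛) (ρ : LocSet L) (n : ℕ) : Option 𝓛.Ty :=
  match Γ.locals[n]? with
  | some p => if LocSet.Sub ρ p.1 then some p.2 else none
  | none => none

/-- The names occurring in a context. -/
def names (Γ : Ctx 𝓛) : Set L :=
  {A | (∃ ρ ∈ Γ.kctx.progs, A ∈ ρ.nl) ∨ (∃ p ∈ Γ.locals, A ∈ p.1.nl) ∨
    ∃ τ ∈ Γ.vars, A ∈ τ.names}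

end Ctx

variable (𝓛)

/-- The augmented typing judgment `Γ ⊢⁺ C : τ ▷ ρ`, where `ρ` is the set of participants.

In the rules for functions and type functions the latent participants of the type include
all components of the participants of the body. -/
inductive HasType : Ctx 𝓛 → Chor L 𝓛.Ty 𝓛.Expr → CTy L 𝓛.Ty → LocSet L → Prop
  | var {Γ : Ctx 𝓛} {n : ℕ} {τ : CTy L 𝓛.Ty} : Γ.vars[n]? = some τ →
      HasType Γ (.var n) τ .empty
  | doneVal {Γ : Ctx 𝓛} {ρ : LocSet L} {e : 𝓛.Expr} {t : 𝓛.Ty} :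
      𝓛.Kinded Γ.kctx.toTyCtx t → ρ.Kinded Γ.kctx.toTyCtx .finlocset →
      𝓛.Typed Γ.kctx.toTyCtx (Γ.proj ρ) e t → 𝓛.Val e →
      HasType Γ (.done ρ e) (.located t ρ) .empty
  | done {Γ : Ctx 𝓛} {ρ : LocSet L} {e : 𝓛.Expr} {t : 𝓛.Ty} :
      𝓛.Kinded Γ.kctx.toTyCtx t → ρ.Kinded Γ.kctx.toTyCtx .finlocset →
      𝓛.Typed Γ.kctx.toTyCtx (Γ.proj ρ) e t → ¬ 𝓛.Val e →
      HasType Γ (.done ρ e) (.located t ρ) ρ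
  | lam {Γ : Ctx 𝓛} {C : Chor L 𝓛.Ty 𝓛.Expr} {τ₁ τ₂ : CTy L 𝓛.Ty} {ρ ρ' ρb : LocSet L} :
      CTy.Kinded 𝓛 Γ.kctx (.arr τ₁ ρ τ₂) ρ' →
      HasType ((Γ.extVar (.arr τ₁ ρ τ₂)).extVar τ₁) C τ₂ ρb → ρb.comps ⊆ ρ.comps →
      C.spawned = ∅ →
      HasType Γ (.lam ρ' C) (.arr τ₁ ρ τ₂) .empty
  | app {Γ : Ctx 𝓛} {C₁ C₂ : Chor L 𝓛.Ty 𝓛.Expr} {τ₁ τ₂ : CTy L 𝓛.Ty}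
      {ρ ρ' ρ₁ ρ₂ : LocSet L} :
      HasType Γ C₁ (.arr τ₁ ρ τ₂) ρ₁ → HasType Γ C₂ τ₁ ρ₂ →
      CTy.Kinded 𝓛 Γ.kctx (.arr τ₁ ρ τ₂) ρ' →
      Disjoint ρ'.nl C₁.spawned → Disjoint ρ'.nl C₂.spawned →
      Disjoint ρ₁.nl C₂.spawned → Disjoint ρ₂.nl C₁.spawned →
      HasType Γ (.app C₁ ρ' C₂) τ₂ (.union (.union ρ₁ ρ₂) ρ')
  | tlam {Γ : Ctx 𝓛} {κ : Kind L} {C : Chor L 𝓛.Ty 𝓛.Expr} {τ : CTy L 𝓛.Ty}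
      {ρ ρ' ρb : LocSet L} :
      CTy.Kinded 𝓛 Γ.kctx (.all κ ρ τ) ρ' →
      HasType ((Γ.extVar (.all κ ρ τ)).extTy κ) C τ ρb → ρb.comps ⊆ ρ.comps →
      C.spawned = ∅ →
      HasType Γ (.tlam κ C) (.all κ ρ τ) .empty
  | tapp {Γ : Ctx 𝓛} {κ : Kind L} {C : Chor L 𝓛.Ty 𝓛.Expr} {τ : CTy L 𝓛.Ty}
      {a : TArg L 𝓛.Ty} {ρ ρ₁ ρ₂ ρ' : LocSet L} :
      HasType Γ C (.all κ ρ τ) ρ₁ → TArg.Kinded 𝓛 Γ.kctx a κ →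
      CTy.Kinded 𝓛 Γ.kctx (τ.subst (.inst a)) ρ₂ →
      ρ' = .union ρ₂ (ρ.subst (TSubst.inst a).loc (TSubst.inst a).set) →
      Disjoint ρ'.nl C.spawned →
      HasType Γ (.tapp C ρ' a) (τ.subst (.inst a)) (.union ρ₁ ρ')
  | pair {Γ : Ctx 𝓛} {C₁ C₂ : Chor L 𝓛.Ty 𝓛.Expr} {τ₁ τ₂ : CTy L 𝓛.Ty} {ρ ρ₁ ρ₂ : LocSet L} :
      HasType Γ C₁ τ₁ ρ₁ → HasType Γ C₂ τ₂ ρ₂ → CTy.Kinded 𝓛 Γ.kctx (.prod τ₁ τ₂) ρ →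
      Disjoint ρ₁.nl C₂.spawned → Disjoint ρ₂.nl C₁.spawned →
      HasType Γ (.pair ρ C₁ C₂) (.prod τ₁ τ₂) (.union ρ₁ ρ₂)
  | fst {Γ : Ctx 𝓛} {C : Chor L 𝓛.Ty 𝓛.Expr} {τ₁ τ₂ : CTy L 𝓛.Ty} {ρ ρ₁ : LocSet L} :
      HasType Γ C (.prod τ₁ τ₂) ρ₁ → CTy.Kinded 𝓛 Γ.kctx (.prod τ₁ τ₂) ρ →
      Disjoint ρ.nl C.spawned →
      HasType Γ (.fst ρ C) τ₁ (.union ρ₁ ρ)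
  | snd {Γ : Ctx 𝓛} {C : Chor L 𝓛.Ty 𝓛.Expr} {τ₁ τ₂ : CTy L 𝓛.Ty} {ρ ρ₁ : LocSet L} :
      HasType Γ C (.prod τ₁ τ₂) ρ₁ → CTy.Kinded 𝓛 Γ.kctx (.prod τ₁ τ₂) ρ →
      Disjoint ρ.nl C.spawned →
      HasType Γ (.snd ρ C) τ₂ (.union ρ₁ ρ)
  | inl {Γ : Ctx 𝓛} {C : Chor L 𝓛.Ty 𝓛.Expr} {τ₁ τ₂ : CTy L 𝓛.Ty} {ρ ρ₁ : LocSet L} :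
      HasType Γ C τ₁ ρ₁ → CTy.Kinded 𝓛 Γ.kctx (.sum ρ τ₁ τ₂) ρ → Disjoint ρ.nl C.spawned →
      HasType Γ (.inl ρ C) (.sum ρ τ₁ τ₂) ρ₁
  | inr {Γ : Ctx 𝓛} {C : Chor L 𝓛.Ty 𝓛.Expr} {τ₁ τ₂ : CTy L 𝓛.Ty} {ρ ρ₁ : LocSet L} :
      HasType Γ C τ₂ ρ₁ → CTy.Kinded 𝓛 Γ.kctx (.sum ρ τ₁ τ₂) ρ → Disjoint ρ.nl C.spawned →
      HasType Γ (.inr ρ C) (.sum ρ τ₁ τ₂) ρ₁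
  | caseOf {Γ : Ctx 𝓛} {C C₁ C₂ : Chor L 𝓛.Ty 𝓛.Expr} {τ τ₁ τ₂ : CTy L 𝓛.Ty}
      {ρ ρ₀ ρ₁ ρ₂ : LocSet L} :
      HasType Γ C (.sum ρ τ₁ τ₂) ρ₀ → HasType (Γ.extVar τ₁) C₁ τ ρ₁ →
      HasType (Γ.extVar τ₂) C₂ τ ρ₂ → C₁.spawned = C₂.spawned →
      Disjoint ρ.nl C.spawned → Disjoint ρ.nl C₁.spawned → Disjoint ρ.nl C₂.spawned →
      Disjoint ρ₀.nl C₁.spawned → Disjoint ρ₀.nl C₂.spawned →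
      Disjoint ρ₁.nl C.spawned → Disjoint ρ₂.nl C.spawned →
      HasType Γ (.caseOf ρ C C₁ C₂) τ (.union (.union (.union ρ₀ ρ₁) ρ₂) ρ)
  | localCase {Γ : Ctx 𝓛} {C C₁ C₂ : Chor L 𝓛.Ty 𝓛.Expr} {τ : CTy L 𝓛.Ty} {t t₁ t₂ : 𝓛.Ty}
      {ρ ρ' ρ₀ ρ₁ ρ₂ : LocSet L} :
      HasType Γ C (.located t ρ') ρ₀ → 𝓛.IsSum t t₁ t₂ → LocSet.Sub ρ ρ' →
      HasType (Γ.extLocal ρ t₁) C₁ τ ρ₁ → HasType (Γ.extLocal ρ t₂) C₂ τ ρ₂ →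
      C₁.spawned = C₂.spawned →
      Disjoint ρ.nl C.spawned → Disjoint ρ.nl C₁.spawned → Disjoint ρ.nl C₂.spawned →
      Disjoint ρ₀.nl C₁.spawned → Disjoint ρ₀.nl C₂.spawned →
      Disjoint ρ₁.nl C.spawned → Disjoint ρ₂.nl C.spawned →
      HasType Γ (.localCase ρ C C₁ C₂) τ (.union (.union (.union ρ₀ ρ₁) ρ₂) ρ)
  | fold {Γ : Ctx 𝓛} {C : Chor L 𝓛.Ty 𝓛.Expr} {τ : CTy L 𝓛.Ty} {ρ ρ₁ : LocSet L} :
      HasType Γ C (τ.subst (.inst (.prog (.mu ρ τ)))) ρ₁ → CTy.Kinded 𝓛 Γ.kctx (.mu ρ τ) ρ →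
      Disjoint ρ.nl C.spawned →
      HasType Γ (.fold ρ C) (.mu ρ τ) ρ₁
  | unfold {Γ : Ctx 𝓛} {C : Chor L 𝓛.Ty 𝓛.Expr} {τ : CTy L 𝓛.Ty} {ρ ρ₁ : LocSet L} :
      HasType Γ C (.mu ρ τ) ρ₁ → Disjoint ρ.nl C.spawned →
      HasType Γ (.unfold ρ C) (τ.subst (.inst (.prog (.mu ρ τ)))) (.union ρ₁ ρ)
  | letLocal {Γ : Ctx 𝓛} {C₁ C₂ : Chor L 𝓛.Ty 𝓛.Expr} {τ : CTy L 𝓛.Ty} {t : 𝓛.Ty}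
      {ρ ρ' ρ₁ ρ₂ : LocSet L} :
      HasType Γ C₁ (.located t ρ') ρ₁ → LocSet.Sub ρ ρ' →
      HasType (Γ.extLocal ρ t) C₂ τ ρ₂ →
      Disjoint ρ.nl C₁.spawned → Disjoint ρ.nl C₂.spawned →
      Disjoint ρ₁.nl C₂.spawned → Disjoint ρ₂.nl C₁.spawned →
      HasType Γ (.letLocal ρ t C₁ C₂) τ (.union (.union ρ₁ ρ₂) ρ)
  | letLoc {Γ : Ctx 𝓛} {C₁ C₂ : Chor L 𝓛.Ty 𝓛.Expr} {τ : CTy L 𝓛.Ty}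
      {ρ ρt ρ' ρτ ρ₁ ρ₂ : LocSet L} :
      HasType Γ C₁ (.located (𝓛.locTy ρt) ρ') ρ₁ → LocSet.Sub ρt ρ → LocSet.Sub ρ ρ' →
      ρ.Kinded Γ.kctx.toTyCtx .finlocset → CTy.Kinded 𝓛 Γ.kctx τ ρτ →
      HasType (Γ.extTy .loc) C₂ (τ.ren 𝓛 (Ren.shift .loc)) ρ₂ →
      Disjoint ρ.nl C₁.spawned → Disjoint ρ.nl C₂.spawned →
      Disjoint ρ₁.nl C₂.spawned → Disjoint ρ₂.nl C₁.spawned →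
      HasType Γ (.letLoc ρ C₁ C₂) τ (.union (.union ρ₁ ρ₂.dropLoc) ρ)
  | letSet {Γ : Ctx 𝓛} {k : SetKind} {C₁ C₂ : Chor L 𝓛.Ty 𝓛.Expr} {τ : CTy L 𝓛.Ty}
      {ρ ρt ρ' ρτ ρ₁ ρ₂ : LocSet L} :
      HasType Γ C₁ (.located (𝓛.locsetTy ρt) ρ') ρ₁ → LocSet.Sub ρt ρ → LocSet.Sub ρ ρ' →
      ρ.Kinded Γ.kctx.toTyCtx .finlocset → CTy.Kinded 𝓛 Γ.kctx τ ρτ →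
      HasType (Γ.extTy (.set k)) C₂ (τ.ren 𝓛 (Ren.shift .set)) ρ₂ →
      Disjoint ρ.nl C₁.spawned → Disjoint ρ.nl C₂.spawned →
      Disjoint ρ₁.nl C₂.spawned → Disjoint ρ₂.nl C₁.spawned →
      HasType Γ (.letSet ρ k C₁ C₂) τ (.union (.union ρ₁ ρ₂.dropSet) ρ)
  | send {Γ : Ctx 𝓛} {C : Chor L 𝓛.Ty 𝓛.Expr} {t : 𝓛.Ty} {ℓ : LocE L} {ρ ρ₁ ρ₂ : LocSet L} :
      HasType Γ C (.located t ρ₁) ρ → LocSet.Mem ℓ ρ₁ → ρ₂.Kinded Γ.kctx.toTyCtx .finlocset →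
      Disjoint ℓ.nl C.spawned → Disjoint ρ₂.nl C.spawned →
      HasType Γ (.send C ℓ ρ₂) (.located t (.union ρ₁ ρ₂)) (.union (.union ρ (.sng ℓ)) ρ₂)
  | sync {Γ : Ctx 𝓛} {C : Chor L 𝓛.Ty 𝓛.Expr} {τ : CTy L 𝓛.Ty} {ℓ : LocE L} {d : Dir}
      {ρ ρ₁ : LocSet L} :
      HasType Γ C τ ρ₁ → ℓ.Kinded Γ.kctx.toTyCtx → ρ.Kinded Γ.kctx.toTyCtx .finlocset →
      Disjoint ℓ.nl C.spawned → Disjoint ρ.nl C.spawned →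
      HasType Γ (.sync ℓ d ρ C) τ (.union (.union (.sng ℓ) ρ) ρ₁)
  | fork {Γ : Ctx 𝓛} {C : Chor L 𝓛.Ty 𝓛.Expr} {τ : CTy L 𝓛.Ty} {ℓ : LocE L} {ρ ρτ : LocSet L} :
      ℓ.Kinded Γ.kctx.toTyCtx → CTy.Kinded 𝓛 Γ.kctx τ ρτ →
      HasType ((Γ.extTy .loc).extLocal
          (.union (.sng (.var 0)) (.sng (ℓ.ren (Ren.shift .loc)))) (𝓛.locTy (.sng (.var 0))))
        C (τ.ren 𝓛 (Ren.shift .loc)) ρ →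
      Disjoint ℓ.nl C.spawned →
      HasType Γ (.fork ℓ C) τ (.union (.sng ℓ) ρ.dropLoc)
  | killAfter {Γ : Ctx 𝓛} {C : Chor L 𝓛.Ty 𝓛.Expr} {τ : CTy L 𝓛.Ty} {A : L} {ρ : LocSet L} :
      HasType Γ C τ ρ → A ∉ τ.nl → A ∉ C.spawned →
      HasType Γ (.killAfter A C) τ (.union ρ (.sng (.const A)))

/-! ## Operational semantics -/

/-- Messages: local values and selections. -/
inductive Msg
  | val (e : 𝓛.Expr)
  | dir (d : Dir)

/-- Redices, the labels of reduction steps. -/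
inductive Redex
  | done (ρ : LocSet L) (e e' : 𝓛.Expr)
  | fn (R : Redex)
  | arg (R : Redex)
  | app (ρ : LocSet L)
  | tapp (ρ : LocSet L)
  | unfoldFold (ρ : LocSet L)
  | pairL (R : Redex)
  | pairR (R : Redex)
  | fstPair (ρ : LocSet L)
  | sndPair (ρ : LocSet L)
  | caseInl (ρ : LocSet L)
  | caseInr (ρ : LocSet L)
  | letVal (ρ : LocSet L) (e : 𝓛.Expr)
  | letTy (ρ : LocSet L) (a : TArg L 𝓛.Ty)
  | send (A : L) (m : Msg 𝓛) (ρ : LocSet L)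
  /-- `A` spawns `B`, whose body is `C` -/
  | fork (A B : L) (C : Chor L 𝓛.Ty 𝓛.Expr)
  | kill (A : L)

variable {𝓛}

/-- Renaming in a message. -/
def Msg.ren (ξ : Ren) : Msg 𝓛 → Msg 𝓛
  | .val e => .val (𝓛.eren ξ e)
  | .dir d => .dir d

/-- Renaming in a redex. -/
def Redex.ren (ξ : Ren) : Redex 𝓛 → Redex 𝓛
  | .done ρ e e' => .done (ρ.ren ξ) (𝓛.eren ξ e) (𝓛.eren ξ e')
  | .fn R => .fn (Redex.ren ξ R)
  | .arg R => .arg (Redex.ren ξ R)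
  | .app ρ => .app (ρ.ren ξ)
  | .tapp ρ => .tapp (ρ.ren ξ)
  | .unfoldFold ρ => .unfoldFold (ρ.ren ξ)
  | .pairL R => .pairL (Redex.ren ξ R)
  | .pairR R => .pairR (Redex.ren ξ R)
  | .fstPair ρ => .fstPair (ρ.ren ξ)
  | .sndPair ρ => .sndPair (ρ.ren ξ)
  | .caseInl ρ => .caseInl (ρ.ren ξ)
  | .caseInr ρ => .caseInr (ρ.ren ξ)
  | .letVal ρ e => .letVal (ρ.ren ξ) (𝓛.eren ξ e)
  | .letTy ρ a => .letTy (ρ.ren ξ) (a.ren 𝓛 ξ)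
  | .send A m ρ => .send A (m.ren ξ) (ρ.ren ξ)
  | .fork A B C => .fork A B (C.ren 𝓛 ξ)
  | .kill A => .kill A

/-- Blocked locations of a redex. -/
def Redex.rloc : Redex 𝓛 → LocSet L
  | .done ρ _ _ => ρ
  | .fn R => Redex.rloc R
  | .arg R => Redex.rloc R
  | .app ρ => ρ
  | .tapp ρ => ρ
  | .unfoldFold ρ => ρ
  | .pairL R => Redex.rloc R
  | .pairR R => Redex.rloc R
  | .fstPair ρ => ρ
  | .sndPair ρ => ρ
  | .caseInl ρ => ρ
  | .caseInr ρ => ρ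
  | .letVal ρ _ => ρ
  | .letTy ρ _ => ρ
  | .send A _ ρ => .union (.sng (.const A)) ρ
  | .fork A _ _ => .sng (.const A)
  | .kill A => .sng (.const A)

variable (𝓛)

/-- The layers of which evaluation contexts consist. -/
inductive Frame
  | appL (ρ : LocSet L) (C : Chor L 𝓛.Ty 𝓛.Expr)
  | appR (V : Chor L 𝓛.Ty 𝓛.Expr) (ρ : LocSet L)
  | tapp (ρ : LocSet L) (a : TArg L 𝓛.Ty)
  | fold (ρ : LocSet L)
  | unfold (ρ : LocSet L)
  | pairL (ρ : LocSet L) (C : Chor L 𝓛.Ty 𝓛.Expr)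
  | pairR (ρ : LocSet L) (V : Chor L 𝓛.Ty 𝓛.Expr)
  | fst (ρ : LocSet L)
  | snd (ρ : LocSet L)
  | inl (ρ : LocSet L)
  | inr (ρ : LocSet L)
  | caseOf (ρ : LocSet L) (C₁ C₂ : Chor L 𝓛.Ty 𝓛.Expr)
  | localCase (ρ : LocSet L) (C₁ C₂ : Chor L 𝓛.Ty 𝓛.Expr)
  | letLocal (ρ : LocSet L) (t : 𝓛.Ty) (C : Chor L 𝓛.Ty 𝓛.Expr)
  | letLoc (ρ : LocSet L) (C : Chor L 𝓛.Ty 𝓛.Expr)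
  | letSet (ρ : LocSet L) (k : SetKind) (C : Chor L 𝓛.Ty 𝓛.Expr)
  | send (ℓ : LocE L) (ρ : LocSet L)
  | killAfter (A : L)

variable {𝓛}

namespace Frame

/-- The side condition of the layers `V η` and `(V, η)`. -/
def Ok : Frame 𝓛 → Prop
  | .appR V _ => V.IsVal 𝓛
  | .pairR _ V => V.IsVal 𝓛
  | _ => True

/-- Fill the hole of a layer. -/
def plug : Frame 𝓛 → Chor L 𝓛.Ty 𝓛.Expr → Chor L 𝓛.Ty 𝓛.Expr
  | .appL ρ C₂, C => .app C ρ C₂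
  | .appR V ρ, C => .app V ρ C
  | .tapp ρ a, C => .tapp C ρ a
  | .fold ρ, C => .fold ρ C
  | .unfold ρ, C => .unfold ρ C
  | .pairL ρ C₂, C => .pair ρ C C₂
  | .pairR ρ V, C => .pair ρ V C
  | .fst ρ, C => .fst ρ C
  | .snd ρ, C => .snd ρ C
  | .inl ρ, C => .inl ρ C
  | .inr ρ, C => .inr ρ C
  | .caseOf ρ C₁ C₂, C => .caseOf ρ C C₁ C₂
  | .localCase ρ C₁ C₂, C => .localCase ρ C C₁ C₂
  | .letLocal ρ t C₂, C => .letLocal ρ t C C₂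
  | .letLoc ρ C₂, C => .letLoc ρ C C₂
  | .letSet ρ k C₂, C => .letSet ρ k C C₂
  | .send ℓ ρ, C => .send C ℓ ρ
  | .killAfter A, C => .killAfter A C

/-- The redex `η[R]`. -/
def redex : Frame 𝓛 → Redex 𝓛 → Redex 𝓛
  | .appL _ _, R => .fn R
  | .appR _ _, R => .arg R
  | .pairL _ _, R => .pairL R
  | .pairR _ _, R => .pairR R
  | _, R => R

end Frame

variable (𝓛)

/-- The labelled reduction `⟨C, Ω⟩ ⟹[R] ⟨C', Ω'⟩`.

A reduction in an evaluation context is obtained by iterating `ctx`.  In the out-of-order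
rules below a binder, the bound variables leave the scope of the label, which is therefore
lowered; where a location (set) variable is bound, it must not occur in the blocked locations
of the redex. -/
inductive Step : Redex 𝓛 → Chor L 𝓛.Ty 𝓛.Expr → Set L → Chor L 𝓛.Ty 𝓛.Expr → Set L → Prop
  | ctx {R : Redex 𝓛} {C C' : Chor L 𝓛.Ty 𝓛.Expr} {Ω Ω' : Set L} (η : Frame 𝓛) : η.Ok →
      Step R C Ω C' Ω' → Step (η.redex R) (η.plug C) Ω (η.plug C') Ω'
  | done {ρ : LocSet L} {e e' : 𝓛.Expr} {Ω : Set L} : 𝓛.Step e e' →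
      Step (.done ρ e e') (.done ρ e) Ω (.done ρ e') Ω
  | app {ρ ρ' : LocSet L} {C V : Chor L 𝓛.Ty 𝓛.Expr} {Ω : Set L} : V.IsVal 𝓛 →
      Step (.app ρ) (.app (.lam ρ' C) ρ V) Ω
        (C.subst (((Subst.id 𝓛).consCh (.lam ρ' C)).consCh V)) Ω
  | tapp {ρ : LocSet L} {κ : Kind L} {C : Chor L 𝓛.Ty 𝓛.Expr} {a : TArg L 𝓛.Ty} {Ω : Set L} :
      Step (.tapp ρ) (.tapp (.tlam κ C) ρ a) Ω
        (C.subst (((Subst.id 𝓛).consCh (.tlam κ C)).consTy a)) Ω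
  | unfoldFold {ρ : LocSet L} {V : Chor L 𝓛.Ty 𝓛.Expr} {Ω : Set L} : V.IsVal 𝓛 →
      Step (.unfoldFold ρ) (.unfold ρ (.fold ρ V)) Ω V Ω
  | fstPair {ρ : LocSet L} {V₁ V₂ : Chor L 𝓛.Ty 𝓛.Expr} {Ω : Set L} : V₁.IsVal 𝓛 →
      V₂.IsVal 𝓛 → Step (.fstPair ρ) (.fst ρ (.pair ρ V₁ V₂)) Ω V₁ Ω
  | sndPair {ρ : LocSet L} {V₁ V₂ : Chor L 𝓛.Ty 𝓛.Expr} {Ω : Set L} : V₁.IsVal 𝓛 →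
      V₂.IsVal 𝓛 → Step (.sndPair ρ) (.snd ρ (.pair ρ V₁ V₂)) Ω V₂ Ω
  | caseInl {ρ : LocSet L} {V C₁ C₂ : Chor L 𝓛.Ty 𝓛.Expr} {Ω : Set L} : V.IsVal 𝓛 →
      Step (.caseInl ρ) (.caseOf ρ (.inl ρ V) C₁ C₂) Ω (C₁.subst ((Subst.id 𝓛).consCh V)) Ω
  | caseInr {ρ : LocSet L} {V C₁ C₂ : Chor L 𝓛.Ty 𝓛.Expr} {Ω : Set L} : V.IsVal 𝓛 →
      Step (.caseInr ρ) (.caseOf ρ (.inr ρ V) C₁ C₂) Ω (C₂.subst ((Subst.id 𝓛).consCh V)) Ω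
  | localCaseInl {ρ ρ' : LocSet L} {e e₁ : 𝓛.Expr} {C₁ C₂ : Chor L 𝓛.Ty 𝓛.Expr} {Ω : Set L} :
      𝓛.Val e → 𝓛.getCase e = some (.inl e₁) →
      Step (.caseInl ρ) (.localCase ρ (.done ρ' e) C₁ C₂) Ω
        (C₁.subst ((Subst.id 𝓛).consEx e₁)) Ω
  | localCaseInr {ρ ρ' : LocSet L} {e e₂ : 𝓛.Expr} {C₁ C₂ : Chor L 𝓛.Ty 𝓛.Expr} {Ω : Set L} :
      𝓛.Val e → 𝓛.getCase e = some (.inr e₂) →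
      Step (.caseInr ρ) (.localCase ρ (.done ρ' e) C₁ C₂) Ω
        (C₂.subst ((Subst.id 𝓛).consEx e₂)) Ω
  | letVal {ρ ρ' : LocSet L} {t : 𝓛.Ty} {e : 𝓛.Expr} {C : Chor L 𝓛.Ty 𝓛.Expr} {Ω : Set L} :
      𝓛.Val e →
      Step (.letVal ρ e) (.letLocal ρ t (.done ρ' e) C) Ω (C.subst ((Subst.id 𝓛).consEx e)) Ω
  | letLocVal {ρ ρ' : LocSet L} {e : 𝓛.Expr} {A : L} {C : Chor L 𝓛.Ty 𝓛.Expr} {Ω : Set L} :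
      𝓛.LocRep e A →
      Step (.letTy ρ (.loc (.const A))) (.letLoc ρ (.done ρ' e) C) Ω
        (C.subst ((Subst.id 𝓛).consTy (.loc (.const A)))) Ω
  | letSetVal {ρ ρ' : LocSet L} {k : SetKind} {e : 𝓛.Expr} {S : Finset L}
      {C : Chor L 𝓛.Ty 𝓛.Expr} {Ω : Set L} :
      𝓛.SetRep e S →
      Step (.letTy ρ (.set (.ofFinset S))) (.letSet ρ k (.done ρ' e) C) Ω
        (C.subst ((Subst.id 𝓛).consTy (.set (.ofFinset S)))) Ω
  | sendVal {ρ₁ ρ₂ : LocSet L} {e : 𝓛.Expr} {A : L} {Ω : Set L} : 𝓛.Val e →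
      Step (.send A (.val e) ρ₂) (.send (.done ρ₁ e) (.const A) ρ₂) Ω
        (.done (.union ρ₁ ρ₂) e) Ω
  | sync {ρ : LocSet L} {A : L} {d : Dir} {C : Chor L 𝓛.Ty 𝓛.Expr} {Ω : Set L} :
      Step (.send A (.dir d) ρ) (.sync (.const A) d ρ C) Ω C Ω
  | syncI {R : Redex 𝓛} {ℓ : LocE L} {d : Dir} {ρ : LocSet L} {C C' : Chor L 𝓛.Ty 𝓛.Expr}
      {Ω Ω' : Set L} :
      Step R C Ω C' Ω' → LocSet.Disj (.union (.sng ℓ) ρ) R.rloc →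
      Step R (.sync ℓ d ρ C) Ω (.sync ℓ d ρ C') Ω'
  | caseI {R : Redex 𝓛} {ρ : LocSet L} {C C₁ C₁' C₂ C₂' : Chor L 𝓛.Ty 𝓛.Expr} {Ω Ω' : Set L} :
      Step R C₁ Ω C₁' Ω' → Step R C₂ Ω C₂' Ω' → LocSet.Disj ρ R.rloc →
      LocSet.Disj C.cloc R.rloc →
      Step (R.ren (Ren.lower .ch)) (.caseOf ρ C C₁ C₂) Ω (.caseOf ρ C C₁' C₂') Ω'
  | localCaseI {R : Redex 𝓛} {ρ : LocSet L} {C C₁ C₁' C₂ C₂' : Chor L 𝓛.Ty 𝓛.Expr}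
      {Ω Ω' : Set L} :
      Step R C₁ Ω C₁' Ω' → Step R C₂ Ω C₂' Ω' → LocSet.Disj ρ R.rloc →
      LocSet.Disj C.cloc R.rloc →
      Step (R.ren (Ren.lower .ex)) (.localCase ρ C C₁ C₂) Ω (.localCase ρ C C₁' C₂') Ω'
  | appI {R : Redex 𝓛} {ρ : LocSet L} {C₁ C₂ C₂' : Chor L 𝓛.Ty 𝓛.Expr} {Ω Ω' : Set L} :
      Step R C₂ Ω C₂' Ω' → LocSet.Disj C₁.cloc R.rloc →
      Step (.arg R) (.app C₁ ρ C₂) Ω (.app C₁ ρ C₂') Ω'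
  | pairI {R : Redex 𝓛} {ρ : LocSet L} {C₁ C₂ C₂' : Chor L 𝓛.Ty 𝓛.Expr} {Ω Ω' : Set L} :
      Step R C₂ Ω C₂' Ω' → LocSet.Disj C₁.cloc R.rloc →
      Step (.pairR R) (.pair ρ C₁ C₂) Ω (.pair ρ C₁ C₂') Ω'
  | letI {R : Redex 𝓛} {ρ : LocSet L} {t : 𝓛.Ty} {C₁ C₂ C₂' : Chor L 𝓛.Ty 𝓛.Expr}
      {Ω Ω' : Set L} :
      Step R C₂ Ω C₂' Ω' → LocSet.Disj ρ R.rloc → LocSet.Disj C₁.cloc R.rloc →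
      Step (R.ren (Ren.lower .ex)) (.letLocal ρ t C₁ C₂) Ω (.letLocal ρ t C₁ C₂') Ω'
  | letLocI {R : Redex 𝓛} {ρ ρR : LocSet L} {C₁ C₂ C₂' : Chor L 𝓛.Ty 𝓛.Expr} {Ω Ω' : Set L} :
      Step R C₂ Ω C₂' Ω' → R.rloc = ρR.ren (Ren.shift .loc) → LocSet.Disj ρ ρR →
      LocSet.Disj C₁.cloc ρR →
      Step (R.ren (Ren.lower .loc)) (.letLoc ρ C₁ C₂) Ω (.letLoc ρ C₁ C₂') Ω'
  | letSetI {R : Redex 𝓛} {ρ ρR : LocSet L} {k : SetKind} {C₁ C₂ C₂' : Chor L 𝓛.Ty 𝓛.Expr}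
      {Ω Ω' : Set L} :
      Step R C₂ Ω C₂' Ω' → R.rloc = ρR.ren (Ren.shift .set) → LocSet.Disj ρ ρR →
      LocSet.Disj C₁.cloc ρR →
      Step (R.ren (Ren.lower .set)) (.letSet ρ k C₁ C₂) Ω (.letSet ρ k C₁ C₂') Ω'
  | fork {A B : L} {e : 𝓛.Expr} {C : Chor L 𝓛.Ty 𝓛.Expr} {Ω : Set L} : B ∉ Ω →
      𝓛.LocRep e B →
      Step (.fork A B (C.subst (((Subst.id 𝓛).consTy (.loc (.const B))).consEx e)))
        (.fork (.const A) C) Ω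
        (.killAfter B (C.subst (((Subst.id 𝓛).consTy (.loc (.const B))).consEx e)))
        (Ω ∪ {B})
  | forkI {R : Redex 𝓛} {ℓ : LocE L} {ρR : LocSet L} {C C' : Chor L 𝓛.Ty 𝓛.Expr}
      {Ω Ω' : Set L} :
      Step R C Ω C' Ω' → R.rloc = ρR.ren (Ren.shift .loc) → LocSet.Disj (.sng ℓ) ρR →
      Step ((R.ren (Ren.lower .loc)).ren (Ren.lower .ex)) (.fork ℓ C) Ω (.fork ℓ C') Ω'
  | kill {A : L} {V : Chor L 𝓛.Ty 𝓛.Expr} {Ω : Set L} : V.IsVal 𝓛 →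
      Step (.kill A) (.killAfter A V) Ω V (Ω \ {A})
  | killI {A : L} {C : Chor L 𝓛.Ty 𝓛.Expr} {Ω : Set L} : ¬ LocSet.Mem (.const A) C.cloc →
      Step (.kill A) (.killAfter A C) Ω C (Ω \ {A})

/-- Many-step reduction `⟨C, Ω⟩ ⟹* ⟨C', Ω'⟩` with fresh names: the name of a newly spawned
location, which is never one of a running location, neither occurs in the choreography that
spawns it nor belongs to the set `avoid`. -/
inductive Steps (avoid : Set L) (C : Chor L 𝓛.Ty 𝓛.Expr) (Ω : Set L) :
    Chor L 𝓛.Ty 𝓛.Expr → Set L → Prop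
  | refl : Steps avoid C Ω C Ω
  | tail {R : Redex 𝓛} {C₁ C₂ : Chor L 𝓛.Ty 𝓛.Expr} {Ω₁ Ω₂ : Set L} :
      Steps avoid C Ω C₁ Ω₁ → Step 𝓛 R C₁ Ω₁ C₂ Ω₂ →
      Disjoint (Ω₂ \ Ω₁) (avoid ∪ C₁.names) →
      Steps avoid C Ω C₂ Ω₂

end Judgments

end LambdaFork

/-!
# Preservation of types, participants and running locations

A single step has an `Effect`.  If it spawns the set `N = Ω' ∖ Ω` and kills the set `K = Ω ∖ Ω'`,
then `SN(C') = (SN(C) ∪ N) ∖ K`, where `K ⊆ SN(C)`, and the new participants satisfy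
`NL(ρ') ⊆ NL(ρ) ∪ N` and `NL(ρ') ∩ K = ∅`.  Typing ensures `SN(C) ⊆ NL(ρ)`
(`HasType.spawned_subset_nl`).  Along a sequence of steps it follows that `Ω ∖ SN(C)` is constant
and that `Ω ∖ NL(ρ)` never shrinks (`HasType.steps_preserves`), and the theorem is a Boolean
consequence.

Three ingredients make up the analysis of a step (`HasType.preserves`).

* *Substitution* (`HasType.subst`).  Substitution can turn an expression into a value, and thereby
  remove participants, so that the new participants are only bounded above.  Values are idle: they
  have no participants and no spawned locations (`HasType.idle_of_isVal`).  Hence substituting them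
  does not change the spawned locations.  By soundness of `loc_ρ` and `locset_ρ`, a location bound
  by a `let` is one that its annotation names.  As usual, substitution is treated for renamings
  first, and the result is weakening, which is needed to go under binders.

* *Separation.*  The side conditions of the typing rules keep the spawned locations of one
  subexpression apart from the participants of the others.  This is why a step in a subexpression
  has the same effect on the whole (`Effect.frame`, `HasType.ctx_preserves`), and why a location
  can be killed out of order once it is not blocked: a named participant is blocked
  (`HasType.mem_cloc`).

* *Hidden names.*  The rule for `kill-after B` requires that `B` not occur in the type.  The name of
  a spawned location is fresh for the choreography, the context and the type as a whole, but the
  typing derivation can involve types with other names.  For instance, a type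
  `∀ α :: κ [ρ]. τ` with a location variable `α` is owned by `⊤`, so that the application of a
  function to an argument of this type is annotated by a set that does not mention the names in it.
  Therefore the fork cannot be analysed with the given derivation.  A map `f` of names that fixes
  those in the choreography can be applied to the types in a derivation (`HasType.mapNames`); local
  types are left alone, since the rule for `kill-after` ignores the names in them.  As there are
  infinitely many names, `f` can be chosen such that the new name is not in its range, and that it
  is the identity on the context and the type (`HasType.preserves_of_fresh`).
-/

namespace LambdaFork

/-! ### Substitution in locations and location sets -/

section LocationAlgebra

variable {L : Type u}

theorem LocE.subst_subst (l l' : ℕ → LocE L) (ℓ : LocE L) :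
    (ℓ.subst l).subst l' = ℓ.subst (fun n => (l n).subst l') := by
  cases ℓ <;> rfl

@[simp] theorem LocE.subst_var (ℓ : LocE L) : ℓ.subst .var = ℓ := by
  cases ℓ <;> rfl

theorem LocSet.subst_subst (l l' : ℕ → LocE L) (s s' : ℕ → LocSet L) (ρ : LocSet L) :
    (ρ.subst l s).subst l' s' =
      ρ.subst (fun n => (l n).subst l') (fun n => (s n).subst l' s') := by
  induction ρ with
  | sng ℓ => simp [LocSet.subst, LocE.subst_subst]
  | union _ _ h₁ h₂ => simp [LocSet.subst, h₁, h₂]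
  | _ => rfl

@[simp] theorem LocSet.subst_var (ρ : LocSet L) : ρ.subst .var .var = ρ := by
  induction ρ with
  | union _ _ h₁ h₂ => simp [LocSet.subst, h₁, h₂]
  | _ => simp [LocSet.subst]

/-- Weakening of a location by a variable that is not a location variable is the identity. -/
theorem LocE.ren_shift_of_ne {s : VSort} (hs : s ≠ .loc) (ℓ : LocE L) :
    ℓ.ren (Ren.shift s) = ℓ := by
  cases ℓ <;> cases s <;> first | rfl | exact absurd rfl hs

/-- Weakening of a location set by a variable that is neither a location variable nor a
location-set variable is the identity. -/
theorem LocSet.ren_shift_of_ne {s : VSort} (hs : s ≠ .loc) (hs' : s ≠ .set) (ρ : LocSet L) :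
    ρ.ren (Ren.shift s) = ρ := by
  cases s <;> first | exact absurd rfl hs | exact absurd rfl hs' | exact LocSet.subst_var ρ

/-- The components are those of the instances of the components. -/
theorem LocSet.mem_comps_subst (l : ℕ → LocE L) (s : ℕ → LocSet L) (ρ c : LocSet L) :
    c ∈ (ρ.subst l s).comps ↔ ∃ d ∈ ρ.comps, c ∈ (d.subst l s).comps := by
  induction ρ with
  | union _ _ h₁ h₂ =>
    simp only [LocSet.subst, LocSet.comps, Set.mem_union, h₁, h₂, or_and_right, exists_or]
  | _ => simp [LocSet.subst, LocSet.comps]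

theorem LocSet.comps_subst_mono {ρ ρ' : LocSet L} (h : ρ.comps ⊆ ρ'.comps) (l : ℕ → LocE L)
    (s : ℕ → LocSet L) : (ρ.subst l s).comps ⊆ (ρ'.subst l s).comps := by
  intro c hc
  rw [mem_comps_subst] at hc ⊢
  obtain ⟨d, hd, hc⟩ := hc
  exact ⟨d, h hd, hc⟩

theorem LocSet.mem_comps_dropLoc (ρ c : LocSet L) :
    c ∈ ρ.dropLoc.comps ↔ ∃ d ∈ ρ.comps, c ∈ d.dropLoc.comps := by
  induction ρ with
  | union _ _ h₁ h₂ =>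
    simp only [LocSet.dropLoc, LocSet.comps, Set.mem_union, h₁, h₂, or_and_right, exists_or]
  | _ => simp [LocSet.dropLoc, LocSet.comps]

theorem LocSet.comps_dropLoc_mono {ρ ρ' : LocSet L} (h : ρ.comps ⊆ ρ'.comps) :
    ρ.dropLoc.comps ⊆ ρ'.dropLoc.comps := by
  intro c hc
  rw [mem_comps_dropLoc] at hc ⊢
  obtain ⟨d, hd, hc⟩ := hc
  exact ⟨d, h hd, hc⟩

theorem LocSet.mem_comps_dropSet (ρ c : LocSet L) :
    c ∈ ρ.dropSet.comps ↔ ∃ d ∈ ρ.comps, c ∈ d.dropSet.comps := by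
  induction ρ with
  | union _ _ h₁ h₂ =>
    simp only [LocSet.dropSet, LocSet.comps, Set.mem_union, h₁, h₂, or_and_right, exists_or]
  | _ => simp [LocSet.dropSet, LocSet.comps]

theorem LocSet.comps_dropSet_mono {ρ ρ' : LocSet L} (h : ρ.comps ⊆ ρ'.comps) :
    ρ.dropSet.comps ⊆ ρ'.dropSet.comps := by
  intro c hc
  rw [mem_comps_dropSet] at hc ⊢
  obtain ⟨d, hd, hc⟩ := hc
  exact ⟨d, h hd, hc⟩

theorem LocSet.mem_nl_iff (A : L) (ρ : LocSet L) :
    A ∈ ρ.nl ↔ LocSet.sng (.const A) ∈ ρ.comps := by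
  induction ρ with
  | sng ℓ => cases ℓ <;> simp [LocSet.nl, LocE.nl, LocSet.comps]
  | union _ _ h₁ h₂ => simp [LocSet.nl, LocSet.comps, h₁, h₂]
  | _ => simp [LocSet.nl, LocSet.comps]

theorem LocSet.nl_mono {ρ ρ' : LocSet L} (h : ρ.comps ⊆ ρ'.comps) : ρ.nl ⊆ ρ'.nl := by
  intro A hA
  rw [mem_nl_iff] at hA ⊢
  exact h hA

@[simp] theorem LocSet.nl_dropLoc (ρ : LocSet L) : ρ.dropLoc.nl = ρ.nl := by
  induction ρ with
  | sng ℓ => rcases ℓ with (_ | n) | A <;> rfl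
  | union _ _ h₁ h₂ => simp [LocSet.nl, LocSet.dropLoc, h₁, h₂]
  | _ => rfl

@[simp] theorem LocSet.nl_dropSet (ρ : LocSet L) : ρ.dropSet.nl = ρ.nl := by
  induction ρ with
  | var n => cases n <;> rfl
  | union _ _ h₁ h₂ => simp [LocSet.nl, LocSet.dropSet, h₁, h₂]
  | _ => rfl

theorem LocSet.dropLoc_ren_shift (ρ : LocSet L) : (ρ.ren (Ren.shift .loc)).dropLoc = ρ := by
  induction ρ with
  | sng ℓ => cases ℓ <;> rfl
  | union _ _ h₁ h₂ => exact congrArg₂ LocSet.union h₁ h₂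
  | _ => rfl

theorem LocSet.dropSet_ren_shift (ρ : LocSet L) : (ρ.ren (Ren.shift .set)).dropSet = ρ := by
  induction ρ with
  | sng ℓ => cases ℓ <;> rfl
  | union _ _ h₁ h₂ => exact congrArg₂ LocSet.union h₁ h₂
  | _ => rfl

theorem LocE.nl_subst (l : ℕ → LocE L) (ℓ : LocE L) :
    (ℓ.subst l).nl ⊆ ℓ.nl ∪ ⋃ n, (l n).nl := by
  cases ℓ with
  | var n => exact (Set.subset_iUnion (fun n => (l n).nl) n).trans Set.subset_union_right
  | const A => exact Set.subset_union_left

theorem LocSet.nl_subst (l : ℕ → LocE L) (s : ℕ → LocSet L) (ρ : LocSet L) :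
    (ρ.subst l s).nl ⊆ ρ.nl ∪ ((⋃ n, (l n).nl) ∪ ⋃ n, (s n).nl) := by
  induction ρ with
  | var n =>
    exact ((Set.subset_iUnion (fun n => (s n).nl) n).trans Set.subset_union_right).trans
      Set.subset_union_right
  | sng ℓ =>
    exact (LocE.nl_subst l ℓ).trans (Set.union_subset_union_right _ Set.subset_union_left)
  | union _ _ h₁ h₂ =>
    refine Set.union_subset (h₁.trans ?_) (h₂.trans ?_) <;>
      exact Set.union_subset_union_left _ (by simp [LocSet.nl])
  | _ => simp [LocSet.subst, LocSet.nl]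

@[simp] theorem LocE.nl_ren (ξ : Ren) (ℓ : LocE L) : (ℓ.ren ξ).nl = ℓ.nl := by
  cases ℓ <;> rfl

@[simp] theorem LocSet.nl_ren (ξ : Ren) (ρ : LocSet L) : (ρ.ren ξ).nl = ρ.nl := by
  induction ρ with
  | sng ℓ => exact LocE.nl_ren ξ ℓ
  | union _ _ h₁ h₂ => exact congrArg₂ (· ∪ ·) h₁ h₂
  | _ => rfl

/-! ### Containment of location sets -/

theorem LocSet.Sub.refl (ρ : LocSet L) : LocSet.Sub ρ ρ := by
  induction ρ with
  | empty => exact .empty _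
  | var n => exact .var n
  | sng ℓ => exact .sng (.sng ℓ)
  | union _ _ h₁ h₂ => exact .union (.left h₁) (.right h₂)
  | top => exact .top _

theorem LocSet.Mem.subst {ℓ : LocE L} {ρ : LocSet L} (h : LocSet.Mem ℓ ρ) (l : ℕ → LocE L)
    (s : ℕ → LocSet L) : LocSet.Mem (ℓ.subst l) (ρ.subst l s) := by
  induction h with
  | sng => exact .sng _
  | left _ ih => exact .left ih
  | right _ ih => exact .right ih
  | top => exact .top _

theorem LocSet.Sub.subst {ρ ρ' : LocSet L} (h : LocSet.Sub ρ ρ') (l : ℕ → LocE L)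
    (s : ℕ → LocSet L) : LocSet.Sub (ρ.subst l s) (ρ'.subst l s) := by
  induction h with
  | empty => exact .empty _
  | var n => exact .refl _
  | sng h => exact .sng (h.subst l s)
  | left _ ih => exact .left ih
  | right _ ih => exact .right ih
  | union _ _ h₁ h₂ => exact .union h₁ h₂
  | top => exact .top _

theorem LocSet.Mem.of_sub {ℓ : LocE L} {ρ ρ' : LocSet L} (h : LocSet.Sub ρ ρ')
    (hℓ : LocSet.Mem ℓ ρ) : LocSet.Mem ℓ ρ' := by
  induction h with
  | empty => cases hℓ
  | var n => cases hℓ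
  | sng h => cases hℓ; exact h
  | left _ ih => exact .left (ih hℓ)
  | right _ ih => exact .right (ih hℓ)
  | union _ _ h₁ h₂ =>
    cases hℓ with
    | left h => exact h₁ h
    | right h => exact h₂ h
  | top => exact .top _

theorem LocSet.mem_of_mem_nl {A : L} {ρ : LocSet L} (h : A ∈ ρ.nl) :
    LocSet.Mem (.const A) ρ := by
  induction ρ with
  | sng ℓ =>
    cases ℓ with
    | var n => cases h
    | const B => cases h; exact .sng _
  | union _ _ h₁ h₂ => exact h.elim (fun h => .left (h₁ h)) fun h => .right (h₂ h)
  | _ => cases h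

/-- In a finite location set, the names that are contained in it are those that occur in it. -/
theorem LocSet.Kinded.mem_nl {Γ : TyCtx} {ρ : LocSet L} (hρ : ρ.Kinded Γ .finlocset) {A : L}
    (h : LocSet.Mem (.const A) ρ) : A ∈ ρ.nl := by
  induction ρ with
  | sng ℓ => cases h; rfl
  | union _ _ h₁ h₂ =>
    cases hρ with
    | union k₁ k₂ =>
      cases h with
      | left h => exact Or.inl (h₁ k₁ h)
      | right h => exact Or.inr (h₂ k₂ h)
  | top => cases hρ
  | _ => cases h

theorem LocE.Kinded.subst {Γ Γ' : TyCtx} {l : ℕ → LocE L}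
    (hl : ∀ n, n < Γ.locs → (l n).Kinded Γ') {ℓ : LocE L} (h : ℓ.Kinded Γ) :
    (ℓ.subst l).Kinded Γ' := by
  cases ℓ with
  | var n => exact hl n h
  | const A => exact h

theorem LocSet.Kinded.fin_locset {Γ : TyCtx} {ρ : LocSet L} (h : ρ.Kinded Γ .finlocset) :
    ρ.Kinded Γ .locset := by
  induction ρ with
  | empty => exact .empty _
  | var n => cases h with | var h => exact .subVar h
  | sng ℓ => cases h with | sng _ h => exact .sng _ h
  | union _ _ h₁ h₂ => cases h with | union k₁ k₂ => exact .union (h₁ k₁) (h₂ k₂)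
  | top => exact .top

theorem LocSet.Kinded.subst {Γ Γ' : TyCtx} {l : ℕ → LocE L} {s : ℕ → LocSet L}
    (hl : ∀ n, n < Γ.locs → (l n).Kinded Γ')
    (hs : ∀ n k, Γ.sets[n]? = some k → (s n).Kinded Γ' k) {ρ : LocSet L} {k : SetKind}
    (h : ρ.Kinded Γ k) : (ρ.subst l s).Kinded Γ' k := by
  induction h with
  | var h => exact hs _ _ h
  | subVar h => exact (hs _ _ h).fin_locset
  | empty k => exact .empty k
  | sng k h => exact .sng k (h.subst hl)
  | union _ _ h₁ h₂ => exact .union h₁ h₂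
  | top => exact .top

end LocationAlgebra

/-! ### Substitution in choreographic types -/

section TypeAlgebra

variable {L : Type u} {𝓛 : LocalLang.{u, v, w} L}

theorem TSubst.ext' {σ σ' : TSubst 𝓛} (h₁ : ∀ n, σ.loc n = σ'.loc n)
    (h₂ : ∀ n, σ.set n = σ'.set n) (h₃ : ∀ n, σ.lty n = σ'.lty n)
    (h₄ : ∀ n, σ.ty n = σ'.ty n) : σ = σ' := by
  cases σ; cases σ'
  simp only [TSubst.mk.injEq]
  exact ⟨funext h₁, funext h₂, funext h₃, funext h₄⟩

variable (𝓛) in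
/-- A renaming as a substitution for type variables. -/
def Ren.toT (ξ : Ren) : TSubst 𝓛 where
  loc n := .var (ξ.loc n)
  set n := .var (ξ.set n)
  lty n := 𝓛.tvar (ξ.lty n)
  ty n := .var (ξ.ty n)

theorem Ren.toT_up (ξ : Ren) (s : VSort) : (ξ.toT 𝓛).up s = (ξ.up s).toT 𝓛 := by
  cases s <;> refine TSubst.ext' ?_ ?_ ?_ ?_ <;> intro n <;>
    first
    | rfl
    | exact 𝓛.tsub_var _ _ _ _
    | (cases n <;> first | rfl | exact 𝓛.tsub_var _ _ _ _)

theorem CTy.ren_eq_subst (ξ : Ren) (τ : CTy L 𝓛.Ty) : τ.ren 𝓛 ξ = τ.subst (ξ.toT 𝓛) := by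
  induction τ generalizing ξ with
  | var n => rfl
  | located t ρ => rfl
  | arr _ ρ _ h₁ h₂ => simp only [CTy.ren, CTy.subst, h₁, h₂]; rfl
  | sum ρ _ _ h₁ h₂ => simp only [CTy.ren, CTy.subst, h₁, h₂]; rfl
  | prod _ _ h₁ h₂ => simp only [CTy.ren, CTy.subst, h₁, h₂]
  | mu ρ _ h => simp only [CTy.ren, CTy.subst, h, Ren.toT_up]; rfl
  | all κ ρ _ h => cases κ <;> simp only [CTy.ren, CTy.subst, h, Ren.toT_up] <;> rfl

/-- Composition of substitutions: first `σ`, then `σ'`. -/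
def TSubst.comp (σ σ' : TSubst 𝓛) : TSubst 𝓛 where
  loc n := (σ.loc n).subst σ'.loc
  set n := (σ.set n).subst σ'.loc σ'.set
  lty n := 𝓛.tsub σ'.loc σ'.set σ'.lty (σ.lty n)
  ty n := (σ.ty n).subst σ'

theorem Kind.subst_subst (l l' : ℕ → LocE L) (s s' : ℕ → LocSet L) (κ : Kind L) :
    (κ.subst l s).subst l' s' =
      κ.subst (fun n => (l n).subst l') (fun n => (s n).subst l' s') := by
  cases κ <;> simp [Kind.subst, LocSet.subst_subst]

@[simp] theorem Kind.sort_subst (l : ℕ → LocE L) (s : ℕ → LocSet L) (κ : Kind L) :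
    (κ.subst l s).sort = κ.sort := by
  cases κ <;> rfl

/-- Substitutions compose as soon as this is known for their lifts.  The property `p` singles
out the pairs of substitutions for which lifts are understood: first those with a renaming on
one side, from which the general case follows. -/
theorem CTy.subst_subst_of_up {p : TSubst 𝓛 → TSubst 𝓛 → Prop}
    (hup : ∀ σ σ' s, p σ σ' → p (σ.up s) (σ'.up s) ∧
      (σ.up s).comp (σ'.up s) = (σ.comp σ').up s)
    (τ : CTy L 𝓛.Ty) (σ σ' : TSubst 𝓛) (h : p σ σ') :
    (τ.subst σ).subst σ' = τ.subst (σ.comp σ') := by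
  induction τ generalizing σ σ' with
  | var n => rfl
  | located t ρ => simp only [CTy.subst, 𝓛.tsub_tsub, LocSet.subst_subst]; rfl
  | arr _ ρ _ h₁ h₂ => simp only [CTy.subst, LocSet.subst_subst, h₁ σ σ' h, h₂ σ σ' h]; rfl
  | sum ρ _ _ h₁ h₂ => simp only [CTy.subst, LocSet.subst_subst, h₁ σ σ' h, h₂ σ σ' h]; rfl
  | prod _ _ h₁ h₂ => simp only [CTy.subst, h₁ σ σ' h, h₂ σ σ' h]
  | mu ρ _ ih =>
    obtain ⟨hp, he⟩ := hup σ σ' .ty h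
    simp only [CTy.subst, LocSet.subst_subst, ih _ _ hp, he]; rfl
  | all κ ρ _ ih =>
    obtain ⟨hp, he⟩ := hup σ σ' κ.sort h
    simp only [CTy.subst, LocSet.subst_subst, Kind.sort_subst, Kind.subst_subst, ih _ _ hp, ← he]
    rfl

theorem Ren.toT_comp_up (ξ : Ren) (σ : TSubst 𝓛) (s : VSort) :
    ((ξ.toT 𝓛).up s).comp (σ.up s) = ((ξ.toT 𝓛).comp σ).up s := by
  rw [Ren.toT_up]
  cases s <;> refine TSubst.ext' ?_ ?_ ?_ ?_ <;> intro n <;>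
    first
    | rfl
    | (cases n <;> first | rfl | exact 𝓛.tsub_var _ _ _ _)
    | (cases n <;> simp [TSubst.comp, Ren.toT, TSubst.up, TSubst.consVar, TSubst.ren, Ren.up,
        Ren.modify, liftNat, scons, LocalLang.tren, 𝓛.tsub_var])

theorem CTy.ren_subst (ξ : Ren) (σ : TSubst 𝓛) (τ : CTy L 𝓛.Ty) :
    (τ.ren 𝓛 ξ).subst σ = τ.subst ((ξ.toT 𝓛).comp σ) := by
  rw [CTy.ren_eq_subst]
  refine CTy.subst_subst_of_up (p := fun σ _ => ∃ ξ : Ren, σ = ξ.toT 𝓛) ?_ τ _ _ ⟨ξ, rfl⟩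
  rintro _ σ' s ⟨ξ, rfl⟩
  exact ⟨⟨ξ.up s, Ren.toT_up ξ s⟩, Ren.toT_comp_up ξ σ' s⟩

/-- Weakening followed by a lifted substitution. -/
theorem TSubst.shift_comp_up (σ : TSubst 𝓛) (s : VSort) :
    ((Ren.shift s).toT 𝓛).comp (σ.up s) = σ.ren (Ren.shift s) := by
  cases s <;> refine TSubst.ext' ?_ ?_ ?_ ?_ <;> intro n <;>
    first | rfl | exact 𝓛.tsub_var _ _ _ _

theorem TSubst.comp_toT (σ : TSubst 𝓛) (ξ : Ren) : σ.comp (ξ.toT 𝓛) = σ.ren ξ :=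
  TSubst.ext' (fun _ => rfl) (fun _ => rfl) (fun _ => rfl)
    fun _ => (CTy.ren_eq_subst ξ _).symm

theorem LocE.ren_shift_subst_up (σ : TSubst 𝓛) (s : VSort) (ℓ : LocE L) :
    (ℓ.ren (Ren.shift s)).subst (σ.up s).loc = (ℓ.subst σ.loc).ren (Ren.shift s) := by
  simp only [LocE.ren, LocE.subst_subst]
  cases s <;> rfl

theorem LocSet.ren_shift_subst_up (σ : TSubst 𝓛) (s : VSort) (ρ : LocSet L) :
    (ρ.ren (Ren.shift s)).subst (σ.up s).loc (σ.up s).set =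
      (ρ.subst σ.loc σ.set).ren (Ren.shift s) := by
  simp only [LocSet.ren, LocSet.subst_subst]
  cases s <;> rfl

theorem LocalLang.tren_shift_tsub_up (σ : TSubst 𝓛) (s : VSort) (t : 𝓛.Ty) :
    𝓛.tsub (σ.up s).loc (σ.up s).set (σ.up s).lty (𝓛.tren (Ren.shift s) t) =
      𝓛.tren (Ren.shift s) (𝓛.tsub σ.loc σ.set σ.lty t) := by
  simp only [LocalLang.tren, 𝓛.tsub_tsub, 𝓛.tsub_var]
  cases s <;> rfl

/-- If weakening commutes with `σ'` then lifting commutes with composition with `σ'`. -/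
theorem TSubst.up_comp_up {σ' : TSubst 𝓛} {s : VSort}
    (h : ∀ τ : CTy L 𝓛.Ty, (τ.ren 𝓛 (Ren.shift s)).subst (σ'.up s) =
      (τ.subst σ').ren 𝓛 (Ren.shift s)) (σ : TSubst 𝓛) :
    (σ.up s).comp (σ'.up s) = (σ.comp σ').up s := by
  have hl := LocE.ren_shift_subst_up σ' s
  have hs := LocSet.ren_shift_subst_up σ' s
  have ht := LocalLang.tren_shift_tsub_up σ' s
  cases s <;> refine TSubst.ext' ?_ ?_ ?_ ?_ <;> intro n <;>
    first
    | exact hl _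
    | exact hs _
    | exact ht _
    | exact h _
    | (cases n <;> first | rfl | exact hl _ | exact hs _ | exact ht _ | exact h _ |
      exact 𝓛.tsub_var _ _ _ _)

theorem CTy.subst_ren (σ : TSubst 𝓛) (ξ : Ren) (τ : CTy L 𝓛.Ty) :
    (τ.subst σ).ren 𝓛 ξ = τ.subst (σ.ren ξ) := by
  rw [CTy.ren_eq_subst, ← TSubst.comp_toT]
  refine CTy.subst_subst_of_up (p := fun _ σ' => ∃ ξ : Ren, σ' = ξ.toT 𝓛) ?_ τ _ _ ⟨ξ, rfl⟩
  rintro σ _ s ⟨ξ, rfl⟩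
  refine ⟨⟨ξ.up s, Ren.toT_up ξ s⟩, TSubst.up_comp_up (fun τ => ?_) σ⟩
  rw [CTy.ren_subst, TSubst.shift_comp_up, ← TSubst.comp_toT, ← CTy.ren_eq_subst ξ,
    CTy.ren_eq_subst (Ren.shift s), CTy.ren_subst]

/-- Weakening commutes with substitution. -/
theorem CTy.ren_shift_subst_up (σ : TSubst 𝓛) (s : VSort) (τ : CTy L 𝓛.Ty) :
    (τ.ren 𝓛 (Ren.shift s)).subst (σ.up s) = (τ.subst σ).ren 𝓛 (Ren.shift s) := by
  rw [CTy.ren_subst, TSubst.shift_comp_up, CTy.subst_ren]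

theorem CTy.subst_subst (σ σ' : TSubst 𝓛) (τ : CTy L 𝓛.Ty) :
    (τ.subst σ).subst σ' = τ.subst (σ.comp σ') :=
  CTy.subst_subst_of_up (p := fun _ _ => True)
    (fun σ σ' s _ => ⟨trivial, TSubst.up_comp_up (CTy.ren_shift_subst_up σ' s) σ⟩) τ σ σ' trivial

theorem TSubst.id_up (s : VSort) : (TSubst.id 𝓛).up s = TSubst.id 𝓛 := by
  cases s <;> refine TSubst.ext' ?_ ?_ ?_ ?_ <;> intro n <;>
    first
    | rfl
    | exact 𝓛.tsub_var _ _ _ _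
    | (cases n <;> first | rfl | exact 𝓛.tsub_var _ _ _ _)

@[simp] theorem Kind.subst_var (κ : Kind L) : κ.subst .var .var = κ := by
  cases κ <;> simp [Kind.subst]

@[simp] theorem CTy.subst_id (τ : CTy L 𝓛.Ty) : τ.subst (TSubst.id 𝓛) = τ := by
  induction τ with
  | var n => rfl
  | located t ρ => simp [CTy.subst, TSubst.id, 𝓛.tsub_id]
  | arr _ ρ _ h₁ h₂ => simp [CTy.subst, h₁, h₂]; simp [TSubst.id]
  | sum ρ _ _ h₁ h₂ => simp [CTy.subst, h₁, h₂]; simp [TSubst.id]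
  | prod _ _ h₁ h₂ => simp [CTy.subst, h₁, h₂]
  | mu ρ _ h => simp [CTy.subst, h, TSubst.id_up]; simp [TSubst.id]
  | all κ ρ _ h => simp [CTy.subst, h, TSubst.id_up]; simp [TSubst.id]

/-- The sort of the variables that a type argument may replace. -/
def TArg.sort : TArg L 𝓛.Ty → VSort
  | .loc _ => .loc
  | .set _ => .set
  | .lty _ => .lty
  | .prog _ => .ty

theorem TSubst.shift_comp_cons (σ : TSubst 𝓛) (a : TArg L 𝓛.Ty) :
    ((Ren.shift a.sort).toT 𝓛).comp (σ.cons a) = σ := by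
  cases a <;> refine TSubst.ext' ?_ ?_ ?_ ?_ <;> intro n <;>
    first | rfl | exact 𝓛.tsub_var _ _ _ _

/-- Instantiating a variable that does not occur has no effect. -/
theorem CTy.ren_shift_inst (a : TArg L 𝓛.Ty) (τ : CTy L 𝓛.Ty) :
    (τ.ren 𝓛 (Ren.shift a.sort)).subst (TSubst.inst a) = τ := by
  rw [CTy.ren_subst, TSubst.inst, TSubst.shift_comp_cons, CTy.subst_id]

theorem TSubst.up_comp_inst (σ : TSubst 𝓛) (a : TArg L 𝓛.Ty) :
    (σ.up a.sort).comp (TSubst.inst a) = σ.cons a := by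
  have hl : ∀ ℓ : LocE L, (ℓ.ren (Ren.shift a.sort)).subst (TSubst.inst a).loc = ℓ := by
    intro ℓ
    simp only [LocE.ren, LocE.subst_subst]
    cases a <;> exact LocE.subst_var ℓ
  have hs : ∀ ρ : LocSet L, (ρ.ren (Ren.shift a.sort)).subst (TSubst.inst a).loc
      (TSubst.inst a).set = ρ := by
    intro ρ
    simp only [LocSet.ren, LocSet.subst_subst]
    cases a <;> exact LocSet.subst_var ρ
  have ht : ∀ t : 𝓛.Ty, 𝓛.tsub (TSubst.inst a).loc (TSubst.inst a).set (TSubst.inst a).lty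
      (𝓛.tren (Ren.shift a.sort) t) = t := by
    intro t
    simp only [LocalLang.tren, 𝓛.tsub_tsub, 𝓛.tsub_var]
    cases a <;> exact 𝓛.tsub_id t
  have h := CTy.ren_shift_inst a
  cases a <;> refine TSubst.ext' ?_ ?_ ?_ ?_ <;> intro n <;>
    first
    | exact hl _
    | exact hs _
    | exact ht _
    | exact h _
    | (cases n <;> first | rfl | exact hl _ | exact hs _ | exact ht _ | exact h _ |
      exact 𝓛.tsub_var _ _ _ _)

theorem TSubst.inst_comp (σ : TSubst 𝓛) (a : TArg L 𝓛.Ty) :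
    (TSubst.inst a).comp σ = σ.cons (a.subst σ) := by
  cases a <;> refine TSubst.ext' ?_ ?_ ?_ ?_ <;> intro n <;>
    first
    | rfl
    | exact 𝓛.tsub_var _ _ _ _
    | (cases n <;> first | rfl | exact 𝓛.tsub_var _ _ _ _)

@[simp] theorem TArg.sort_subst (σ : TSubst 𝓛) (a : TArg L 𝓛.Ty) :
    (a.subst σ).sort = a.sort := by
  cases a <;> rfl

theorem TSubst.inst_comp_eq (σ : TSubst 𝓛) (a : TArg L 𝓛.Ty) :
    (TSubst.inst a).comp σ = (σ.up a.sort).comp (TSubst.inst (a.subst σ)) := by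
  rw [TSubst.inst_comp, ← TSubst.up_comp_inst, TArg.sort_subst]

/-- Substitution commutes with instantiation. -/
theorem CTy.inst_subst (σ : TSubst 𝓛) (a : TArg L 𝓛.Ty) (τ : CTy L 𝓛.Ty) :
    (τ.subst (TSubst.inst a)).subst σ =
      (τ.subst (σ.up a.sort)).subst (TSubst.inst (a.subst σ)) := by
  rw [CTy.subst_subst, CTy.subst_subst, TSubst.inst_comp_eq]

theorem LocSet.inst_subst (σ : TSubst 𝓛) (a : TArg L 𝓛.Ty) (ρ : LocSet L) :
    (ρ.subst (TSubst.inst a).loc (TSubst.inst a).set).subst σ.loc σ.set =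
      (ρ.subst (σ.up a.sort).loc (σ.up a.sort).set).subst (TSubst.inst (a.subst σ)).loc
        (TSubst.inst (a.subst σ)).set := by
  have h := TSubst.inst_comp_eq σ a
  rw [LocSet.subst_subst, LocSet.subst_subst]
  exact congrArg₂ (fun l s => ρ.subst l s) (congrArg TSubst.loc h) (congrArg TSubst.set h)

theorem LocSet.dropLoc_subst_up (σ : TSubst 𝓛) (ρ : LocSet L) :
    (ρ.subst (σ.up .loc).loc (σ.up .loc).set).dropLoc = ρ.dropLoc.subst σ.loc σ.set := by
  induction ρ with
  | var n => exact LocSet.dropLoc_ren_shift _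
  | sng ℓ =>
    rcases ℓ with (_ | n) | A
    · rfl
    · exact LocSet.dropLoc_ren_shift (.sng (σ.loc n))
    · rfl
  | union _ _ h₁ h₂ => exact congrArg₂ LocSet.union h₁ h₂
  | _ => rfl

theorem LocSet.dropSet_subst_up (σ : TSubst 𝓛) (ρ : LocSet L) :
    (ρ.subst (σ.up .set).loc (σ.up .set).set).dropSet = ρ.dropSet.subst σ.loc σ.set := by
  induction ρ with
  | var n =>
    cases n with
    | zero => rfl
    | succ n => exact LocSet.dropSet_ren_shift _
  | sng ℓ =>
    cases ℓ with
    | var n => exact LocSet.dropSet_ren_shift (.sng (σ.loc n))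
    | const A => rfl
  | union _ _ h₁ h₂ => exact congrArg₂ LocSet.union h₁ h₂
  | _ => rfl

end TypeAlgebra
section KindingSubst

variable {L : Type u} {𝓛 : LocalLang.{u, v, w} L}

/-! ### Kinding is stable under substitution -/

variable (𝓛) in
theorem WfTypeSubst.shift (Γ : KCtx L) (κ : Kind L) :
    WfTypeSubst 𝓛.Kinded Γ.toTyCtx (Γ.ext κ).toTyCtx
      (fun n => (.var ((Ren.shift κ.sort).loc n) : LocE L))
      (fun n => .var ((Ren.shift κ.sort).set n))
      (fun n => 𝓛.tvar ((Ren.shift κ.sort).lty n)) := by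
  cases κ with
  | loc =>
    exact ⟨fun n h => Nat.succ_lt_succ h, fun n k h => .var h, fun n h => 𝓛.kinded_tvar _ _ h⟩
  | set k =>
    exact ⟨fun n h => h, fun n k h => .var h, fun n h => 𝓛.kinded_tvar _ _ h⟩
  | lty =>
    exact ⟨fun n h => h, fun n k h => .var h,
      fun n h => 𝓛.kinded_tvar _ _ (Nat.succ_lt_succ h)⟩
  | prog ρ =>
    exact ⟨fun n h => h, fun n k h => .var h, fun n h => 𝓛.kinded_tvar _ _ h⟩

/-- `σ` is a well-formed substitution from `Γ` to `Γ'`, where the images of the program-type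
variables are subject to the judgment `Q`. -/
def TSubst.Wf (Q : KCtx L → CTy L 𝓛.Ty → LocSet L → Prop) (Γ Γ' : KCtx L) (σ : TSubst 𝓛) :
    Prop :=
  WfTypeSubst 𝓛.Kinded Γ.toTyCtx Γ'.toTyCtx σ.loc σ.set σ.lty ∧
    ∀ n ρ, Γ.progs[n]? = some ρ → Q Γ' (σ.ty n) (ρ.subst σ.loc σ.set)

/-- The requirements under which images of program-type variables that satisfy `Q` can be
pushed under binders and are well-kinded. -/
structure KindKit (Q : KCtx L → CTy L 𝓛.Ty → LocSet L → Prop) : Prop where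
  kinded : ∀ {Γ τ ρ}, Q Γ τ ρ → CTy.Kinded 𝓛 Γ τ ρ
  shift : ∀ {Γ τ ρ} (κ : Kind L), Q Γ τ ρ →
    Q (Γ.ext κ) (τ.ren 𝓛 (Ren.shift κ.sort)) (ρ.ren (Ren.shift κ.sort))
  var : ∀ {Γ n ρ}, Γ.progs[n]? = some ρ → Q Γ (.var n) ρ

theorem LocSet.Kinded.ren_shift {Γ : KCtx L} {ρ : LocSet L} {k : SetKind}
    (h : ρ.Kinded Γ.toTyCtx k) (κ : Kind L) :
    (ρ.ren (Ren.shift κ.sort)).Kinded (Γ.ext κ).toTyCtx k := by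
  refine h.subst (fun n hn => ?_) fun n k hk => .var ?_
  · cases κ with
    | loc => exact Nat.succ_lt_succ hn
    | _ => exact hn
  · cases κ <;> exact hk

theorem LocE.Kinded.ren_shift {Γ : KCtx L} {ℓ : LocE L} (h : ℓ.Kinded Γ.toTyCtx) (κ : Kind L) :
    (ℓ.ren (Ren.shift κ.sort)).Kinded (Γ.ext κ).toTyCtx := by
  refine h.subst fun n hn => ?_
  cases κ with
  | loc => exact Nat.succ_lt_succ hn
  | _ => exact hn

theorem LocalLang.kinded_tren_shift {Γ : KCtx L} {t : 𝓛.Ty} (h : 𝓛.Kinded Γ.toTyCtx t)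
    (κ : Kind L) : 𝓛.Kinded (Γ.ext κ).toTyCtx (𝓛.tren (Ren.shift κ.sort) t) :=
  𝓛.kinded_tsub _ _ _ _ _ _ h (WfTypeSubst.shift 𝓛 Γ κ)

@[simp] theorem LocSet.ren_shift_lty (ρ : LocSet L) : ρ.ren (Ren.shift .lty) = ρ :=
  LocSet.ren_shift_of_ne (by simp) (by simp) ρ

@[simp] theorem LocSet.ren_shift_ty (ρ : LocSet L) : ρ.ren (Ren.shift .ty) = ρ :=
  LocSet.ren_shift_of_ne (by simp) (by simp) ρ

@[simp] theorem LocSet.ren_shift_ex (ρ : LocSet L) : ρ.ren (Ren.shift .ex) = ρ :=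
  LocSet.ren_shift_of_ne (by simp) (by simp) ρ

@[simp] theorem LocSet.ren_shift_ch (ρ : LocSet L) : ρ.ren (Ren.shift .ch) = ρ :=
  LocSet.ren_shift_of_ne (by simp) (by simp) ρ

@[simp] theorem LocE.ren_shift_ex (ℓ : LocE L) : ℓ.ren (Ren.shift .ex) = ℓ :=
  LocE.ren_shift_of_ne (by simp) ℓ

@[simp] theorem LocE.ren_shift_ch (ℓ : LocE L) : ℓ.ren (Ren.shift .ch) = ℓ :=
  LocE.ren_shift_of_ne (by simp) ℓ

theorem TSubst.Wf.up {Q : KCtx L → CTy L 𝓛.Ty → LocSet L → Prop} (hQ : KindKit Q)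
    {Γ Γ' : KCtx L} {σ : TSubst 𝓛} (h : σ.Wf Q Γ Γ') (κ : Kind L) :
    (σ.up κ.sort).Wf Q (Γ.ext κ) (Γ'.ext (κ.subst σ.loc σ.set)) := by
  obtain ⟨⟨hl, hs, ht⟩, hp⟩ := h
  have hsort : (κ.subst σ.loc σ.set).sort = κ.sort := Kind.sort_subst _ _ κ
  have hl' : ∀ n, n < Γ.locs →
      ((σ.loc n).ren (Ren.shift κ.sort)).Kinded (Γ'.ext (κ.subst σ.loc σ.set)).toTyCtx :=
    fun n hn => hsort ▸ (hl n hn).ren_shift _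
  have hs' : ∀ n k, Γ.sets[n]? = some k →
      ((σ.set n).ren (Ren.shift κ.sort)).Kinded (Γ'.ext (κ.subst σ.loc σ.set)).toTyCtx k :=
    fun n k hn => hsort ▸ (hs n k hn).ren_shift _
  have ht' : ∀ n, n < Γ.ltys → 𝓛.Kinded (Γ'.ext (κ.subst σ.loc σ.set)).toTyCtx
      (𝓛.tren (Ren.shift κ.sort) (σ.lty n)) :=
    fun n hn => hsort ▸ 𝓛.kinded_tren_shift (ht n hn) _
  have hp' : ∀ n ρ, Γ.progs[n]? = some ρ → Q (Γ'.ext (κ.subst σ.loc σ.set))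
      ((σ.ty n).ren 𝓛 (Ren.shift κ.sort))
      ((ρ.ren (Ren.shift κ.sort)).subst (σ.up κ.sort).loc (σ.up κ.sort).set) := by
    intro n ρ hn
    rw [LocSet.ren_shift_subst_up, ← hsort]
    exact hQ.shift _ (hp n ρ hn)
  cases κ with
  | loc =>
    refine ⟨⟨?_, hs', ht'⟩, ?_⟩
    · rintro (_ | n) hn
      · exact Nat.succ_pos _
      · exact hl' n (Nat.lt_of_succ_lt_succ hn)
    · intro n ρ hn
      simp only [KCtx.ext, List.getElem?_map, Option.map_eq_some_iff] at hn
      obtain ⟨ρ, hn, rfl⟩ := hn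
      exact hp' n ρ hn
  | set k =>
    refine ⟨⟨hl', ?_, ht'⟩, ?_⟩
    · rintro (_ | n) k' hn
      · exact .var hn
      · exact hs' n k' hn
    · intro n ρ hn
      simp only [KCtx.ext, List.getElem?_map, Option.map_eq_some_iff] at hn
      obtain ⟨ρ, hn, rfl⟩ := hn
      exact hp' n ρ hn
  | lty =>
    refine ⟨⟨hl', hs', ?_⟩, ?_⟩
    · rintro (_ | n) hn
      · exact 𝓛.kinded_tvar _ _ (Nat.succ_pos _)
      · exact ht' n (Nat.lt_of_succ_lt_succ hn)
    · intro n ρ hn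
      have := hp' n ρ hn
      rwa [Kind.sort, LocSet.ren_shift_lty] at this
  | prog ρ₀ =>
    refine ⟨⟨hl', hs', ht'⟩, ?_⟩
    rintro (_ | n) ρ hn
    · cases hn
      have h := LocSet.ren_shift_subst_up σ .ty ρ₀
      rw [LocSet.ren_shift_ty, LocSet.ren_shift_ty] at h
      simp only [Kind.sort, h]
      exact hQ.var rfl
    · have := hp' n ρ hn
      rwa [Kind.sort, LocSet.ren_shift_ty] at this

theorem Kind.IsLoc.subst_iff (l : ℕ → LocE L) (s : ℕ → LocSet L) (κ : Kind L) :
    (κ.subst l s).IsLoc ↔ κ.IsLoc := by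
  cases κ <;> rfl

/-- Kinding is stable under substitution.  With variables as images this is weakening, which
is what it takes to push arbitrary well-kinded images under binders. -/
theorem CTy.Kinded.subst_of_kit {Q : KCtx L → CTy L 𝓛.Ty → LocSet L → Prop} (hQ : KindKit Q)
    {Γ Γ' : KCtx L} {σ : TSubst 𝓛} {τ : CTy L 𝓛.Ty} {ρ : LocSet L}
    (hτ : CTy.Kinded 𝓛 Γ τ ρ) (h : σ.Wf Q Γ Γ') :
    CTy.Kinded 𝓛 Γ' (τ.subst σ) (ρ.subst σ.loc σ.set) := by
  induction hτ generalizing Γ' σ with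
  | var hn => exact hQ.kinded (h.2 _ _ hn)
  | located ht hρ => exact .located (𝓛.kinded_tsub _ _ _ _ _ _ ht h.1) (hρ.subst h.1.1 h.1.2.1)
  | arr _ _ hρ ih₁ ih₂ => exact .arr (ih₁ h) (ih₂ h) (hρ.subst h.1.1 h.1.2.1)
  | prod _ _ ih₁ ih₂ => exact .prod (ih₁ h) (ih₂ h)
  | sum _ _ hρ hsub ih₁ ih₂ =>
    exact .sum (ih₁ h) (ih₂ h) (hρ.subst h.1.1 h.1.2.1) (hsub.subst _ _)
  | @mu Γ τ ρ ρ' hρ _ hsub ih =>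
    have hup := ih (h.up hQ (.prog ρ))
    have e : ∀ ρ : LocSet L, ρ.subst (σ.up .ty).loc (σ.up .ty).set = ρ.subst σ.loc σ.set := by
      intro ρ
      have h := LocSet.ren_shift_subst_up σ .ty ρ
      rwa [LocSet.ren_shift_ty, LocSet.ren_shift_ty] at h
    refine .mu (hρ.subst h.1.1 h.1.2.1) hup ?_
    rw [Kind.sort, e]
    exact hsub.subst _ _
  | @allLoc Γ κ τ ρ ρ' hκ hρ _ ih =>
    have hw := h.up hQ κ
    exact .allLoc ((Kind.IsLoc.subst_iff _ _ κ).2 hκ) (hρ.subst hw.1.1 hw.1.2.1) (ih hw)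
  | @all Γ κ τ ρ ρ' hκ hwf hρ _ ih =>
    have hw := h.up hQ κ
    have e : ∀ ρ : LocSet L, ρ.subst (σ.up κ.sort).loc (σ.up κ.sort).set =
        ρ.subst σ.loc σ.set := by
      intro ρ
      have h := LocSet.ren_shift_subst_up σ κ.sort ρ
      cases κ with
      | loc => exact absurd trivial hκ
      | set k => exact absurd trivial hκ
      | lty => rwa [Kind.sort, LocSet.ren_shift_lty, LocSet.ren_shift_lty] at h
      | prog ρ => rwa [Kind.sort, LocSet.ren_shift_ty, LocSet.ren_shift_ty] at h
    have hwf' : (κ.subst σ.loc σ.set).Wf Γ' := by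
      cases κ with
      | prog ρ => exact LocSet.Kinded.subst h.1.1 h.1.2.1 hwf
      | _ => trivial
    have hall := CTy.Kinded.all (fun hc => hκ ((Kind.IsLoc.subst_iff _ _ κ).1 hc)) hwf'
      (hρ.subst hw.1.1 hw.1.2.1) (ih hw)
    rw [e ρ'] at hall
    have hu : (LocSet.union ρ ρ').subst σ.loc σ.set =
        .union (ρ.subst (σ.up κ.sort).loc (σ.up κ.sort).set) (ρ'.subst σ.loc σ.set) := by
      rw [e ρ]; rfl
    rw [hu]
    exact hall

/-- Images that are variables: this makes well-formed substitutions renamings. -/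
theorem KindKit.vars :
    KindKit (𝓛 := 𝓛) (fun Γ τ ρ => ∃ n, τ = .var n ∧ Γ.progs[n]? = some ρ) where
  kinded := by rintro Γ _ ρ ⟨n, rfl, h⟩; exact .var h
  shift := by
    rintro Γ _ ρ κ ⟨n, rfl, h⟩
    refine ⟨_, rfl, ?_⟩
    cases κ <;> simp [Ren.shift, Ren.modify, Ren.id, Kind.sort, KCtx.ext, h]
    · exact (LocSet.ren_shift_lty ρ).symm
    · exact (LocSet.ren_shift_ty ρ).symm
  var := fun h => ⟨_, rfl, h⟩

theorem TSubst.Wf.shift {Q : KCtx L → CTy L 𝓛.Ty → LocSet L → Prop} (hQ : KindKit Q)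
    (Γ : KCtx L) (κ : Kind L) : ((Ren.shift κ.sort).toT 𝓛).Wf Q Γ (Γ.ext κ) := by
  refine ⟨WfTypeSubst.shift 𝓛 Γ κ, fun n ρ h => ?_⟩
  have h' := hQ.shift κ (hQ.var h)
  exact h'

theorem CTy.Kinded.ren_shift {Γ : KCtx L} {τ : CTy L 𝓛.Ty} {ρ : LocSet L}
    (h : CTy.Kinded 𝓛 Γ τ ρ) (κ : Kind L) :
    CTy.Kinded 𝓛 (Γ.ext κ) (τ.ren 𝓛 (Ren.shift κ.sort)) (ρ.ren (Ren.shift κ.sort)) := by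
  rw [CTy.ren_eq_subst]
  exact h.subst_of_kit KindKit.vars (TSubst.Wf.shift KindKit.vars Γ κ)

theorem KindKit.kindedTypes : KindKit (CTy.Kinded 𝓛) where
  kinded := fun h => h
  shift := fun κ h => h.ren_shift κ
  var := .var

theorem CTy.Kinded.subst {Γ Γ' : KCtx L} {σ : TSubst 𝓛} {τ : CTy L 𝓛.Ty} {ρ : LocSet L}
    (hτ : CTy.Kinded 𝓛 Γ τ ρ) (h : σ.Wf (CTy.Kinded 𝓛) Γ Γ') :
    CTy.Kinded 𝓛 Γ' (τ.subst σ) (ρ.subst σ.loc σ.set) :=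
  hτ.subst_of_kit KindKit.kindedTypes h

theorem TArg.Kinded.subst {Γ Γ' : KCtx L} {σ : TSubst 𝓛} {a : TArg L 𝓛.Ty} {κ : Kind L}
    (ha : TArg.Kinded 𝓛 Γ a κ) (h : σ.Wf (CTy.Kinded 𝓛) Γ Γ') :
    TArg.Kinded 𝓛 Γ' (a.subst σ) (κ.subst σ.loc σ.set) := by
  cases ha with
  | loc hℓ => exact .loc (hℓ.subst h.1.1)
  | set hρ => exact .set (hρ.subst h.1.1 h.1.2.1)
  | lty ht => exact .lty (𝓛.kinded_tsub _ _ _ _ _ _ ht h.1)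
  | prog hτ => exact .prog (hτ.subst h)

theorem TArg.Kinded.sort_eq {Γ : KCtx L} {a : TArg L 𝓛.Ty} {κ : Kind L}
    (ha : TArg.Kinded 𝓛 Γ a κ) : a.sort = κ.sort := by
  cases ha <;> rfl

theorem TSubst.Wf.id (Γ : KCtx L) : (TSubst.id 𝓛).Wf (CTy.Kinded 𝓛) Γ Γ := by
  refine ⟨⟨fun n h => h, fun n k h => .var h, fun n h => 𝓛.kinded_tvar _ _ h⟩, fun n ρ h => ?_⟩
  have : ρ.subst (TSubst.id 𝓛).loc (TSubst.id 𝓛).set = ρ := LocSet.subst_var ρ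
  rw [this]
  exact .var h

/-- Instantiating the innermost type variable by an argument of its kind. -/
theorem TSubst.Wf.inst {Γ : KCtx L} {a : TArg L 𝓛.Ty} {κ : Kind L}
    (ha : TArg.Kinded 𝓛 Γ a κ) : (TSubst.inst a).Wf (CTy.Kinded 𝓛) (Γ.ext κ) Γ := by
  obtain ⟨⟨hl, hs, ht⟩, hp⟩ := TSubst.Wf.id (𝓛 := 𝓛) Γ
  have e : ∀ ρ : LocSet L, (ρ.ren (Ren.shift a.sort)).subst (TSubst.inst a).loc
      (TSubst.inst a).set = ρ := by
    intro ρ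
    simp only [LocSet.ren, LocSet.subst_subst]
    cases a <;> exact LocSet.subst_var ρ
  cases ha with
  | loc hℓ =>
    refine ⟨⟨?_, hs, ht⟩, ?_⟩
    · rintro (_ | n) hn
      · exact hℓ
      · exact hl n (Nat.lt_of_succ_lt_succ hn)
    · intro n ρ hn
      simp only [KCtx.ext, List.getElem?_map, Option.map_eq_some_iff] at hn
      obtain ⟨ρ, hn, rfl⟩ := hn
      exact (e ρ).symm ▸ .var hn
  | set hρ =>
    refine ⟨⟨hl, ?_, ht⟩, ?_⟩
    · rintro (_ | n) k hn
      · cases hn; exact hρ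
      · exact hs n k hn
    · intro n ρ hn
      simp only [KCtx.ext, List.getElem?_map, Option.map_eq_some_iff] at hn
      obtain ⟨ρ, hn, rfl⟩ := hn
      exact (e ρ).symm ▸ .var hn
  | lty h =>
    refine ⟨⟨hl, hs, ?_⟩, hp⟩
    rintro (_ | n) hn
    · exact h
    · exact ht n (Nat.lt_of_succ_lt_succ hn)
  | prog h =>
    refine ⟨⟨hl, hs, ht⟩, ?_⟩
    rintro (_ | n) ρ hn
    · cases hn
      have e' : ∀ ρ : LocSet L, ρ.subst (TSubst.inst (.prog ‹_› : TArg L 𝓛.Ty)).loc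
        (TSubst.inst (.prog ‹_› : TArg L 𝓛.Ty)).set = ρ := fun ρ => LocSet.subst_var ρ
      rw [e']
      exact h
    · exact hp n ρ hn

/-! ### Names in substitution instances -/

/-- The names in the images of a substitution. -/
def TSubst.names (σ : TSubst 𝓛) : Set L :=
  ((⋃ n, (σ.loc n).nl) ∪ ⋃ n, (σ.set n).nl) ∪ ⋃ n, (σ.ty n).nl

@[simp] theorem CTy.nl_ren (ξ : Ren) (τ : CTy L 𝓛.Ty) : (τ.ren 𝓛 ξ).nl = τ.nl := by
  induction τ generalizing ξ <;> simp_all [CTy.ren, CTy.nl]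

/-- Lifting adds no names, as the new image is a variable. -/
theorem TSubst.names_up (σ : TSubst 𝓛) (s : VSort) : (σ.up s).names ⊆ σ.names := by
  intro A hA
  simp only [TSubst.names, Set.mem_union, Set.mem_iUnion] at hA ⊢
  rcases hA with (⟨n, hn⟩ | ⟨n, hn⟩) | ⟨n, hn⟩
  · refine .inl (.inl ?_)
    cases s <;> simp only [TSubst.up, TSubst.consVar, TSubst.ren] at hn <;>
      first
      | exact ⟨n, LocE.nl_ren _ _ ▸ hn⟩
      | (cases n with
        | zero => cases hn
        | succ n => exact ⟨n, LocE.nl_ren _ _ ▸ hn⟩)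
  · refine .inl (.inr ?_)
    cases s <;> simp only [TSubst.up, TSubst.consVar, TSubst.ren] at hn <;>
      first
      | exact ⟨n, LocSet.nl_ren _ _ ▸ hn⟩
      | (cases n with
        | zero => cases hn
        | succ n => exact ⟨n, LocSet.nl_ren _ _ ▸ hn⟩)
  · refine .inr ?_
    cases s <;> simp only [TSubst.up, TSubst.consVar, TSubst.ren] at hn <;>
      first
      | exact ⟨n, CTy.nl_ren _ _ ▸ hn⟩
      | (cases n with
        | zero => cases hn
        | succ n => exact ⟨n, CTy.nl_ren _ _ ▸ hn⟩)

theorem LocE.nl_subst_names (σ : TSubst 𝓛) (ℓ : LocE L) :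
    (ℓ.subst σ.loc).nl ⊆ ℓ.nl ∪ σ.names :=
  (LocE.nl_subst σ.loc ℓ).trans (Set.union_subset_union_right _
    (Set.subset_union_left.trans Set.subset_union_left))

theorem LocSet.nl_subst_names (σ : TSubst 𝓛) (ρ : LocSet L) :
    (ρ.subst σ.loc σ.set).nl ⊆ ρ.nl ∪ σ.names :=
  (LocSet.nl_subst σ.loc σ.set ρ).trans (Set.union_subset_union_right _ Set.subset_union_left)

theorem CTy.nl_subst_names (σ : TSubst 𝓛) (τ : CTy L 𝓛.Ty) :
    (τ.subst σ).nl ⊆ τ.nl ∪ σ.names := by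
  induction τ generalizing σ with
  | var n =>
    exact ((Set.subset_iUnion (fun n => (σ.ty n).nl) n).trans Set.subset_union_right).trans
      Set.subset_union_right
  | located t ρ => exact LocSet.nl_subst_names σ ρ
  | arr _ ρ _ h₁ h₂ =>
    intro A hA
    have := @h₁ σ A; have := @h₂ σ A; have := @LocSet.nl_subst_names _ _ σ ρ A
    simp only [CTy.subst, CTy.nl, Set.mem_union] at *
    tauto
  | sum ρ _ _ h₁ h₂ =>
    intro A hA
    have := @h₁ σ A; have := @h₂ σ A; have := @LocSet.nl_subst_names _ _ σ ρ A
    simp only [CTy.subst, CTy.nl, Set.mem_union] at *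
    tauto
  | prod _ _ h₁ h₂ =>
    intro A hA
    have := @h₁ σ A; have := @h₂ σ A
    simp only [CTy.subst, CTy.nl, Set.mem_union] at *
    tauto
  | mu ρ _ h =>
    intro A hA
    have := @h (σ.up .ty) A; have := @LocSet.nl_subst_names _ _ σ ρ A
    have := @TSubst.names_up _ _ σ .ty A
    simp only [CTy.subst, CTy.nl, Set.mem_union] at *
    tauto
  | all κ ρ _ h =>
    intro A hA
    have := @h (σ.up κ.sort) A; have := @LocSet.nl_subst_names _ _ (σ.up κ.sort) ρ A
    have := @TSubst.names_up _ _ σ κ.sort A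
    simp only [CTy.subst, CTy.nl, Set.mem_union] at *
    tauto

theorem TSubst.names_id : (TSubst.id 𝓛).names = ∅ := by
  simp [TSubst.names, TSubst.id, LocE.nl, LocSet.nl, CTy.nl]

theorem Ren.names_toT (ξ : Ren) : (ξ.toT 𝓛).names = ∅ := by
  simp [TSubst.names, Ren.toT, LocE.nl, LocSet.nl, CTy.nl]

/-! ### Substitution in choreographies -/

variable (𝓛) in
/-- A renaming as a substitution. -/
def Ren.toS (ξ : Ren) : Subst 𝓛 := ⟨ξ.toT 𝓛, fun n => 𝓛.var (ξ.ex n), fun n => .var (ξ.ch n)⟩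

theorem Subst.ext' {σ σ' : Subst 𝓛} (h₁ : σ.tsubst = σ'.tsubst) (h₂ : ∀ n, σ.ex n = σ'.ex n)
    (h₃ : ∀ n, σ.ch n = σ'.ch n) : σ = σ' := by
  cases σ; cases σ'
  simp only [Subst.mk.injEq]
  exact ⟨h₁, funext h₂, funext h₃⟩

theorem Subst.tsubst_up (σ : Subst 𝓛) (s : VSort) : (σ.up s).tsubst = σ.tsubst.up s := by
  cases s <;> rfl

theorem Ren.toS_up (ξ : Ren) (s : VSort) : (ξ.toS 𝓛).up s = (ξ.up s).toS 𝓛 := by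
  refine Subst.ext' ?_ ?_ ?_
  · rw [Subst.tsubst_up]; exact Ren.toT_up ξ s
  · intro n
    cases s <;> first | exact 𝓛.esub_var _ _ _ _ _ |
      (cases n <;> first | rfl | exact 𝓛.esub_var _ _ _ _ _)
  · intro n
    cases s <;> first | rfl | (cases n <;> rfl)

theorem TArg.ren_eq_subst (ξ : Ren) (a : TArg L 𝓛.Ty) : a.ren 𝓛 ξ = a.subst (ξ.toT 𝓛) := by
  cases a with
  | prog τ => exact congrArg TArg.prog (CTy.ren_eq_subst ξ τ)
  | _ => rfl

theorem Chor.ren_eq_subst (ξ : Ren) (C : Chor L 𝓛.Ty 𝓛.Expr) :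
    C.ren 𝓛 ξ = C.subst (ξ.toS 𝓛) := by
  induction C generalizing ξ with
  | tlam κ C h =>
    simp only [Chor.ren, Chor.subst, h, Ren.toS_up]
    cases κ <;> rfl
  | _ =>
    simp_all [Chor.ren, Chor.subst, Ren.toS_up, TArg.ren_eq_subst] <;> (try constructor) <;>
      rfl

theorem Chor.spawned_ren (ξ : Ren) (C : Chor L 𝓛.Ty 𝓛.Expr) :
    (C.ren 𝓛 ξ).spawned = C.spawned := by
  induction C generalizing ξ <;> simp_all [Chor.ren, Chor.spawned]

theorem Subst.spawned_up {σ : Subst 𝓛} (h : ∀ n, (σ.ch n).spawned = ∅) (s : VSort) (n : ℕ) :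
    ((σ.up s).ch n).spawned = ∅ := by
  cases s <;>
    first
    | exact (Chor.spawned_ren _ _).trans (h n)
    | (cases n with
      | zero => rfl
      | succ n => exact (Chor.spawned_ren _ _).trans (h n))

/-- Substitution changes the spawned locations neither by its images, which have none, nor
otherwise, since a `kill-after` carries a concrete name. -/
theorem Chor.spawned_subst {σ : Subst 𝓛} (h : ∀ n, (σ.ch n).spawned = ∅)
    (C : Chor L 𝓛.Ty 𝓛.Expr) : (C.subst σ).spawned = C.spawned := by
  induction C generalizing σ with
  | var n => exact h n
  | lam ρ C ih => exact ih (Subst.spawned_up (Subst.spawned_up h _) _)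
  | tlam κ C ih => exact ih (Subst.spawned_up (Subst.spawned_up h _) _)
  | fork ℓ C ih => exact ih (Subst.spawned_up (Subst.spawned_up h _) _)
  | _ => simp_all [Chor.subst, Chor.spawned, Subst.spawned_up]

end KindingSubst
section TypingSubst

variable {L : Type u} {𝓛 : LocalLang.{u, v, w} L}

/-! ### Typing is stable under substitution -/

@[simp] theorem CTy.ren_shift_ex (τ : CTy L 𝓛.Ty) : τ.ren 𝓛 (Ren.shift .ex) = τ :=
  (CTy.ren_eq_subst _ τ).trans (CTy.subst_id τ)

@[simp] theorem CTy.ren_shift_ch (τ : CTy L 𝓛.Ty) : τ.ren 𝓛 (Ren.shift .ch) = τ :=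
  (CTy.ren_eq_subst _ τ).trans (CTy.subst_id τ)

theorem LocalLang.tren_shift_ex (t : 𝓛.Ty) : 𝓛.tren (Ren.shift .ex) t = t := 𝓛.tsub_id t

theorem LocalLang.tren_shift_ch (t : 𝓛.Ty) : 𝓛.tren (Ren.shift .ch) t = t := 𝓛.tsub_id t

@[simp] theorem TSubst.up_ex (σ : TSubst 𝓛) : σ.up .ex = σ :=
  TSubst.ext' (fun _ => LocE.ren_shift_ex _) (fun _ => LocSet.ren_shift_ex _)
    (fun _ => 𝓛.tren_shift_ex _) (fun _ => CTy.ren_shift_ex _)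

@[simp] theorem TSubst.up_ch (σ : TSubst 𝓛) : σ.up .ch = σ :=
  TSubst.ext' (fun _ => LocE.ren_shift_ch _) (fun _ => LocSet.ren_shift_ch _)
    (fun _ => 𝓛.tren_shift_ch _) (fun _ => CTy.ren_shift_ch _)

/-- Typing of local programs is monotone in the local typing context. -/
theorem LocalLang.typed_weaken {Γ : TyCtx} {Δ Δ' : ℕ → Option 𝓛.Ty} {e : 𝓛.Expr} {t : 𝓛.Ty}
    (h : 𝓛.Typed Γ Δ e t) (hΔ : ∀ n b, Δ n = some b → Δ' n = some b) : 𝓛.Typed Γ Δ' e t := by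
  have := 𝓛.typed_esub Γ Γ Δ Δ' .var .var 𝓛.tvar 𝓛.var e t h
    ⟨fun n h => h, fun n k h => .var h, fun n h => 𝓛.kinded_tvar _ _ h⟩
    (fun n b hb => by rw [𝓛.tsub_id]; exact 𝓛.typed_var _ _ _ _ (hΔ n b hb))
  rwa [𝓛.esub_id, 𝓛.tsub_id] at this

theorem LocalLang.typed_of_closed {Γ : TyCtx} {e : 𝓛.Expr} {t : 𝓛.Ty}
    (h : 𝓛.Typed Γ (fun _ => none) e t) (Δ : ℕ → Option 𝓛.Ty) : 𝓛.Typed Γ Δ e t :=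
  𝓛.typed_weaken h (by simp)

/-- The image `e` of a local variable `ρ.x : t` under a well-formed substitution: a closed
program, or a variable that is available wherever `x` is. -/
def LocalImage (Γ : Ctx 𝓛) (e : 𝓛.Expr) (ρ : LocSet L) (t : 𝓛.Ty) : Prop :=
  𝓛.Typed Γ.kctx.toTyCtx (fun _ => none) e t ∨ ∃ m, e = 𝓛.var m ∧ Γ.locals[m]? = some (ρ, t)

theorem LocalImage.extTy {Γ : Ctx 𝓛} {e : 𝓛.Expr} {ρ : LocSet L} {t : 𝓛.Ty}
    (h : LocalImage Γ e ρ t) (κ : Kind L) :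
    LocalImage (Γ.extTy κ) (𝓛.eren (Ren.shift κ.sort) e) (ρ.ren (Ren.shift κ.sort))
      (𝓛.tren (Ren.shift κ.sort) t) := by
  rcases h with h | ⟨m, rfl, h⟩
  · exact .inl (𝓛.typed_esub _ _ _ _ _ _ _ _ _ _ h (WfTypeSubst.shift 𝓛 Γ.kctx κ) (by simp))
  · refine .inr ⟨m, ?_, ?_⟩
    · rw [LocalLang.eren, 𝓛.esub_var]
      cases κ <;> rfl
    · simp [Ctx.extTy, h]

theorem LocalImage.extVar {Γ : Ctx 𝓛} {e : 𝓛.Expr} {ρ : LocSet L} {t : 𝓛.Ty}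
    (h : LocalImage Γ e ρ t) (τ : CTy L 𝓛.Ty) :
    LocalImage (Γ.extVar τ) (𝓛.eren (Ren.shift .ch) e) ρ t := by
  have : 𝓛.eren (Ren.shift .ch) e = e := 𝓛.esub_id e
  rw [this]
  exact h

theorem LocalImage.extLocal {Γ : Ctx 𝓛} {e : 𝓛.Expr} {ρ : LocSet L} {t : 𝓛.Ty}
    (h : LocalImage Γ e ρ t) (ρ' : LocSet L) (t' : 𝓛.Ty) :
    LocalImage (Γ.extLocal ρ' t') (𝓛.eren (Ren.shift .ex) e) ρ t := by
  rcases h with h | ⟨m, rfl, h⟩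
  · refine .inl ?_
    have := 𝓛.typed_esub _ Γ.kctx.toTyCtx _ (fun _ => none) .var .var 𝓛.tvar
      (fun n => 𝓛.var (n + 1)) e t h
      ⟨fun n h => h, fun n k h => .var h, fun n h => 𝓛.kinded_tvar _ _ h⟩ (by simp)
    rw [𝓛.tsub_id] at this
    exact this
  · exact .inr ⟨m + 1, 𝓛.esub_var _ _ _ _ _, h⟩

/-- The requirements under which images of program variables that satisfy `P` can be pushed
under binders and are typed, without participants and without spawned locations. -/
structure TypeKit (P : Ctx 𝓛 → Chor L 𝓛.Ty 𝓛.Expr → CTy L 𝓛.Ty → Prop) : Prop where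
  typed : ∀ {Γ V τ}, P Γ V τ → ∃ ρ, HasType 𝓛 Γ V τ ρ ∧ ρ.comps = ∅
  extTy : ∀ {Γ V τ} (κ : Kind L), P Γ V τ →
    P (Γ.extTy κ) (V.ren 𝓛 (Ren.shift κ.sort)) (τ.ren 𝓛 (Ren.shift κ.sort))
  extVar : ∀ {Γ V τ} τ', P Γ V τ → P (Γ.extVar τ') (V.ren 𝓛 (Ren.shift .ch)) τ
  extLocal : ∀ {Γ V τ} ρ t, P Γ V τ → P (Γ.extLocal ρ t) (V.ren 𝓛 (Ren.shift .ex)) τ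
  var : ∀ {Γ n τ}, Γ.vars[n]? = some τ → P Γ (.var n) τ

/-- `σ` is a well-formed substitution from `Γ` to `Γ'`, where the images of the program
variables are subject to the judgment `P`. -/
structure Subst.Wf (P : Ctx 𝓛 → Chor L 𝓛.Ty 𝓛.Expr → CTy L 𝓛.Ty → Prop) (Γ Γ' : Ctx 𝓛)
    (σ : Subst 𝓛) : Prop where
  types : σ.tsubst.Wf (CTy.Kinded 𝓛) Γ.kctx Γ'.kctx
  locals : ∀ n p, Γ.locals[n]? = some p →
    LocalImage Γ' (σ.ex n) (p.1.subst σ.tsubst.loc σ.tsubst.set)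
      (𝓛.tsub σ.tsubst.loc σ.tsubst.set σ.tsubst.lty p.2)
  vars : ∀ n τ, Γ.vars[n]? = some τ → P Γ' (σ.ch n) (τ.subst σ.tsubst)
  spawned : ∀ n, (σ.ch n).spawned = ∅

variable {P : Ctx 𝓛 → Chor L 𝓛.Ty 𝓛.Expr → CTy L 𝓛.Ty → Prop}

theorem Subst.Wf.upTy (hP : TypeKit P) {Γ Γ' : Ctx 𝓛} {σ : Subst 𝓛} (h : σ.Wf P Γ Γ')
    (κ : Kind L) : (σ.up κ.sort).Wf P (Γ.extTy κ)
      (Γ'.extTy (κ.subst σ.tsubst.loc σ.tsubst.set)) := by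
  have hs : (κ.subst σ.tsubst.loc σ.tsubst.set).sort = κ.sort := Kind.sort_subst _ _ κ
  refine ⟨?_, ?_, ?_, Subst.spawned_up h.spawned _⟩
  · rw [Subst.tsubst_up]
    exact h.types.up KindKit.kindedTypes κ
  · intro n p hn
    simp only [Ctx.extTy, List.getElem?_map, Option.map_eq_some_iff] at hn
    obtain ⟨p, hn, rfl⟩ := hn
    simp only [Subst.tsubst_up, LocSet.ren_shift_subst_up, LocalLang.tren_shift_tsub_up]
    have := (h.locals n p hn).extTy (κ.subst σ.tsubst.loc σ.tsubst.set)
    rw [hs] at this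
    cases κ <;> exact this
  · intro n τ hn
    simp only [Ctx.extTy, List.getElem?_map, Option.map_eq_some_iff] at hn
    obtain ⟨τ, hn, rfl⟩ := hn
    rw [Subst.tsubst_up, CTy.ren_shift_subst_up]
    have := hP.extTy (κ.subst σ.tsubst.loc σ.tsubst.set) (h.vars n τ hn)
    rw [hs] at this
    cases κ <;> exact this

theorem Subst.Wf.upVar (hP : TypeKit P) {Γ Γ' : Ctx 𝓛} {σ : Subst 𝓛} (h : σ.Wf P Γ Γ')
    (τ : CTy L 𝓛.Ty) :
    (σ.up .ch).Wf P (Γ.extVar τ) (Γ'.extVar (τ.subst σ.tsubst)) := by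
  refine ⟨?_, ?_, ?_, Subst.spawned_up h.spawned _⟩
  · rw [Subst.tsubst_up, TSubst.up_ch]
    exact h.types
  · intro n p hn
    rw [Subst.tsubst_up, TSubst.up_ch]
    exact (h.locals n p hn).extVar _
  · intro n τ' hn
    rw [Subst.tsubst_up, TSubst.up_ch]
    cases n with
    | zero => cases hn; exact hP.var rfl
    | succ n => exact hP.extVar _ (h.vars n τ' hn)

theorem Subst.Wf.upLocal (hP : TypeKit P) {Γ Γ' : Ctx 𝓛} {σ : Subst 𝓛} (h : σ.Wf P Γ Γ')
    (ρ : LocSet L) (t : 𝓛.Ty) :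
    (σ.up .ex).Wf P (Γ.extLocal ρ t) (Γ'.extLocal (ρ.subst σ.tsubst.loc σ.tsubst.set)
      (𝓛.tsub σ.tsubst.loc σ.tsubst.set σ.tsubst.lty t)) := by
  refine ⟨?_, ?_, ?_, Subst.spawned_up h.spawned _⟩
  · rw [Subst.tsubst_up, TSubst.up_ex]
    exact h.types
  · intro n p hn
    rw [Subst.tsubst_up, TSubst.up_ex]
    cases n with
    | zero => cases hn; exact .inr ⟨0, rfl, rfl⟩
    | succ n => exact (h.locals n p hn).extLocal _ _
  · intro n τ' hn
    rw [Subst.tsubst_up, TSubst.up_ex]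
    exact hP.extLocal _ _ (h.vars n τ' hn)

theorem Ctx.proj_eq_some {Γ : Ctx 𝓛} {ρ : LocSet L} {n : ℕ} {t : 𝓛.Ty} :
    Γ.proj ρ n = some t ↔ ∃ ρ', Γ.locals[n]? = some (ρ', t) ∧ LocSet.Sub ρ ρ' := by
  unfold Ctx.proj
  cases h : Γ.locals[n]? with
  | none => simp
  | some p =>
    obtain ⟨ρ', t'⟩ := p
    by_cases hs : LocSet.Sub ρ ρ'
    · simp only [hs, if_true, Option.some.injEq, Prod.mk.injEq]
      exact ⟨fun h => ⟨ρ', ⟨rfl, h⟩, hs⟩, fun ⟨_, h, _⟩ => h.2⟩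
    · simp only [hs, if_false, Option.some.injEq, Prod.mk.injEq, reduceCtorEq, false_iff]
      rintro ⟨_, ⟨rfl, _⟩, h⟩
      exact hs h

theorem Subst.Wf.typed_esub {Γ Γ' : Ctx 𝓛} {σ : Subst 𝓛} (h : σ.Wf P Γ Γ') {ρ : LocSet L}
    {e : 𝓛.Expr} {t : 𝓛.Ty} (he : 𝓛.Typed Γ.kctx.toTyCtx (Γ.proj ρ) e t) :
    𝓛.Typed Γ'.kctx.toTyCtx (Γ'.proj (ρ.subst σ.tsubst.loc σ.tsubst.set))
      (𝓛.esub σ.tsubst.loc σ.tsubst.set σ.tsubst.lty σ.ex e)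
      (𝓛.tsub σ.tsubst.loc σ.tsubst.set σ.tsubst.lty t) := by
  refine 𝓛.typed_esub _ _ _ _ _ _ _ _ _ _ he h.types.1 fun n b hb => ?_
  obtain ⟨ρ', hn, hsub⟩ := Ctx.proj_eq_some.1 hb
  rcases h.locals n _ hn with h' | ⟨m, hm, h'⟩
  · exact 𝓛.typed_of_closed h' _
  · rw [hm]
    exact 𝓛.typed_var _ _ _ _ (Ctx.proj_eq_some.2 ⟨_, h', hsub.subst _ _⟩)

/-- Substitution preserves that the names of a location set are not spawned, provided that
no name in the images is. -/
theorem LocSet.disjoint_nl_subst {ρ : LocSet L} {S : Set L} (h : Disjoint ρ.nl S)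
    {σ : TSubst 𝓛} (hσ : Disjoint σ.names S) : Disjoint (ρ.subst σ.loc σ.set).nl S :=
  Disjoint.mono_left (LocSet.nl_subst_names σ ρ) (Set.disjoint_union_left.2 ⟨h, hσ⟩)

theorem LocE.disjoint_nl_subst {ℓ : LocE L} {S : Set L} (h : Disjoint ℓ.nl S)
    {σ : TSubst 𝓛} (hσ : Disjoint σ.names S) : Disjoint (ℓ.subst σ.loc).nl S :=
  Disjoint.mono_left (LocE.nl_subst_names σ ℓ) (Set.disjoint_union_left.2 ⟨h, hσ⟩)

theorem LocSet.disjoint_nl_of_comps {ρ ρ' : LocSet L} {S : Set L}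
    {σ : TSubst 𝓛} (hc : ρ'.comps ⊆ (ρ.subst σ.loc σ.set).comps) (h : Disjoint ρ.nl S)
    (hσ : Disjoint σ.names S) : Disjoint ρ'.nl S :=
  (LocSet.disjoint_nl_subst h hσ).mono_left (LocSet.nl_mono hc)

theorem TSubst.disjoint_names_up {σ : TSubst 𝓛} {S : Set L} (h : Disjoint σ.names S)
    (s : VSort) : Disjoint (σ.up s).names S :=
  h.mono_left (TSubst.names_up σ s)

/-- The substitution lemma.  A participant may disappear, since an expression can become a
value, so the participants are only bounded above.  The bound is in terms of components rather
than of `LocSet.Sub`, because the rules for functions ask for it in these terms.  The images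
must not name a spawned location, or else the side conditions that keep spawned locations
apart from the rest could fail. -/
theorem HasType.subst_of_kit (hP : TypeKit P) {Γ Γ' : Ctx 𝓛} {C : Chor L 𝓛.Ty 𝓛.Expr}
    {τ : CTy L 𝓛.Ty} {ρ : LocSet L} {σ : Subst 𝓛} (hC : HasType 𝓛 Γ C τ ρ) (h : σ.Wf P Γ Γ')
    (hn : Disjoint σ.tsubst.names C.spawned) :
    ∃ ρ', HasType 𝓛 Γ' (C.subst σ) (τ.subst σ.tsubst) ρ' ∧
      ρ'.comps ⊆ (ρ.subst σ.tsubst.loc σ.tsubst.set).comps := by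
  induction hC generalizing Γ' σ with
  | var hx =>
    obtain ⟨ρ, hV, hρ⟩ := hP.typed (h.vars _ _ hx)
    exact ⟨ρ, hV, by rw [hρ]; exact Set.empty_subset _⟩
  | doneVal ht hρ he hv =>
    exact ⟨_, .doneVal (𝓛.kinded_tsub _ _ _ _ _ _ ht h.types.1)
      (hρ.subst h.types.1.1 h.types.1.2.1) (h.typed_esub he) (𝓛.val_esub _ _ _ _ _ hv),
      Set.Subset.rfl⟩
  | @done Γ ρ e t ht hρ he hv =>
    have ht' := 𝓛.kinded_tsub _ _ _ _ _ _ ht h.types.1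
    have hρ' := hρ.subst h.types.1.1 h.types.1.2.1
    have he' := h.typed_esub he
    by_cases hv' : 𝓛.Val (𝓛.esub σ.tsubst.loc σ.tsubst.set σ.tsubst.lty σ.ex e)
    · exact ⟨_, .doneVal ht' hρ' he' hv', Set.empty_subset _⟩
    · exact ⟨_, .done ht' hρ' he' hv', Set.Subset.rfl⟩
  | @lam Γ C τ₁ τ₂ ρ ρ' ρb hk _ hb hs ih =>
    have hw := (h.upVar hP (.arr τ₁ ρ τ₂)).upVar hP τ₁
    obtain ⟨ρb', hC', hb'⟩ := ih hw (by rw [hs]; exact Set.disjoint_empty _)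
    simp only [Subst.tsubst_up, TSubst.up_ch] at hC' hb'
    exact ⟨_, .lam (hk.subst h.types) hC' (hb'.trans (LocSet.comps_subst_mono hb _ _))
      ((Chor.spawned_subst hw.spawned C).trans hs), Set.Subset.rfl⟩
  | @app Γ C₁ C₂ τ₁ τ₂ ρ ρ' ρ₁ ρ₂ _ _ hk d₁ d₂ d₃ d₄ ih₁ ih₂ =>
    obtain ⟨n₁, n₂⟩ := Set.disjoint_union_right.1 hn
    obtain ⟨ρ₁', hC₁, c₁⟩ := ih₁ h n₁
    obtain ⟨ρ₂', hC₂, c₂⟩ := ih₂ h n₂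
    refine ⟨_, .app hC₁ hC₂ (hk.subst h.types) ?_ ?_ ?_ ?_,
      Set.union_subset_union (Set.union_subset_union c₁ c₂) Set.Subset.rfl⟩ <;>
      rw [Chor.spawned_subst h.spawned]
    · exact LocSet.disjoint_nl_subst d₁ n₁
    · exact LocSet.disjoint_nl_subst d₂ n₂
    · exact LocSet.disjoint_nl_of_comps c₁ d₃ n₂
    · exact LocSet.disjoint_nl_of_comps c₂ d₄ n₁
  | @tlam Γ κ C τ ρ ρ' ρb hk _ hb hs ih =>
    have hw := (h.upVar hP (.all κ ρ τ)).upTy hP κ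
    obtain ⟨ρb', hC', hb'⟩ := ih hw (by rw [hs]; exact Set.disjoint_empty _)
    simp only [Subst.tsubst_up, TSubst.up_ch] at hC' hb'
    exact ⟨_, .tlam (hk.subst h.types) hC' (hb'.trans (LocSet.comps_subst_mono hb _ _))
      ((Chor.spawned_subst hw.spawned C).trans hs), Set.Subset.rfl⟩
  | @tapp Γ κ C τ a ρ ρ₁ ρ₂ ρ' _ ha hk e d ih =>
    obtain ⟨ρ₁', hC', c₁⟩ := ih h hn
    have hk' := hk.subst h.types
    have hd : Disjoint (ρ'.subst σ.tsubst.loc σ.tsubst.set).nl (C.subst σ).spawned := by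
      rw [Chor.spawned_subst h.spawned]
      exact LocSet.disjoint_nl_subst d hn
    rw [CTy.inst_subst, ha.sort_eq] at hk' ⊢
    refine ⟨_, .tapp hC' (ha.subst h.types) hk' ?_ hd,
      Set.union_subset_union c₁ Set.Subset.rfl⟩
    rw [e]
    simp only [LocSet.subst, LocSet.union.injEq, true_and]
    rw [LocSet.inst_subst, ha.sort_eq]
  | @pair Γ C₁ C₂ τ₁ τ₂ ρ ρ₁ ρ₂ _ _ hk d₃ d₄ ih₁ ih₂ =>
    obtain ⟨n₁, n₂⟩ := Set.disjoint_union_right.1 hn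
    obtain ⟨ρ₁', hC₁, c₁⟩ := ih₁ h n₁
    obtain ⟨ρ₂', hC₂, c₂⟩ := ih₂ h n₂
    refine ⟨_, .pair hC₁ hC₂ (hk.subst h.types) ?_ ?_, Set.union_subset_union c₁ c₂⟩ <;>
      rw [Chor.spawned_subst h.spawned]
    · exact LocSet.disjoint_nl_of_comps c₁ d₃ n₂
    · exact LocSet.disjoint_nl_of_comps c₂ d₄ n₁
  | fst _ hk d ih =>
    obtain ⟨ρ₁', hC', c⟩ := ih h hn
    refine ⟨_, .fst hC' (hk.subst h.types) ?_, Set.union_subset_union c Set.Subset.rfl⟩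
    rw [Chor.spawned_subst h.spawned]
    exact LocSet.disjoint_nl_subst d hn
  | snd _ hk d ih =>
    obtain ⟨ρ₁', hC', c⟩ := ih h hn
    refine ⟨_, .snd hC' (hk.subst h.types) ?_, Set.union_subset_union c Set.Subset.rfl⟩
    rw [Chor.spawned_subst h.spawned]
    exact LocSet.disjoint_nl_subst d hn
  | inl _ hk d ih =>
    obtain ⟨ρ₁', hC', c⟩ := ih h hn
    refine ⟨_, .inl hC' (hk.subst h.types) ?_, c⟩
    rw [Chor.spawned_subst h.spawned]
    exact LocSet.disjoint_nl_subst d hn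
  | inr _ hk d ih =>
    obtain ⟨ρ₁', hC', c⟩ := ih h hn
    refine ⟨_, .inr hC' (hk.subst h.types) ?_, c⟩
    rw [Chor.spawned_subst h.spawned]
    exact LocSet.disjoint_nl_subst d hn
  | @caseOf Γ C C₁ C₂ τ τ₁ τ₂ ρ ρ₀ ρ₁ ρ₂ _ _ _ hs d d₁ d₂ d₀₁ d₀₂ d₁₀ d₂₀ ih₀ ih₁ ih₂ =>
    obtain ⟨n', n₂⟩ := Set.disjoint_union_right.1 hn
    obtain ⟨n₀, n₁⟩ := Set.disjoint_union_right.1 n'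
    obtain ⟨ρ₀', hC₀, c₀⟩ := ih₀ h n₀
    have hw₁ := h.upVar hP τ₁
    have hw₂ := h.upVar hP τ₂
    obtain ⟨ρ₁', hC₁, c₁⟩ := ih₁ hw₁ (by rwa [Subst.tsubst_up, TSubst.up_ch])
    obtain ⟨ρ₂', hC₂, c₂⟩ := ih₂ hw₂ (by rwa [Subst.tsubst_up, TSubst.up_ch])
    have s₀ := Chor.spawned_subst h.spawned C
    have s₁ := Chor.spawned_subst hw₁.spawned C₁
    have s₂ := Chor.spawned_subst hw₂.spawned C₂
    simp only [Subst.tsubst_up, TSubst.up_ch] at hC₁ c₁ hC₂ c₂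
    refine ⟨_, .caseOf hC₀ hC₁ hC₂ ((s₁.trans hs).trans s₂.symm) ?_ ?_ ?_ ?_ ?_ ?_ ?_,
      Set.union_subset_union (Set.union_subset_union (Set.union_subset_union c₀ c₁) c₂)
        Set.Subset.rfl⟩ <;> simp only [s₀, s₁, s₂]
    · exact LocSet.disjoint_nl_subst d n₀
    · exact LocSet.disjoint_nl_subst d₁ n₁
    · exact LocSet.disjoint_nl_subst d₂ n₂
    · exact LocSet.disjoint_nl_of_comps c₀ d₀₁ n₁
    · exact LocSet.disjoint_nl_of_comps c₀ d₀₂ n₂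
    · exact LocSet.disjoint_nl_of_comps c₁ d₁₀ n₀
    · exact LocSet.disjoint_nl_of_comps c₂ d₂₀ n₀
  | @localCase Γ C C₁ C₂ τ t t₁ t₂ ρ ρ' ρ₀ ρ₁ ρ₂ _ hsum hsub _ _ hs d d₁ d₂ d₀₁ d₀₂ d₁₀ d₂₀
      ih₀ ih₁ ih₂ =>
    obtain ⟨n', n₂⟩ := Set.disjoint_union_right.1 hn
    obtain ⟨n₀, n₁⟩ := Set.disjoint_union_right.1 n'
    obtain ⟨ρ₀', hC₀, c₀⟩ := ih₀ h n₀
    have hw₁ := h.upLocal hP ρ t₁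
    have hw₂ := h.upLocal hP ρ t₂
    obtain ⟨ρ₁', hC₁, c₁⟩ := ih₁ hw₁ (by rwa [Subst.tsubst_up, TSubst.up_ex])
    obtain ⟨ρ₂', hC₂, c₂⟩ := ih₂ hw₂ (by rwa [Subst.tsubst_up, TSubst.up_ex])
    have s₀ := Chor.spawned_subst h.spawned C
    have s₁ := Chor.spawned_subst hw₁.spawned C₁
    have s₂ := Chor.spawned_subst hw₂.spawned C₂
    simp only [Subst.tsubst_up, TSubst.up_ex] at hC₁ c₁ hC₂ c₂
    refine ⟨_, .localCase hC₀ (𝓛.isSum_tsub _ _ _ _ _ _ hsum) (hsub.subst _ _) hC₁ hC₂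
      ((s₁.trans hs).trans s₂.symm) ?_ ?_ ?_ ?_ ?_ ?_ ?_,
      Set.union_subset_union (Set.union_subset_union (Set.union_subset_union c₀ c₁) c₂)
        Set.Subset.rfl⟩ <;> simp only [s₀, s₁, s₂]
    · exact LocSet.disjoint_nl_subst d n₀
    · exact LocSet.disjoint_nl_subst d₁ n₁
    · exact LocSet.disjoint_nl_subst d₂ n₂
    · exact LocSet.disjoint_nl_of_comps c₀ d₀₁ n₁
    · exact LocSet.disjoint_nl_of_comps c₀ d₀₂ n₂
    · exact LocSet.disjoint_nl_of_comps c₁ d₁₀ n₀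
    · exact LocSet.disjoint_nl_of_comps c₂ d₂₀ n₀
  | fold _ hk d ih =>
    obtain ⟨ρ₁', hC', c⟩ := ih h hn
    rw [CTy.inst_subst] at hC'
    refine ⟨_, .fold hC' (hk.subst h.types) ?_, c⟩
    rw [Chor.spawned_subst h.spawned]
    exact LocSet.disjoint_nl_subst d hn
  | unfold _ d ih =>
    obtain ⟨ρ₁', hC', c⟩ := ih h hn
    rw [CTy.inst_subst]
    refine ⟨_, .unfold hC' ?_, Set.union_subset_union c Set.Subset.rfl⟩
    rw [Chor.spawned_subst h.spawned]
    exact LocSet.disjoint_nl_subst d hn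
  | @letLocal Γ C₁ C₂ τ t ρ ρ' ρ₁ ρ₂ _ hsub _ d₁ d₂ d₁₂ d₂₁ ih₁ ih₂ =>
    obtain ⟨n₁, n₂⟩ := Set.disjoint_union_right.1 hn
    obtain ⟨ρ₁', hC₁, c₁⟩ := ih₁ h n₁
    have hw₂ := h.upLocal hP ρ t
    obtain ⟨ρ₂', hC₂, c₂⟩ := ih₂ hw₂ (by rwa [Subst.tsubst_up, TSubst.up_ex])
    have s₁ := Chor.spawned_subst h.spawned C₁
    have s₂ := Chor.spawned_subst hw₂.spawned C₂
    simp only [Subst.tsubst_up, TSubst.up_ex] at hC₂ c₂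
    refine ⟨_, .letLocal hC₁ (hsub.subst _ _) hC₂ ?_ ?_ ?_ ?_,
      Set.union_subset_union (Set.union_subset_union c₁ c₂) Set.Subset.rfl⟩ <;>
      simp only [s₁, s₂]
    · exact LocSet.disjoint_nl_subst d₁ n₁
    · exact LocSet.disjoint_nl_subst d₂ n₂
    · exact LocSet.disjoint_nl_of_comps c₁ d₁₂ n₂
    · exact LocSet.disjoint_nl_of_comps c₂ d₂₁ n₁
  | @letLoc Γ C₁ C₂ τ ρ ρt ρ' ρτ ρ₁ ρ₂ _ hsub hsub' hρ hτ _ d₁ d₂ d₁₂ d₂₁ ih₁ ih₂ =>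
    obtain ⟨n₁, n₂⟩ := Set.disjoint_union_right.1 hn
    obtain ⟨ρ₁', hC₁, c₁⟩ := ih₁ h n₁
    have hw₂ := h.upTy hP .loc
    obtain ⟨ρ₂', hC₂, c₂⟩ := ih₂ hw₂ (by
      rw [Subst.tsubst_up]; exact TSubst.disjoint_names_up n₂ _)
    have s₁ := Chor.spawned_subst h.spawned C₁
    have s₂ := Chor.spawned_subst hw₂.spawned C₂
    simp only [Kind.sort, Subst.tsubst_up, CTy.ren_shift_subst_up] at hC₂ c₂ s₂
    simp only [CTy.subst, 𝓛.tsub_locTy] at hC₁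
    refine ⟨_, .letLoc hC₁ (hsub.subst _ _) (hsub'.subst _ _)
      (hρ.subst h.types.1.1 h.types.1.2.1) (hτ.subst h.types) hC₂ ?_ ?_ ?_ ?_, ?_⟩
    rotate_right
    · refine Set.union_subset_union (Set.union_subset_union c₁ ?_) Set.Subset.rfl
      rw [← LocSet.dropLoc_subst_up]
      exact LocSet.comps_dropLoc_mono c₂
    all_goals simp only [s₁, s₂]
    · exact LocSet.disjoint_nl_subst d₁ n₁
    · exact LocSet.disjoint_nl_subst d₂ n₂
    · exact LocSet.disjoint_nl_of_comps c₁ d₁₂ n₂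
    · exact LocSet.disjoint_nl_of_comps c₂ d₂₁ (TSubst.disjoint_names_up n₁ .loc)
  | @letSet Γ k C₁ C₂ τ ρ ρt ρ' ρτ ρ₁ ρ₂ _ hsub hsub' hρ hτ _ d₁ d₂ d₁₂ d₂₁ ih₁ ih₂ =>
    obtain ⟨n₁, n₂⟩ := Set.disjoint_union_right.1 hn
    obtain ⟨ρ₁', hC₁, c₁⟩ := ih₁ h n₁
    have hw₂ := h.upTy hP (.set k)
    obtain ⟨ρ₂', hC₂, c₂⟩ := ih₂ hw₂ (by
      rw [Subst.tsubst_up]; exact TSubst.disjoint_names_up n₂ _)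
    have s₁ := Chor.spawned_subst h.spawned C₁
    have s₂ := Chor.spawned_subst hw₂.spawned C₂
    simp only [Kind.sort, Subst.tsubst_up, CTy.ren_shift_subst_up] at hC₂ c₂ s₂
    simp only [CTy.subst, 𝓛.tsub_locsetTy] at hC₁
    refine ⟨_, .letSet hC₁ (hsub.subst _ _) (hsub'.subst _ _)
      (hρ.subst h.types.1.1 h.types.1.2.1) (hτ.subst h.types) hC₂ ?_ ?_ ?_ ?_, ?_⟩
    rotate_right
    · refine Set.union_subset_union (Set.union_subset_union c₁ ?_) Set.Subset.rfl
      rw [← LocSet.dropSet_subst_up]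
      exact LocSet.comps_dropSet_mono c₂
    all_goals simp only [s₁, s₂]
    · exact LocSet.disjoint_nl_subst d₁ n₁
    · exact LocSet.disjoint_nl_subst d₂ n₂
    · exact LocSet.disjoint_nl_of_comps c₁ d₁₂ n₂
    · exact LocSet.disjoint_nl_of_comps c₂ d₂₁ (TSubst.disjoint_names_up n₁ .set)
  | send _ hm hρ d₁ d₂ ih =>
    obtain ⟨ρ₁', hC', c⟩ := ih h hn
    refine ⟨_, .send hC' (hm.subst _ _) (hρ.subst h.types.1.1 h.types.1.2.1) ?_ ?_,
      Set.union_subset_union (Set.union_subset_union c Set.Subset.rfl) Set.Subset.rfl⟩ <;>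
      rw [Chor.spawned_subst h.spawned]
    · exact LocE.disjoint_nl_subst d₁ hn
    · exact LocSet.disjoint_nl_subst d₂ hn
  | sync _ hℓ hρ d₁ d₂ ih =>
    obtain ⟨ρ₁', hC', c⟩ := ih h hn
    refine ⟨_, .sync hC' (hℓ.subst h.types.1.1) (hρ.subst h.types.1.1 h.types.1.2.1) ?_ ?_,
      Set.union_subset_union Set.Subset.rfl c⟩ <;>
      rw [Chor.spawned_subst h.spawned]
    · exact LocE.disjoint_nl_subst d₁ hn
    · exact LocSet.disjoint_nl_subst d₂ hn
  | @fork Γ C τ ℓ ρ ρτ hℓ hτ _ d ih =>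
    have hw := (h.upTy hP .loc).upLocal hP
      (.union (.sng (.var 0)) (.sng (ℓ.ren (Ren.shift .loc)))) (𝓛.locTy (.sng (.var 0)))
    obtain ⟨ρ', hC', c⟩ := ih hw (by
      rw [Subst.tsubst_up, TSubst.up_ex, Subst.tsubst_up]
      exact TSubst.disjoint_names_up hn .loc)
    have s := Chor.spawned_subst hw.spawned C
    have e := LocE.ren_shift_subst_up σ.tsubst .loc ℓ
    simp only [Kind.sort, Kind.subst, Subst.tsubst_up, TSubst.up_ex, CTy.ren_shift_subst_up,
      𝓛.tsub_locTy, LocSet.subst, e] at hC' c s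
    refine ⟨_, .fork (hℓ.subst h.types.1.1) (hτ.subst h.types) hC' ?_, ?_⟩
    · rw [s]
      exact LocE.disjoint_nl_subst d hn
    · refine Set.union_subset_union Set.Subset.rfl ?_
      rw [← LocSet.dropLoc_subst_up]
      exact LocSet.comps_dropLoc_mono c
  | @killAfter Γ C τ A ρ _ hτ hA ih =>
    obtain ⟨nA, n'⟩ := Set.disjoint_union_right.1 hn
    obtain ⟨ρ', hC', c⟩ := ih h n'
    refine ⟨_, .killAfter hC' ?_ ?_, Set.union_subset_union c Set.Subset.rfl⟩
    · intro hA'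
      rcases CTy.nl_subst_names _ _ hA' with h' | h'
      · exact hτ h'
      · exact Set.disjoint_left.1 nA h' rfl
    · rwa [Chor.spawned_subst h.spawned]

/-! ### Weakening, and substitution of values -/

/-- Images that are variables: this makes well-formed substitutions renamings. -/
theorem TypeKit.vars :
    TypeKit (𝓛 := 𝓛) (fun Γ V τ => ∃ n, V = .var n ∧ Γ.vars[n]? = some τ) where
  typed := by rintro Γ _ τ ⟨n, rfl, h⟩; exact ⟨_, .var h, rfl⟩
  extTy := by
    rintro Γ _ τ κ ⟨n, rfl, h⟩
    refine ⟨n, ?_, ?_⟩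
    · cases κ <;> rfl
    · simp [Ctx.extTy, h]
  extVar := by rintro Γ _ τ τ' ⟨n, rfl, h⟩; exact ⟨n + 1, rfl, h⟩
  extLocal := by rintro Γ _ τ ρ t ⟨n, rfl, h⟩; exact ⟨n, rfl, h⟩
  var := fun h => ⟨_, rfl, h⟩

/-- `V` has type `τ` without participants and without spawned locations.  This is what is
required of the images of program variables in a substitution; values satisfy it. -/
def TypedIdle (Γ : Ctx 𝓛) (V : Chor L 𝓛.Ty 𝓛.Expr) (τ : CTy L 𝓛.Ty) : Prop :=
  ∃ ρ, HasType 𝓛 Γ V τ ρ ∧ ρ.comps = ∅ ∧ V.spawned = ∅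

theorem TypedIdle.ren {Γ Γ' : Ctx 𝓛} {V : Chor L 𝓛.Ty 𝓛.Expr} {τ : CTy L 𝓛.Ty} {ξ : Ren}
    (h : TypedIdle Γ V τ) (hξ : (ξ.toS 𝓛).Wf
      (fun Γ V τ => ∃ n, V = .var n ∧ Γ.vars[n]? = some τ) Γ Γ') :
    TypedIdle Γ' (V.ren 𝓛 ξ) (τ.ren 𝓛 ξ) := by
  obtain ⟨ρ, hV, hρ, hs⟩ := h
  obtain ⟨ρ', hV', hρ'⟩ := hV.subst_of_kit TypeKit.vars hξ (by
    rw [show (ξ.toS 𝓛).tsubst = ξ.toT 𝓛 from rfl, Ren.names_toT]; exact Set.empty_disjoint _)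
  refine ⟨ρ', ?_, ?_, ?_⟩
  · rw [Chor.ren_eq_subst, CTy.ren_eq_subst]; exact hV'
  · refine Set.subset_empty_iff.1 (hρ'.trans ?_)
    exact (LocSet.comps_subst_mono (ρ' := .empty) hρ.subset _ _)
  · rw [Chor.spawned_ren, hs]

/-- By the substitution lemma for renamings, the images of program variables can be weakened. -/
theorem TypeKit.idle : TypeKit (𝓛 := 𝓛) TypedIdle where
  typed := fun ⟨ρ, h, hρ, _⟩ => ⟨ρ, h, hρ⟩
  extTy := by
    intro Γ V τ κ h
    refine h.ren ⟨TSubst.Wf.shift KindKit.kindedTypes Γ.kctx κ, fun n p hn => ?_,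
      fun n τ hn => ?_, fun n => rfl⟩
    · refine .inr ⟨n, ?_, ?_⟩
      · cases κ <;> rfl
      · simp only [Ctx.extTy, List.getElem?_map, hn]; rfl
    · refine ⟨n, ?_, ?_⟩
      · cases κ <;> rfl
      · simp only [Ctx.extTy, List.getElem?_map, hn, Option.map_some, CTy.ren_eq_subst]; rfl
  extVar := by
    intro Γ V τ τ' h
    have := h.ren (ξ := Ren.shift .ch) (Γ' := Γ.extVar τ') ⟨TSubst.Wf.id Γ.kctx,
      fun n p hn => .inr ⟨n, rfl, ?_⟩, fun n τ hn => ⟨n + 1, rfl, ?_⟩, fun n => rfl⟩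
    · rwa [CTy.ren_shift_ch] at this
    · exact hn.trans (congrArg some (Prod.ext (LocSet.subst_var _).symm (𝓛.tsub_id _).symm))
    · exact hn.trans (congrArg some (CTy.subst_id τ).symm)
  extLocal := by
    intro Γ V τ ρ t h
    have := h.ren (ξ := Ren.shift .ex) (Γ' := Γ.extLocal ρ t) ⟨TSubst.Wf.id Γ.kctx,
      fun n p hn => .inr ⟨n + 1, rfl, ?_⟩, fun n τ hn => ⟨n, rfl, ?_⟩, fun n => rfl⟩
    · rwa [CTy.ren_shift_ex] at this
    · exact hn.trans (congrArg some (Prod.ext (LocSet.subst_var _).symm (𝓛.tsub_id _).symm))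
    · exact hn.trans (congrArg some (CTy.subst_id τ).symm)
  var := fun h => ⟨_, .var h, rfl, rfl⟩

theorem HasType.subst {Γ Γ' : Ctx 𝓛} {C : Chor L 𝓛.Ty 𝓛.Expr} {τ : CTy L 𝓛.Ty} {ρ : LocSet L}
    {σ : Subst 𝓛} (hC : HasType 𝓛 Γ C τ ρ) (h : σ.Wf TypedIdle Γ Γ')
    (hn : Disjoint σ.tsubst.names C.spawned) :
    ∃ ρ', HasType 𝓛 Γ' (C.subst σ) (τ.subst σ.tsubst) ρ' ∧
      ρ'.comps ⊆ (ρ.subst σ.tsubst.loc σ.tsubst.set).comps :=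
  hC.subst_of_kit TypeKit.idle h hn

theorem Subst.Wf.id (Γ : Ctx 𝓛) : (Subst.id 𝓛).Wf TypedIdle Γ Γ := by
  refine ⟨TSubst.Wf.id Γ.kctx, fun n p hn => .inr ⟨n, rfl, ?_⟩, fun n τ hn => ?_, fun n => rfl⟩
  · exact hn.trans (congrArg some (Prod.ext (LocSet.subst_var _).symm (𝓛.tsub_id _).symm))
  · exact TypeKit.idle.var (hn.trans (congrArg some (CTy.subst_id τ).symm))

theorem Subst.Wf.consCh {Γ Γ' : Ctx 𝓛} {σ : Subst 𝓛} (h : σ.Wf TypedIdle Γ Γ')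
    {V : Chor L 𝓛.Ty 𝓛.Expr} {τ : CTy L 𝓛.Ty} (hV : TypedIdle Γ' V (τ.subst σ.tsubst)) :
    (σ.consCh V).Wf TypedIdle (Γ.extVar τ) Γ' := by
  refine ⟨h.types, h.locals, ?_, ?_⟩
  · rintro (_ | n) τ' hn
    · cases hn; exact hV
    · exact h.vars n τ' hn
  · rintro (_ | n)
    · exact hV.choose_spec.2.2
    · exact h.spawned n

theorem Subst.Wf.consEx {Γ Γ' : Ctx 𝓛} {σ : Subst 𝓛} (h : σ.Wf TypedIdle Γ Γ') {e : 𝓛.Expr}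
    {ρ : LocSet L} {t : 𝓛.Ty} (he : 𝓛.Typed Γ'.kctx.toTyCtx (fun _ => none) e
      (𝓛.tsub σ.tsubst.loc σ.tsubst.set σ.tsubst.lty t)) :
    (σ.consEx e).Wf TypedIdle (Γ.extLocal ρ t) Γ' := by
  refine ⟨h.types, ?_, h.vars, h.spawned⟩
  rintro (_ | n) p hn
  · cases hn; exact .inl he
  · exact h.locals n p hn

/-- Instantiation of the innermost type variable. -/
theorem Subst.Wf.consTy {Γ Γ' : Ctx 𝓛} {σ : Subst 𝓛} (h : σ.Wf TypedIdle Γ Γ')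
    (hσ : σ.tsubst = TSubst.id 𝓛) (hΓ : Γ.kctx = Γ'.kctx) {a : TArg L 𝓛.Ty} {κ : Kind L}
    (ha : TArg.Kinded 𝓛 Γ'.kctx a κ) : (σ.consTy a).Wf TypedIdle (Γ.extTy κ) Γ' := by
  have he : (σ.consTy a).tsubst = TSubst.inst a := by rw [Subst.consTy, hσ]; rfl
  have hs := ha.sort_eq
  refine ⟨?_, ?_, ?_, h.spawned⟩
  · rw [he]
    change (TSubst.inst a).Wf _ (Γ.kctx.ext κ) Γ'.kctx
    rw [hΓ]
    exact TSubst.Wf.inst ha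
  · intro n p hn
    simp only [Ctx.extTy, List.getElem?_map, Option.map_eq_some_iff] at hn
    obtain ⟨p, hn, rfl⟩ := hn
    have h' := h.locals n p hn
    rw [hσ] at h'
    rw [he, ← hs]
    have e₁ : (p.1.ren (Ren.shift a.sort)).subst (TSubst.inst a).loc (TSubst.inst a).set =
        p.1.subst (TSubst.id 𝓛).loc (TSubst.id 𝓛).set := by
      simp only [LocSet.ren, LocSet.subst_subst]
      cases a <;> rfl
    have e₂ : 𝓛.tsub (TSubst.inst a).loc (TSubst.inst a).set (TSubst.inst a).lty
        (𝓛.tren (Ren.shift a.sort) p.2) =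
        𝓛.tsub (TSubst.id 𝓛).loc (TSubst.id 𝓛).set (TSubst.id 𝓛).lty p.2 := by
      simp only [LocalLang.tren, 𝓛.tsub_tsub, 𝓛.tsub_var]
      cases a <;> rfl
    simp only [e₁, e₂]
    exact h'
  · intro n τ hn
    simp only [Ctx.extTy, List.getElem?_map, Option.map_eq_some_iff] at hn
    obtain ⟨τ, hn, rfl⟩ := hn
    have h' := h.vars n τ hn
    rw [hσ, CTy.subst_id] at h'
    rw [he, ← hs, CTy.ren_shift_inst]
    exact h'

/-- Values have no participants and no spawned locations. -/
theorem HasType.idle_of_isVal {Γ : Ctx 𝓛} {V : Chor L 𝓛.Ty 𝓛.Expr} {τ : CTy L 𝓛.Ty}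
    {ρ : LocSet L} (h : HasType 𝓛 Γ V τ ρ) (hV : V.IsVal 𝓛) :
    ρ.comps = ∅ ∧ V.spawned = ∅ := by
  induction hV generalizing τ ρ with
  | done hv =>
    cases h with
    | doneVal => exact ⟨rfl, rfl⟩
    | done _ _ _ hv' => exact absurd hv hv'
  | lam => cases h with | lam _ _ _ hs => exact ⟨rfl, hs⟩
  | tlam => cases h with | tlam _ _ _ hs => exact ⟨rfl, hs⟩
  | pair _ _ ih₁ ih₂ =>
    cases h with
    | pair h₁ h₂ =>
      simp [LocSet.comps, Chor.spawned, ih₁ h₁, ih₂ h₂]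
  | inl _ ih => cases h with | inl h => exact ih h
  | inr _ ih => cases h with | inr h => exact ih h
  | fold _ ih => cases h with | fold h => exact ih h

theorem HasType.typedIdle {Γ : Ctx 𝓛} {V : Chor L 𝓛.Ty 𝓛.Expr} {τ : CTy L 𝓛.Ty}
    {ρ : LocSet L} (h : HasType 𝓛 Γ V τ ρ) (hV : V.IsVal 𝓛) : TypedIdle Γ V τ :=
  ⟨ρ, h, h.idle_of_isVal hV⟩

end TypingSubst
/-! ### Changing names in types -/

section NameMaps

variable {L : Type u}

/-- Apply a map of names to a location. -/
def LocE.mapNames (f : L → L) : LocE L → LocE L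
  | .var n => .var n
  | .const A => .const (f A)

/-- Apply a map of names to a location set. -/
def LocSet.mapNames (f : L → L) : LocSet L → LocSet L
  | .empty => .empty
  | .var n => .var n
  | .sng ℓ => .sng (ℓ.mapNames f)
  | .union ρ₁ ρ₂ => .union (LocSet.mapNames f ρ₁) (LocSet.mapNames f ρ₂)
  | .top => .top

/-- Apply a map of names to a kind. -/
def Kind.mapNames (f : L → L) : Kind L → Kind L
  | .prog ρ => .prog (ρ.mapNames f)
  | κ => κ

/-- Apply a map of names to the location sets of a choreographic type.  Local types, which are
opaque, are left alone. -/
def CTy.mapNames {T : Type v} (f : L → L) : CTy L T → CTy L T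
  | .var n => .var n
  | .located t ρ => .located t (ρ.mapNames f)
  | .arr τ₁ ρ τ₂ => .arr (CTy.mapNames f τ₁) (ρ.mapNames f) (CTy.mapNames f τ₂)
  | .sum ρ τ₁ τ₂ => .sum (ρ.mapNames f) (CTy.mapNames f τ₁) (CTy.mapNames f τ₂)
  | .prod τ₁ τ₂ => .prod (CTy.mapNames f τ₁) (CTy.mapNames f τ₂)
  | .mu ρ τ => .mu (ρ.mapNames f) (CTy.mapNames f τ)
  | .all κ ρ τ => .all (κ.mapNames f) (ρ.mapNames f) (CTy.mapNames f τ)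

/-- Apply a map of names to a type argument. -/
def TArg.mapNames {T : Type v} (f : L → L) : TArg L T → TArg L T
  | .loc ℓ => .loc (ℓ.mapNames f)
  | .set ρ => .set (ρ.mapNames f)
  | .lty t => .lty t
  | .prog τ => .prog (τ.mapNames f)

/-- Apply a map of names to a kinding context. -/
def KCtx.mapNames (f : L → L) (Γ : KCtx L) : KCtx L :=
  { Γ with progs := Γ.progs.map (LocSet.mapNames f) }

variable {𝓛 : LocalLang.{u, v, w} L}

/-- Apply a map of names to a typing context. -/
def Ctx.mapNames (f : L → L) (Γ : Ctx 𝓛) : Ctx 𝓛 where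
  kctx := Γ.kctx.mapNames f
  locals := Γ.locals.map fun p => (p.1.mapNames f, p.2)
  vars := Γ.vars.map (CTy.mapNames f)

/-- Apply a map of names to the images of the program-type variables. -/
def TSubst.mapNames (f : L → L) (σ : TSubst 𝓛) : TSubst 𝓛 :=
  { σ with ty := fun n => (σ.ty n).mapNames f }

variable {f : L → L}

theorem LocE.mapNames_eq {ℓ : LocE L} (h : ∀ A ∈ ℓ.nl, f A = A) : ℓ.mapNames f = ℓ := by
  cases ℓ with
  | var n => rfl
  | const A => exact congrArg LocE.const (h A rfl)

theorem LocSet.mapNames_eq {ρ : LocSet L} (h : ∀ A ∈ ρ.nl, f A = A) : ρ.mapNames f = ρ := by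
  induction ρ with
  | sng ℓ => exact congrArg LocSet.sng (LocE.mapNames_eq h)
  | union _ _ h₁ h₂ =>
    exact congrArg₂ LocSet.union (h₁ fun A hA => h A (.inl hA)) (h₂ fun A hA => h A (.inr hA))
  | _ => rfl

theorem Kind.mapNames_eq {κ : Kind L} (h : ∀ A ∈ κ.names, f A = A) : κ.mapNames f = κ := by
  cases κ with
  | prog ρ => exact congrArg Kind.prog (LocSet.mapNames_eq h)
  | _ => rfl

theorem CTy.mapNames_eq {T : Type v} {τ : CTy L T} (h : ∀ A ∈ τ.names, f A = A) :
    τ.mapNames f = τ := by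
  induction τ with
  | var n => rfl
  | located t ρ => exact congrArg _ (LocSet.mapNames_eq h)
  | arr _ ρ _ h₁ h₂ =>
    simp only [CTy.mapNames, h₁ fun A hA => h A (.inl (.inl hA)),
      h₂ fun A hA => h A (.inl (.inr hA)), LocSet.mapNames_eq fun A hA => h A (.inr hA)]
  | sum ρ _ _ h₁ h₂ =>
    simp only [CTy.mapNames, h₁ fun A hA => h A (.inl (.inl hA)),
      h₂ fun A hA => h A (.inl (.inr hA)), LocSet.mapNames_eq fun A hA => h A (.inr hA)]
  | prod _ _ h₁ h₂ =>
    simp only [CTy.mapNames, h₁ fun A hA => h A (.inl hA), h₂ fun A hA => h A (.inr hA)]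
  | mu ρ _ h₁ =>
    simp only [CTy.mapNames, LocSet.mapNames_eq fun A hA => h A (.inl hA),
      h₁ fun A hA => h A (.inr hA)]
  | all κ ρ _ h₁ =>
    simp only [CTy.mapNames, Kind.mapNames_eq fun A hA => h A (.inl (.inl hA)),
      LocSet.mapNames_eq fun A hA => h A (.inl (.inr hA)), h₁ fun A hA => h A (.inr hA)]

theorem TArg.mapNames_eq {T : Type v} {a : TArg L T} (h : ∀ A ∈ a.names, f A = A) :
    a.mapNames f = a := by
  cases a with
  | loc ℓ => exact congrArg TArg.loc (LocE.mapNames_eq h)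
  | set ρ => exact congrArg TArg.set (LocSet.mapNames_eq h)
  | lty t => rfl
  | prog τ => exact congrArg TArg.prog (CTy.mapNames_eq h)

theorem Ctx.mapNames_eq {Γ : Ctx 𝓛} (h : ∀ A ∈ Γ.names, f A = A) : Γ.mapNames f = Γ := by
  obtain ⟨⟨Γt, progs⟩, locals, vars⟩ := Γ
  simp only [Ctx.mapNames, KCtx.mapNames, Ctx.mk.injEq, KCtx.mk.injEq, true_and]
  refine ⟨?_, ?_, ?_⟩ <;> refine (List.map_congr_left ?_).trans (List.map_id _)
  · exact fun ρ hρ => LocSet.mapNames_eq fun A hA => h A (.inl ⟨ρ, hρ, hA⟩)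
  · exact fun p hp => Prod.ext
      (LocSet.mapNames_eq fun A hA => h A (.inr (.inl ⟨p, hp, hA⟩))) rfl
  · exact fun τ hτ => CTy.mapNames_eq fun A hA => h A (.inr (.inr ⟨τ, hτ, hA⟩))

@[simp] theorem Kind.sort_mapNames (κ : Kind L) : (κ.mapNames f).sort = κ.sort := by
  cases κ <;> rfl

theorem Kind.isLoc_mapNames_iff (κ : Kind L) : (κ.mapNames f).IsLoc ↔ κ.IsLoc := by
  cases κ <;> rfl

theorem LocE.mapNames_subst {l : ℕ → LocE L} (hl : ∀ n, (l n).mapNames f = l n) (ℓ : LocE L) :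
    (ℓ.subst l).mapNames f = (ℓ.mapNames f).subst l := by
  cases ℓ with
  | var n => exact hl n
  | const A => rfl

theorem LocSet.mapNames_subst {l : ℕ → LocE L} {s : ℕ → LocSet L}
    (hl : ∀ n, (l n).mapNames f = l n) (hs : ∀ n, (s n).mapNames f = s n) (ρ : LocSet L) :
    (ρ.subst l s).mapNames f = (ρ.mapNames f).subst l s := by
  induction ρ with
  | var n => exact hs n
  | sng ℓ => exact congrArg LocSet.sng (LocE.mapNames_subst hl ℓ)
  | union _ _ h₁ h₂ => exact congrArg₂ LocSet.union h₁ h₂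
  | _ => rfl

theorem LocE.mapNames_ren (ξ : Ren) (ℓ : LocE L) :
    (ℓ.ren ξ).mapNames f = (ℓ.mapNames f).ren ξ :=
  LocE.mapNames_subst (fun _ => rfl) ℓ

theorem LocSet.mapNames_ren (ξ : Ren) (ρ : LocSet L) :
    (ρ.ren ξ).mapNames f = (ρ.mapNames f).ren ξ :=
  LocSet.mapNames_subst (fun _ => rfl) (fun _ => rfl) ρ

theorem Kind.mapNames_subst {l : ℕ → LocE L} {s : ℕ → LocSet L}
    (hl : ∀ n, (l n).mapNames f = l n) (hs : ∀ n, (s n).mapNames f = s n) (κ : Kind L) :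
    (κ.subst l s).mapNames f = (κ.mapNames f).subst l s := by
  cases κ with
  | prog ρ => exact congrArg Kind.prog (LocSet.mapNames_subst hl hs ρ)
  | _ => rfl

theorem CTy.mapNames_ren (ξ : Ren) (τ : CTy L 𝓛.Ty) :
    (τ.ren 𝓛 ξ).mapNames f = (τ.mapNames f).ren 𝓛 ξ := by
  induction τ generalizing ξ with
  | all κ ρ _ h =>
    simp only [CTy.ren, CTy.mapNames, h, LocSet.mapNames_ren, Kind.sort_mapNames]
    cases κ with
    | prog ρ => simp only [Kind.ren, Kind.mapNames, LocSet.mapNames_ren]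
    | _ => rfl
  | _ => simp_all [CTy.ren, CTy.mapNames, LocSet.mapNames_ren]

/-- The names in the location and location-set images of `σ` are fixed by `f`. -/
def TSubst.FixedBy (f : L → L) (σ : TSubst 𝓛) : Prop :=
  (∀ n, (σ.loc n).mapNames f = σ.loc n) ∧ ∀ n, (σ.set n).mapNames f = σ.set n

theorem TSubst.FixedBy.up {σ : TSubst 𝓛} (h : σ.FixedBy f) (s : VSort) :
    (σ.up s).FixedBy f := by
  have hl : ∀ n, ((σ.loc n).ren (Ren.shift s)).mapNames f = (σ.loc n).ren (Ren.shift s) :=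
    fun n => by rw [LocE.mapNames_ren, h.1]
  have hs : ∀ n, ((σ.set n).ren (Ren.shift s)).mapNames f = (σ.set n).ren (Ren.shift s) :=
    fun n => by rw [LocSet.mapNames_ren, h.2]
  constructor
  · cases s <;> first | exact hl | (rintro (_ | n) <;> [rfl; exact hl n])
  · cases s <;> first | exact hs | (rintro (_ | n) <;> [rfl; exact hs n])

theorem TSubst.mapNames_up (σ : TSubst 𝓛) (s : VSort) :
    (σ.mapNames f).up s = (σ.up s).mapNames f := by
  have ht : ∀ n, ((σ.ty n).mapNames f).ren 𝓛 (Ren.shift s) =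
      ((σ.ty n).ren 𝓛 (Ren.shift s)).mapNames f := fun n => (CTy.mapNames_ren _ _).symm
  cases s <;> refine TSubst.ext' ?_ ?_ ?_ ?_ <;> intro n <;>
    first | rfl | exact ht n | (cases n <;> first | rfl | exact ht _)

theorem CTy.mapNames_subst {σ : TSubst 𝓛} (h : σ.FixedBy f) (τ : CTy L 𝓛.Ty) :
    (τ.subst σ).mapNames f = (τ.mapNames f).subst (σ.mapNames f) := by
  have e : ∀ (ρ : LocSet L) (σ : TSubst 𝓛), σ.FixedBy f →
      (ρ.subst σ.loc σ.set).mapNames f =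
        (ρ.mapNames f).subst (σ.mapNames f).loc (σ.mapNames f).set :=
    fun ρ σ h => LocSet.mapNames_subst h.1 h.2 ρ
  induction τ generalizing σ with
  | var n => rfl
  | located t ρ => exact congrArg _ (e ρ σ h)
  | arr _ ρ _ h₁ h₂ => simp only [CTy.subst, CTy.mapNames, h₁ h, h₂ h, e ρ σ h]
  | sum ρ _ _ h₁ h₂ => simp only [CTy.subst, CTy.mapNames, h₁ h, h₂ h, e ρ σ h]
  | prod _ _ h₁ h₂ => simp only [CTy.subst, CTy.mapNames, h₁ h, h₂ h]
  | mu ρ _ ih =>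
    simp only [CTy.subst, CTy.mapNames, ih (h.up _), e ρ σ h, TSubst.mapNames_up]
  | all κ ρ _ ih =>
    have eκ : (κ.subst σ.loc σ.set).mapNames f =
        (κ.mapNames f).subst (σ.mapNames f).loc (σ.mapNames f).set :=
      Kind.mapNames_subst h.1 h.2 κ
    simp only [CTy.subst, CTy.mapNames, ih (h.up _), e ρ _ (h.up _), eκ, TSubst.mapNames_up,
      Kind.sort_mapNames]

/-- Changing names commutes with instantiation by `a`.  If `a` is a location or a location set,
its names have to be fixed, as it may be substituted in local types, which are not changed.  A
program type does not occur in local types, and is changed along. -/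
theorem CTy.mapNames_inst {a : TArg L 𝓛.Ty} (τ : CTy L 𝓛.Ty)
    (ha : (TSubst.inst a).FixedBy f) :
    (τ.subst (TSubst.inst a)).mapNames f =
      (τ.mapNames f).subst (TSubst.inst (a.mapNames f)) := by
  rw [CTy.mapNames_subst ha]
  congr 1
  have hl := ha.1 0
  have hs := ha.2 0
  cases a <;> refine TSubst.ext' ?_ ?_ ?_ ?_ <;> intro n <;>
    first
    | rfl
    | (cases n <;> first | rfl | exact hl.symm | exact hs.symm)

theorem TSubst.FixedBy.inst {a : TArg L 𝓛.Ty} (h : ∀ A ∈ a.names, f A = A) :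
    (TSubst.inst a).FixedBy f := by
  cases a with
  | loc ℓ =>
    refine ⟨?_, fun n => rfl⟩
    rintro (_ | n)
    · exact LocE.mapNames_eq h
    · rfl
  | set ρ =>
    refine ⟨fun n => rfl, ?_⟩
    rintro (_ | n)
    · exact LocSet.mapNames_eq h
    · rfl
  | lty t => exact ⟨fun n => rfl, fun n => rfl⟩
  | prog τ => exact ⟨fun n => rfl, fun n => rfl⟩

theorem LocE.mapNames_kinded {Γ : TyCtx} {ℓ : LocE L} (h : ℓ.Kinded Γ) :
    (ℓ.mapNames f).Kinded Γ := by
  cases ℓ <;> exact h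

theorem LocSet.Kinded.mapNames {Γ : TyCtx} {ρ : LocSet L} {k : SetKind} (h : ρ.Kinded Γ k) :
    (ρ.mapNames f).Kinded Γ k := by
  induction h with
  | var h => exact .var h
  | subVar h => exact .subVar h
  | empty k => exact .empty k
  | sng k h => exact .sng k (LocE.mapNames_kinded h)
  | union _ _ h₁ h₂ => exact .union h₁ h₂
  | top => exact .top

theorem LocSet.Mem.mapNames {ℓ : LocE L} {ρ : LocSet L} (h : LocSet.Mem ℓ ρ) :
    LocSet.Mem (ℓ.mapNames f) (ρ.mapNames f) := by
  induction h with
  | sng => exact .sng _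
  | left _ ih => exact .left ih
  | right _ ih => exact .right ih
  | top => exact .top _

theorem LocSet.Sub.mapNames {ρ ρ' : LocSet L} (h : LocSet.Sub ρ ρ') :
    LocSet.Sub (ρ.mapNames f) (ρ'.mapNames f) := by
  induction h with
  | empty => exact .empty _
  | var n => exact .refl _
  | sng h => exact .sng h.mapNames
  | left _ ih => exact .left ih
  | right _ ih => exact .right ih
  | union _ _ h₁ h₂ => exact .union h₁ h₂
  | top => exact .top _

theorem LocSet.comps_mapNames (ρ : LocSet L) :
    (ρ.mapNames f).comps = LocSet.mapNames f '' ρ.comps := by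
  induction ρ with
  | empty => exact (Set.image_empty _).symm
  | union _ _ h₁ h₂ =>
    simp only [LocSet.mapNames, LocSet.comps, h₁, h₂, Set.image_union]
  | _ => simp [LocSet.mapNames, LocSet.comps]

theorem LocSet.nl_mapNames (ρ : LocSet L) : (ρ.mapNames f).nl = f '' ρ.nl := by
  induction ρ with
  | sng ℓ => cases ℓ <;> simp [LocSet.mapNames, LocSet.nl, LocE.mapNames, LocE.nl]
  | union _ _ h₁ h₂ => simp [LocSet.mapNames, LocSet.nl, h₁, h₂, Set.image_union]
  | _ => simp [LocSet.mapNames, LocSet.nl]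

theorem CTy.nl_mapNames {T : Type v} (τ : CTy L T) : (τ.mapNames f).nl = f '' τ.nl := by
  induction τ <;> simp_all [CTy.mapNames, CTy.nl, Set.image_union, LocSet.nl_mapNames]

theorem KCtx.mapNames_ext (Γ : KCtx L) (κ : Kind L) :
    (Γ.ext κ).mapNames f = (Γ.mapNames f).ext (κ.mapNames f) := by
  have e : ∀ ξ : Ren, LocSet.mapNames f ∘ LocSet.ren ξ = LocSet.ren ξ ∘ LocSet.mapNames f :=
    fun ξ => funext fun ρ => LocSet.mapNames_ren ξ ρ
  cases κ <;> simp [KCtx.mapNames, KCtx.ext, Kind.mapNames, e]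

theorem CTy.Kinded.mapNames {Γ : KCtx L} {τ : CTy L 𝓛.Ty} {ρ : LocSet L}
    (h : CTy.Kinded 𝓛 Γ τ ρ) :
    CTy.Kinded 𝓛 (Γ.mapNames f) (τ.mapNames f) (ρ.mapNames f) := by
  induction h with
  | var hn => exact .var (by simp [KCtx.mapNames, hn])
  | located ht hρ => exact .located ht hρ.mapNames
  | arr _ _ hρ ih₁ ih₂ => exact .arr ih₁ ih₂ hρ.mapNames
  | prod _ _ ih₁ ih₂ => exact .prod ih₁ ih₂
  | sum _ _ hρ hsub ih₁ ih₂ => exact .sum ih₁ ih₂ hρ.mapNames hsub.mapNames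
  | mu hρ _ hsub ih =>
    rw [KCtx.mapNames_ext] at ih
    exact .mu hρ.mapNames ih hsub.mapNames
  | @allLoc Γ κ _ _ _ hκ hρ _ ih =>
    rw [KCtx.mapNames_ext] at ih
    refine .allLoc ((Kind.isLoc_mapNames_iff κ).2 hκ) ?_ ih
    rw [← KCtx.mapNames_ext]
    exact hρ.mapNames
  | @all Γ κ _ _ _ hκ hwf hρ _ ih =>
    rw [KCtx.mapNames_ext] at ih
    refine .all (fun h => hκ ((Kind.isLoc_mapNames_iff κ).1 h)) ?_ ?_ ih
    · cases κ with
      | prog ρ => exact LocSet.Kinded.mapNames hwf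
      | _ => trivial
    · rw [← KCtx.mapNames_ext]
      exact hρ.mapNames

theorem TArg.Kinded.mapNames {Γ : KCtx L} {a : TArg L 𝓛.Ty} {κ : Kind L}
    (h : TArg.Kinded 𝓛 Γ a κ) :
    TArg.Kinded 𝓛 (Γ.mapNames f) (a.mapNames f) (κ.mapNames f) := by
  cases h with
  | loc h => exact .loc (LocE.mapNames_kinded h)
  | set h => exact .set h.mapNames
  | lty h => exact .lty h
  | prog h => exact .prog h.mapNames

theorem Ctx.mapNames_extTy (Γ : Ctx 𝓛) (κ : Kind L) :
    (Γ.extTy κ).mapNames f = (Γ.mapNames f).extTy (κ.mapNames f) := by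
  simp only [Ctx.mapNames, Ctx.extTy, KCtx.mapNames_ext, List.map_map, Ctx.mk.injEq, true_and,
    Kind.sort_mapNames]
  refine ⟨List.map_congr_left fun p _ => ?_, List.map_congr_left fun τ _ => ?_⟩
  · exact Prod.ext (LocSet.mapNames_ren _ _) rfl
  · exact CTy.mapNames_ren _ _

theorem Ctx.typed_mapNames {Γ : Ctx 𝓛} {ρ : LocSet L} {e : 𝓛.Expr} {t : 𝓛.Ty}
    (h : 𝓛.Typed Γ.kctx.toTyCtx (Γ.proj ρ) e t) (hρ : ∀ A ∈ ρ.nl, f A = A) :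
    𝓛.Typed (Γ.mapNames f).kctx.toTyCtx ((Γ.mapNames f).proj ρ) e t := by
  refine 𝓛.typed_weaken (Γ := Γ.kctx.toTyCtx) h fun n b hb => ?_
  obtain ⟨ρ', hn, hs⟩ := Ctx.proj_eq_some.1 hb
  refine Ctx.proj_eq_some.2 ⟨ρ'.mapNames f, by simp [Ctx.mapNames, hn], ?_⟩
  rw [← LocSet.mapNames_eq hρ]
  exact hs.mapNames

/-- The participants are among the names that occur in the choreography. -/
theorem HasType.nl_subset_names {Γ : Ctx 𝓛} {C : Chor L 𝓛.Ty 𝓛.Expr} {τ : CTy L 𝓛.Ty}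
    {ρ : LocSet L} (h : HasType 𝓛 Γ C τ ρ) : ρ.nl ⊆ C.names := by
  induction h with
  | _ =>
    simp only [LocSet.nl, Chor.names, LocSet.nl_dropLoc, LocSet.nl_dropSet, LocE.nl]
    grind

/-- `f` fixes the names in `S`, and maps no other name into `S`.  The second property preserves
that a name in `S`, such as that of a spawned location, does not occur in a type. -/
def Fixes (f : L → L) (S : Set L) : Prop := ∀ A, A ∈ S ∨ f A ∈ S → f A = A

theorem Fixes.mono {S T : Set L} (h : Fixes f T) (hST : S ⊆ T) : Fixes f S :=
  fun A hA => h A (hA.imp (@hST _) (@hST _))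

theorem Fixes.eq {S : Set L} (h : Fixes f S) {A : L} (hA : A ∈ S) : f A = A := h A (.inl hA)

/-- The names in types that do not occur in the choreography can be changed: a typing
derivation may involve types that mention names of which there is no trace in the
choreography, and these names may clash with that of a new location. -/
theorem HasType.mapNames {Γ : Ctx 𝓛} {C : Chor L 𝓛.Ty 𝓛.Expr} {τ : CTy L 𝓛.Ty} {ρ : LocSet L}
    (h : HasType 𝓛 Γ C τ ρ) (hf : Fixes f C.names) :
    HasType 𝓛 (Γ.mapNames f) C (τ.mapNames f) ρ := by
  induction h with
  | var hn => exact .var (by simp [Ctx.mapNames, hn])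
  | @doneVal Γ ρ e t ht hρ he hv =>
    have e : ρ.mapNames f = ρ := LocSet.mapNames_eq fun A hA => hf.eq hA
    simp only [CTy.mapNames, e]
    exact .doneVal ht hρ (Ctx.typed_mapNames he fun A hA => hf.eq hA) hv
  | @done Γ ρ e t ht hρ he hv =>
    have e : ρ.mapNames f = ρ := LocSet.mapNames_eq fun A hA => hf.eq hA
    simp only [CTy.mapNames, e]
    exact .done ht hρ (Ctx.typed_mapNames he fun A hA => hf.eq hA) hv
  | @lam Γ C τ₁ τ₂ ρ ρ' ρb hk hC hb hs ih =>
    have e : ρ'.mapNames f = ρ' := LocSet.mapNames_eq fun A hA => hf.eq (.inl hA)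
    have eb : ρb.mapNames f = ρb :=
      LocSet.mapNames_eq fun A hA => hf.eq (.inr (hC.nl_subset_names hA))
    have hk' := hk.mapNames (f := f)
    rw [e] at hk'
    refine .lam hk' (ih (hf.mono Set.subset_union_right)) ?_ hs
    rw [← eb, LocSet.comps_mapNames, LocSet.comps_mapNames]
    exact Set.image_mono hb
  | @app Γ C₁ C₂ τ₁ τ₂ ρ ρ' ρ₁ ρ₂ _ _ hk d₁ d₂ d₃ d₄ ih₁ ih₂ =>
    have e : ρ'.mapNames f = ρ' := LocSet.mapNames_eq fun A hA => hf.eq (.inl (.inl hA))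
    have hk' := hk.mapNames (f := f)
    rw [e] at hk'
    exact .app (ih₁ (hf.mono fun A hA => .inl (.inr hA))) (ih₂ (hf.mono fun A hA => .inr hA)) hk'
      d₁ d₂ d₃ d₄
  | @tlam Γ κ C τ ρ ρ' ρb hk hC hb hs ih =>
    have e : κ.mapNames f = κ := Kind.mapNames_eq fun A hA => hf.eq (.inl hA)
    have eb : ρb.mapNames f = ρb :=
      LocSet.mapNames_eq fun A hA => hf.eq (.inr (hC.nl_subset_names hA))
    have ih' := ih (hf.mono Set.subset_union_right)
    have hk' := hk.mapNames (f := f)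
    rw [Ctx.mapNames_extTy, e] at ih'
    simp only [CTy.mapNames, e] at hk' ⊢
    refine .tlam hk' ?_ ?_ hs (ρb := ρb)
    · simp only [Ctx.mapNames, Ctx.extVar, List.map_cons, CTy.mapNames, e] at ih'
      exact ih'
    · rw [← eb, LocSet.comps_mapNames, LocSet.comps_mapNames]
      exact Set.image_mono hb
  | @tapp Γ κ C τ a ρ ρ₁ ρ₂ ρ' _ ha hk e d ih =>
    have ea : ∀ A ∈ a.names, f A = A := fun A hA => hf.eq (.inr hA)
    have eρ : ρ'.mapNames f = ρ' := LocSet.mapNames_eq fun A hA => hf.eq (.inl (.inr hA))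
    have hi := TSubst.FixedBy.inst (𝓛 := 𝓛) ea
    have ha' := ha.mapNames (f := f)
    have hk' := hk.mapNames (f := f)
    rw [CTy.mapNames_inst _ hi] at hk' ⊢
    rw [TArg.mapNames_eq ea] at ha' hk' ⊢
    refine .tapp (ih (hf.mono fun A hA => .inl (.inl hA))) ha' hk' ?_ d
    rw [← LocSet.mapNames_subst hi.1 hi.2, ← eρ, e]
    rfl
  | pair _ _ hk d₁ d₂ ih₁ ih₂ =>
    have hk' := hk.mapNames (f := f)
    rw [LocSet.mapNames_eq fun A hA => hf.eq (.inl (.inl hA))] at hk'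
    exact .pair (ih₁ (hf.mono fun A hA => .inl (.inr hA))) (ih₂ (hf.mono fun A hA => .inr hA))
      hk' d₁ d₂
  | fst _ hk d ih =>
    have hk' := hk.mapNames (f := f)
    rw [LocSet.mapNames_eq fun A hA => hf.eq (.inl hA)] at hk'
    exact .fst (ih (hf.mono fun A hA => .inr hA)) hk' d
  | snd _ hk d ih =>
    have hk' := hk.mapNames (f := f)
    rw [LocSet.mapNames_eq fun A hA => hf.eq (.inl hA)] at hk'
    exact .snd (ih (hf.mono fun A hA => .inr hA)) hk' d
  | @inl Γ C τ₁ τ₂ ρ ρ₁ _ hk d ih =>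
    have e : ρ.mapNames f = ρ := LocSet.mapNames_eq fun A hA => hf.eq (.inl hA)
    have hk' := hk.mapNames (f := f)
    simp only [CTy.mapNames, e] at hk' ⊢
    exact .inl (ih (hf.mono fun A hA => .inr hA)) hk' d
  | @inr Γ C τ₁ τ₂ ρ ρ₁ _ hk d ih =>
    have e : ρ.mapNames f = ρ := LocSet.mapNames_eq fun A hA => hf.eq (.inl hA)
    have hk' := hk.mapNames (f := f)
    simp only [CTy.mapNames, e] at hk' ⊢
    exact .inr (ih (hf.mono fun A hA => .inr hA)) hk' d
  | @caseOf Γ C C₁ C₂ τ τ₁ τ₂ ρ ρ₀ ρ₁ ρ₂ _ _ _ hs d d₁ d₂ d₀₁ d₀₂ d₁₀ d₂₀ ih₀ ih₁ ih₂ =>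
    have e : ρ.mapNames f = ρ := LocSet.mapNames_eq fun A hA => hf.eq (.inl (.inl (.inl hA)))
    have h₀ := ih₀ (hf.mono fun A hA => .inl (.inl (.inr hA)))
    simp only [CTy.mapNames, e] at h₀
    exact .caseOf h₀ (ih₁ (hf.mono fun A hA => .inl (.inr hA)))
      (ih₂ (hf.mono fun A hA => .inr hA)) hs d d₁ d₂ d₀₁ d₀₂ d₁₀ d₂₀
  | @localCase Γ C C₁ C₂ τ t t₁ t₂ ρ ρ' ρ₀ ρ₁ ρ₂ _ hsum hsub _ _ hs d d₁ d₂ d₀₁ d₀₂ d₁₀ d₂₀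
      ih₀ ih₁ ih₂ =>
    have e : ρ.mapNames f = ρ := LocSet.mapNames_eq fun A hA => hf.eq (.inl (.inl (.inl hA)))
    have h₀ := ih₀ (hf.mono fun A hA => .inl (.inl (.inr hA)))
    have h₁ := ih₁ (hf.mono fun A hA => .inl (.inr hA))
    have h₂ := ih₂ (hf.mono fun A hA => .inr hA)
    have hsub' := hsub.mapNames (f := f)
    simp only [Ctx.mapNames, Ctx.extLocal, List.map_cons] at h₁ h₂
    rw [e] at h₁ h₂ hsub'
    exact .localCase h₀ hsum hsub' h₁ h₂ hs d d₁ d₂ d₀₁ d₀₂ d₁₀ d₂₀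
  | @fold Γ C τ ρ ρ₁ _ hk d ih =>
    have e : ρ.mapNames f = ρ := LocSet.mapNames_eq fun A hA => hf.eq (.inl hA)
    have hk' := hk.mapNames (f := f)
    have h' := ih (hf.mono fun A hA => .inr hA)
    rw [CTy.mapNames_inst _ ⟨fun n => rfl, fun n => rfl⟩] at h'
    simp only [CTy.mapNames, TArg.mapNames, e] at h' hk' ⊢
    exact .fold h' hk' d
  | @unfold Γ C τ ρ ρ₁ _ d ih =>
    have e : ρ.mapNames f = ρ := LocSet.mapNames_eq fun A hA => hf.eq (.inl hA)
    have h' := ih (hf.mono fun A hA => .inr hA)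
    rw [CTy.mapNames_inst _ ⟨fun n => rfl, fun n => rfl⟩]
    simp only [CTy.mapNames, TArg.mapNames, e] at h' ⊢
    exact .unfold h' d
  | @letLocal Γ C₁ C₂ τ t ρ ρ' ρ₁ ρ₂ _ hsub _ d₁ d₂ d₁₂ d₂₁ ih₁ ih₂ =>
    have e : ρ.mapNames f = ρ := LocSet.mapNames_eq fun A hA => hf.eq (.inl (.inl hA))
    have h₁ := ih₁ (hf.mono fun A hA => .inl (.inr hA))
    have h₂ := ih₂ (hf.mono fun A hA => .inr hA)
    have hsub' := hsub.mapNames (f := f)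
    simp only [Ctx.mapNames, Ctx.extLocal, List.map_cons] at h₂
    rw [e] at h₂ hsub'
    exact .letLocal h₁ hsub' h₂ d₁ d₂ d₁₂ d₂₁
  | @letLoc Γ C₁ C₂ τ ρ ρt ρ' ρτ ρ₁ ρ₂ _ hsub hsub' hρ hτ _ d₁ d₂ d₁₂ d₂₁ ih₁ ih₂ =>
    have e : ρ.mapNames f = ρ := LocSet.mapNames_eq fun A hA => hf.eq (.inl (.inl hA))
    have h₁ := ih₁ (hf.mono fun A hA => .inl (.inr hA))
    have h₂ := ih₂ (hf.mono fun A hA => .inr hA)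
    have hsub'' := hsub'.mapNames (f := f)
    rw [e] at hsub''
    rw [Ctx.mapNames_extTy, CTy.mapNames_ren] at h₂
    exact .letLoc h₁ hsub hsub'' hρ hτ.mapNames h₂ d₁ d₂ d₁₂ d₂₁
  | @letSet Γ k C₁ C₂ τ ρ ρt ρ' ρτ ρ₁ ρ₂ _ hsub hsub' hρ hτ _ d₁ d₂ d₁₂ d₂₁ ih₁ ih₂ =>
    have e : ρ.mapNames f = ρ := LocSet.mapNames_eq fun A hA => hf.eq (.inl (.inl hA))
    have h₁ := ih₁ (hf.mono fun A hA => .inl (.inr hA))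
    have h₂ := ih₂ (hf.mono fun A hA => .inr hA)
    have hsub'' := hsub'.mapNames (f := f)
    rw [e] at hsub''
    rw [Ctx.mapNames_extTy, CTy.mapNames_ren] at h₂
    exact .letSet h₁ hsub hsub'' hρ hτ.mapNames h₂ d₁ d₂ d₁₂ d₂₁
  | @send Γ C t ℓ ρ ρ₁ ρ₂ _ hm hρ d₁ d₂ ih =>
    have e₁ : ℓ.mapNames f = ℓ := LocE.mapNames_eq fun A hA => hf.eq (.inl (.inl hA))
    have e₂ : ρ₂.mapNames f = ρ₂ := LocSet.mapNames_eq fun A hA => hf.eq (.inl (.inr hA))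
    have hm' := hm.mapNames (f := f)
    rw [e₁] at hm'
    simp only [CTy.mapNames, LocSet.mapNames, e₂]
    exact .send (ih (hf.mono fun A hA => .inr hA)) hm' hρ d₁ d₂
  | sync _ hℓ hρ d₁ d₂ ih =>
    exact .sync (ih (hf.mono fun A hA => .inr hA)) hℓ hρ d₁ d₂
  | @fork Γ C τ ℓ ρ ρτ hℓ hτ _ d ih =>
    have e : (ℓ.ren (Ren.shift .loc)).mapNames f = ℓ.ren (Ren.shift .loc) := by
      rw [LocE.mapNames_ren, LocE.mapNames_eq fun A hA => hf.eq (.inl hA)]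
    have h' := ih (hf.mono fun A hA => .inr hA)
    have e' := Ctx.mapNames_extTy (f := f) Γ .loc
    simp only [Ctx.mapNames] at e'
    simp only [Ctx.mapNames, Ctx.extLocal, List.map_cons, LocSet.mapNames, e,
      CTy.mapNames_ren] at h'
    refine .fork hℓ hτ.mapNames (ρ := ρ) ?_ d
    rw [Ctx.mk.injEq] at e'
    simp only [e'] at h'
    exact h'
  | killAfter _ hτ hA ih =>
    refine .killAfter (ih (hf.mono fun A hA => .inr hA)) (fun h => hτ ?_) hA
    rw [CTy.nl_mapNames] at h
    obtain ⟨B, hB, e⟩ := h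
    have hBA : f B = B := hf B (.inr (by rw [e]; exact .inl rfl))
    rwa [← e, hBA]

end NameMaps
section Steps

variable {L : Type u} {𝓛 : LocalLang.{u, v, w} L}

/-! ### The effect of a step on spawned locations and participants -/

/-- The spawned locations are participants. -/
theorem HasType.spawned_subset_nl {Γ : Ctx 𝓛} {C : Chor L 𝓛.Ty 𝓛.Expr} {τ : CTy L 𝓛.Ty}
    {ρ : LocSet L} (h : HasType 𝓛 Γ C τ ρ) : C.spawned ⊆ ρ.nl := by
  induction h with
  | lam _ _ _ hs => exact hs.subset.trans (Set.empty_subset _)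
  | tlam _ _ _ hs => exact hs.subset.trans (Set.empty_subset _)
  | _ =>
    simp only [LocSet.nl, Chor.spawned, LocSet.nl_dropLoc, LocSet.nl_dropSet, LocE.nl]
    grind

theorem LocSet.mem_const_dropLoc {A : L} {ρ : LocSet L} (h : LocSet.Mem (.const A) ρ) :
    LocSet.Mem (.const A) ρ.dropLoc := by
  induction ρ with
  | sng ℓ => cases h; exact .sng _
  | union _ _ h₁ h₂ =>
    cases h with
    | left h => exact .left (h₁ h)
    | right h => exact .right (h₂ h)
  | top => exact .top _
  | _ => cases h

theorem LocSet.mem_const_dropSet {A : L} {ρ : LocSet L} (h : LocSet.Mem (.const A) ρ) :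
    LocSet.Mem (.const A) ρ.dropSet := by
  induction ρ with
  | sng ℓ => exact h
  | union _ _ h₁ h₂ =>
    cases h with
    | left h => exact .left (h₁ h)
    | right h => exact .right (h₂ h)
  | top => exact .top _
  | _ => cases h

theorem LocSet.mem_union_iff {ℓ : LocE L} {ρ₁ ρ₂ : LocSet L} :
    LocSet.Mem ℓ (.union ρ₁ ρ₂) ↔ LocSet.Mem ℓ ρ₁ ∨ LocSet.Mem ℓ ρ₂ := by
  constructor
  · rintro (_ | h | h)
    · exact .inl h
    · exact .inr h
  · rintro (h | h)
    · exact .left h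
    · exact .right h

/-- The named participants are blocked locations.  Hence a location that is not blocked can
be killed without remaining a participant. -/
theorem HasType.mem_cloc {Γ : Ctx 𝓛} {C : Chor L 𝓛.Ty 𝓛.Expr} {τ : CTy L 𝓛.Ty}
    {ρ : LocSet L} (h : HasType 𝓛 Γ C τ ρ) {A : L} (hA : A ∈ ρ.nl) :
    LocSet.Mem (.const A) C.cloc := by
  have key : ∀ {ρ : LocSet L}, A ∈ ρ.nl → LocSet.Mem (.const A) ρ := LocSet.mem_of_mem_nl
  have keyℓ : ∀ {ℓ : LocE L}, A ∈ ℓ.nl → LocSet.Mem (.const A) (.sng ℓ) :=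
    fun {ℓ} h => LocSet.mem_of_mem_nl (ρ := .sng ℓ) h
  have kl : ∀ {ρ : LocSet L}, LocSet.Mem (.const A) ρ → LocSet.Mem (.const A) ρ.dropLoc :=
    LocSet.mem_const_dropLoc
  have ks : ∀ {ρ : LocSet L}, LocSet.Mem (.const A) ρ → LocSet.Mem (.const A) ρ.dropSet :=
    LocSet.mem_const_dropSet
  induction h with
  | var | doneVal | lam | tlam => cases hA
  | done => exact key hA
  | fold _ _ _ ih | inl _ _ _ ih | inr _ _ _ ih => exact ih hA
  | killAfter _ _ _ ih =>
    rcases hA with hA | hA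
    · exact .right (ih hA)
    · exact .left (LocSet.mem_of_mem_nl hA)
  | _ =>
    simp only [LocSet.nl, Set.mem_union, LocSet.nl_dropLoc, LocSet.nl_dropSet] at hA
    simp only [Chor.cloc, LocSet.mem_union_iff]
    grind

/-- The effect of a step that spawns `N` and kills `K`, on the spawned locations, which change
from `S` to `S'`, and on the named participants, which change from `P` to `P'`. -/
structure Effect (N K S S' P P' : Set L) : Prop where
  spawned : S' = (S ∪ N) \ K
  killed : K ⊆ S
  nl : P' ⊆ P ∪ N
  nl_killed : Disjoint P' K

namespace Effect

variable {N K S S' P P' : Set L}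

theorem disjoint_spawned (h : Effect N K S S' P P') {X : Set L} (hS : Disjoint X S)
    (hN : Disjoint X N) : Disjoint X S' := by
  rw [h.spawned]
  exact (Set.disjoint_union_right.2 ⟨hS, hN⟩).mono_right Set.sdiff_subset

theorem disjoint_nl (h : Effect N K S S' P P') {X : Set L} (hP : Disjoint P X)
    (hN : Disjoint X N) : Disjoint P' X :=
  (Set.disjoint_union_left.2 ⟨hP, hN.symm⟩).mono_left h.nl

/-- A step in a choreography whose remaining parts have spawned locations `S₂` and
participants `P₂`.  No killed location is among these, since typing keeps the spawned locations
of one part apart from the participants of the others. -/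
theorem frame (h : Effect N K S S' P P') {S₂ P₂ T T' Q Q' : Set L} (hd : Disjoint P₂ S)
    (hs : S₂ ⊆ P₂) (hT : T = S ∪ S₂) (hT' : T' = S' ∪ S₂) (hQ : Q = P ∪ P₂)
    (hQ' : Q' = P' ∪ P₂) : Effect N K T T' Q Q' := by
  subst hT hT' hQ hQ'
  have hd' : Disjoint P₂ K := hd.mono_right h.killed
  refine ⟨?_, h.killed.trans Set.subset_union_left, ?_,
    Set.disjoint_union_left.2 ⟨h.nl_killed, hd'⟩⟩
  · rw [h.spawned]
    ext A
    have : A ∈ S₂ → A ∉ K := fun hA => Set.disjoint_left.1 hd' (hs hA)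
    simp only [Set.mem_union, Set.mem_sdiff]
    tauto
  · intro A hA
    have := @h.nl A
    simp only [Set.mem_union] at *
    tauto

/-- The same step in two branches, which have the same spawned locations. -/
theorem branches {S₂ S₂' P₂ P₂' : Set L} (h : Effect N K S S' P P')
    (h₂ : Effect N K S₂ S₂' P₂ P₂') (hS : S = S₂) :
    S' = S₂' ∧ Effect N K S S' (P ∪ P₂) (P' ∪ P₂') := by
  refine ⟨by rw [h.spawned, h₂.spawned, hS], h.spawned, h.killed, ?_,
    Set.disjoint_union_left.2 ⟨h.nl_killed, h₂.nl_killed⟩⟩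
  intro A hA
  have := @h.nl A
  have := @h₂.nl A
  simp only [Set.mem_union] at *
  tauto

theorem frame_unary (h : Effect N K S S' P P') {P₂ Q Q' : Set L} (hd : Disjoint P₂ S)
    (hQ : Q = P ∪ P₂) (hQ' : Q' = P' ∪ P₂) : Effect N K S S' Q Q' :=
  h.frame (S₂ := ∅) hd (Set.empty_subset _) (Set.union_empty _).symm (Set.union_empty _).symm
    hQ hQ'

/-- The effect of a step that neither spawns nor kills. -/
theorem of_eq {Ω : Set L} (hS : S' = S) (hP : P' ⊆ P) : Effect (Ω \ Ω) (Ω \ Ω) S S' P P' := by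
  simp only [sdiff_self, Set.bot_eq_empty]
  exact ⟨by simp [hS], Set.empty_subset _, by simpa using hP, Set.disjoint_empty _⟩

end Effect

/-! ### Reduction preserves types -/

theorem Ctx.mapNames_extLocal (f : L → L) (Γ : Ctx 𝓛) (ρ : LocSet L) (t : 𝓛.Ty) :
    (Γ.extLocal ρ t).mapNames f = (Γ.mapNames f).extLocal (ρ.mapNames f) t := rfl

/-- Instantiation of a program variable by a value. -/
theorem HasType.subst_val {Γ : Ctx 𝓛} {C V : Chor L 𝓛.Ty 𝓛.Expr} {τ τ' : CTy L 𝓛.Ty}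
    {ρ : LocSet L} (hC : HasType 𝓛 (Γ.extVar τ') C τ ρ) (hV : TypedIdle Γ V τ') :
    ∃ ρ', HasType 𝓛 Γ (C.subst ((Subst.id 𝓛).consCh V)) τ ρ' ∧ ρ'.nl ⊆ ρ.nl ∧
      (C.subst ((Subst.id 𝓛).consCh V)).spawned = C.spawned := by
  have hw := (Subst.Wf.id Γ).consCh (τ := τ') (V := V) (by
    rw [show (Subst.id 𝓛).tsubst = TSubst.id 𝓛 from rfl, CTy.subst_id]; exact hV)
  have e : ((Subst.id 𝓛).consCh V).tsubst = TSubst.id 𝓛 := rfl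
  obtain ⟨ρ', h, hc⟩ := hC.subst hw (by rw [e, TSubst.names_id]; exact Set.empty_disjoint _)
  rw [e, CTy.subst_id] at h
  rw [e, show ρ.subst (TSubst.id 𝓛).loc (TSubst.id 𝓛).set = ρ from LocSet.subst_var ρ] at hc
  exact ⟨ρ', h, LocSet.nl_mono hc, Chor.spawned_subst hw.spawned C⟩

/-- Instantiation of a local variable by a closed local program. -/
theorem HasType.subst_local {Γ : Ctx 𝓛} {C : Chor L 𝓛.Ty 𝓛.Expr} {e : 𝓛.Expr} {t : 𝓛.Ty}
    {τ : CTy L 𝓛.Ty} {ρ ρx : LocSet L} (hC : HasType 𝓛 (Γ.extLocal ρx t) C τ ρ)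
    (he : 𝓛.Typed Γ.kctx.toTyCtx (fun _ => none) e t) :
    ∃ ρ', HasType 𝓛 Γ (C.subst ((Subst.id 𝓛).consEx e)) τ ρ' ∧ ρ'.nl ⊆ ρ.nl ∧
      (C.subst ((Subst.id 𝓛).consEx e)).spawned = C.spawned := by
  have hw := (Subst.Wf.id Γ).consEx (ρ := ρx) (t := t) (e := e) (by
    rw [show 𝓛.tsub (Subst.id 𝓛).tsubst.loc (Subst.id 𝓛).tsubst.set (Subst.id 𝓛).tsubst.lty t = t
      from 𝓛.tsub_id t]
    exact he)
  have e' : ((Subst.id 𝓛).consEx e).tsubst = TSubst.id 𝓛 := rfl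
  obtain ⟨ρ', h, hc⟩ := hC.subst hw (by rw [e', TSubst.names_id]; exact Set.empty_disjoint _)
  rw [e', CTy.subst_id] at h
  rw [e', show ρ.subst (TSubst.id 𝓛).loc (TSubst.id 𝓛).set = ρ from LocSet.subst_var ρ] at hc
  exact ⟨ρ', h, LocSet.nl_mono hc, Chor.spawned_subst hw.spawned C⟩

theorem TSubst.nl_names_inst_loc (A : L) :
    (TSubst.inst (.loc (.const A) : TArg L 𝓛.Ty)).names ⊆ {A} := by
  intro B hB
  simp only [TSubst.names, Set.mem_union, Set.mem_iUnion] at hB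
  rcases hB with (⟨_ | n, hn⟩ | ⟨n, hn⟩) | ⟨n, hn⟩
  · exact hn
  all_goals cases hn

theorem TSubst.nl_names_inst_set (ρ : LocSet L) :
    (TSubst.inst (.set ρ : TArg L 𝓛.Ty)).names ⊆ ρ.nl := by
  intro B hB
  simp only [TSubst.names, Set.mem_union, Set.mem_iUnion] at hB
  rcases hB with (⟨n, hn⟩ | ⟨_ | n, hn⟩) | ⟨n, hn⟩
  · cases hn
  · exact hn
  all_goals cases hn

/-- Instantiation of a type variable in a type that does not depend on it. -/
theorem HasType.subst_type {Γ : Ctx 𝓛} {C : Chor L 𝓛.Ty 𝓛.Expr} {κ : Kind L}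
    {a : TArg L 𝓛.Ty} {τ : CTy L 𝓛.Ty} {ρ : LocSet L}
    (hC : HasType 𝓛 (Γ.extTy κ) C (τ.ren 𝓛 (Ren.shift κ.sort)) ρ)
    (ha : TArg.Kinded 𝓛 Γ.kctx a κ) (hd : Disjoint (TSubst.inst a).names C.spawned) :
    ∃ ρ', HasType 𝓛 Γ (C.subst ((Subst.id 𝓛).consTy a)) τ ρ' ∧
      ρ'.nl ⊆ ρ.nl ∪ (TSubst.inst a).names ∧
      (C.subst ((Subst.id 𝓛).consTy a)).spawned = C.spawned := by
  have hw := (Subst.Wf.id Γ).consTy rfl rfl ha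
  have e : ((Subst.id 𝓛).consTy a).tsubst = TSubst.inst a := rfl
  obtain ⟨ρ', h, hc⟩ := hC.subst hw (by rwa [e])
  rw [e, ← ha.sort_eq, CTy.ren_shift_inst] at h
  exact ⟨ρ', h, (LocSet.nl_mono hc).trans (LocSet.nl_subst_names _ _),
    Chor.spawned_subst hw.spawned C⟩

theorem LocSet.nl_ofFinset (S : Finset L) : (LocSet.ofFinset S).nl = S := by
  have : ∀ l : List L, (l.foldr (fun A ρ => LocSet.union (.sng (.const A)) ρ) .empty).nl =
      {A | A ∈ l} := by
    intro l
    induction l with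
    | nil => simp [LocSet.nl]
    | cons B l ih =>
      ext A
      simp [LocSet.nl, LocE.nl, ih]
  rw [LocSet.ofFinset, this]
  ext A
  simp

theorem LocSet.kinded_ofFinset (Γ : TyCtx) (S : Finset L) (k : SetKind) :
    (LocSet.ofFinset S).Kinded Γ k := by
  rw [LocSet.ofFinset]
  induction S.toList with
  | nil => exact .empty k
  | cons B l ih => exact .union (.sng k trivial) ih

/-- Inversion for located values. -/
theorem HasType.typed_of_val {Γ : Ctx 𝓛} {ρ ρ' ρ₁ : LocSet L} {e : 𝓛.Expr} {t : 𝓛.Ty}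
    (h : HasType 𝓛 Γ (.done ρ e) (.located t ρ') ρ₁) (he : 𝓛.Val e) :
    𝓛.Typed Γ.kctx.toTyCtx (fun _ => none) e t := by
  cases h with
  | doneVal _ _ h _ => exact 𝓛.val_closed _ _ _ _ he h
  | done _ _ _ hv => exact absurd he hv

/-- What a step does to a typing: the resulting choreography has the same type, up to a change
of names, and spawned locations and participants evolve with the running locations. -/
def Preserves (f : L → L) (Γ : Ctx 𝓛) (C C' : Chor L 𝓛.Ty 𝓛.Expr) (τ : CTy L 𝓛.Ty)
    (ρ : LocSet L) (Ω Ω' : Set L) : Prop :=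
  ∃ ρ', HasType 𝓛 (Γ.mapNames f) C' (τ.mapNames f) ρ' ∧
    Effect (Ω' \ Ω) (Ω \ Ω') C.spawned C'.spawned ρ.nl ρ'.nl

/-- A reduction that neither spawns nor kills: the names can be changed beforehand. -/
theorem HasType.preserves_of_eq {f : L → L} {Γ : Ctx 𝓛} {C C' : Chor L 𝓛.Ty 𝓛.Expr}
    {τ : CTy L 𝓛.Ty} {ρ : LocSet L} (Ω : Set L) (hC : HasType 𝓛 Γ C τ ρ)
    (hf : Fixes f C.names)
    (h : ∀ {Γ τ}, HasType 𝓛 Γ C τ ρ →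
      ∃ ρ', HasType 𝓛 Γ C' τ ρ' ∧ ρ'.nl ⊆ ρ.nl ∧ C'.spawned = C.spawned) :
    Preserves f Γ C C' τ ρ Ω Ω := by
  obtain ⟨ρ', h', hρ, hs⟩ := h (hC.mapNames hf)
  exact ⟨ρ', h', Effect.of_eq hs hρ⟩

theorem HasType.app_preserves {Γ : Ctx 𝓛} {C V : Chor L 𝓛.Ty 𝓛.Expr} {τ : CTy L 𝓛.Ty}
    {ρ₁ ρ₂ ρ : LocSet L} (hV : V.IsVal 𝓛)
    (h : HasType 𝓛 Γ (.app (.lam ρ₁ C) ρ₂ V) τ ρ) :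
    ∃ ρ', HasType 𝓛 Γ (C.subst (((Subst.id 𝓛).consCh (.lam ρ₁ C)).consCh V)) τ ρ' ∧
      ρ'.nl ⊆ ρ.nl ∧ (C.subst (((Subst.id 𝓛).consCh (.lam ρ₁ C)).consCh V)).spawned =
        (Chor.app (.lam ρ₁ C) ρ₂ V).spawned := by
  cases h with
  | @app _ _ _ τ₁ _ ρl _ _ _ hF hX hk d₁ d₂ d₃ d₄ =>
    cases hF with
    | @lam _ _ _ _ _ _ ρb hk' hC hb hs =>
      have hF : HasType 𝓛 Γ (.lam ρ₁ C) (.arr τ₁ ρl τ) .empty := .lam hk' hC hb hs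
      have hw := ((Subst.Wf.id Γ).consCh (τ := .arr τ₁ ρl τ) (V := .lam ρ₁ C) (by
        rw [show (Subst.id 𝓛).tsubst = TSubst.id 𝓛 from rfl, CTy.subst_id]
        exact hF.typedIdle .lam)).consCh (τ := τ₁) (V := V) (by
        rw [show ((Subst.id 𝓛).consCh (.lam ρ₁ C)).tsubst = TSubst.id 𝓛 from rfl, CTy.subst_id]
        exact hX.typedIdle hV)
      have e : (((Subst.id 𝓛).consCh (.lam ρ₁ C)).consCh V).tsubst = TSubst.id 𝓛 := rfl
      obtain ⟨ρ', h, hc⟩ := hC.subst hw (by rw [e, TSubst.names_id]; exact Set.empty_disjoint _)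
      rw [e, CTy.subst_id] at h
      rw [e, show ρb.subst (TSubst.id 𝓛).loc (TSubst.id 𝓛).set = ρb from LocSet.subst_var ρb] at hc
      refine ⟨ρ', h, ?_, ?_⟩
      · -- the participants of the body are latent, and hence annotated
        have hl : ρ'.nl ⊆ ρl.nl := (LocSet.nl_mono hc).trans (LocSet.nl_mono hb)
        cases hk with
        | arr => exact hl.trans (Set.subset_union_right.trans Set.subset_union_right)
      · rw [Chor.spawned_subst hw.spawned]
        simp [Chor.spawned, (hX.idle_of_isVal hV).2]

theorem HasType.tapp_preserves {Γ : Ctx 𝓛} {κ : Kind L} {C : Chor L 𝓛.Ty 𝓛.Expr}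
    {a : TArg L 𝓛.Ty} {τ : CTy L 𝓛.Ty} {ρ₁ ρ : LocSet L}
    (h : HasType 𝓛 Γ (.tapp (.tlam κ C) ρ₁ a) τ ρ) :
    ∃ ρ', HasType 𝓛 Γ (C.subst (((Subst.id 𝓛).consCh (.tlam κ C)).consTy a)) τ ρ' ∧
      ρ'.nl ⊆ ρ.nl ∧ (C.subst (((Subst.id 𝓛).consCh (.tlam κ C)).consTy a)).spawned =
        (Chor.tapp (.tlam κ C) ρ₁ a).spawned := by
  cases h with
  | @tapp _ _ _ τ _ ρl _ ρ₂ _ hF ha hk e d =>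
    cases hF with
    | @tlam _ _ _ _ _ _ ρb hk' hC hb hs =>
      have hF : HasType 𝓛 Γ (.tlam κ C) (.all κ ρl τ) .empty := .tlam hk' hC hb hs
      have hw := ((Subst.Wf.id Γ).consCh (τ := .all κ ρl τ) (V := .tlam κ C) (by
        rw [show (Subst.id 𝓛).tsubst = TSubst.id 𝓛 from rfl, CTy.subst_id]
        exact hF.typedIdle .tlam)).consTy rfl rfl ha
      have e' : (((Subst.id 𝓛).consCh (.tlam κ C)).consTy a).tsubst = TSubst.inst a := rfl
      obtain ⟨ρ', h, hc⟩ := hC.subst hw (by rw [hs]; exact Set.disjoint_empty _)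
      rw [e'] at h hc
      refine ⟨ρ', h, ?_, Chor.spawned_subst hw.spawned C⟩
      have hl := LocSet.nl_mono (hc.trans (LocSet.comps_subst_mono hb _ _))
      rw [e]
      exact hl.trans (Set.subset_union_right.trans Set.subset_union_right)

theorem HasType.letLoc_preserves {Γ : Ctx 𝓛} {C : Chor L 𝓛.Ty 𝓛.Expr} {e : 𝓛.Expr} {A : L}
    {τ : CTy L 𝓛.Ty} {ρ₁ ρ₂ ρ : LocSet L} (he : 𝓛.LocRep e A)
    (h : HasType 𝓛 Γ (.letLoc ρ₁ (.done ρ₂ e) C) τ ρ) :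
    ∃ ρ', HasType 𝓛 Γ (C.subst ((Subst.id 𝓛).consTy (.loc (.const A)))) τ ρ' ∧
      ρ'.nl ⊆ ρ.nl ∧ (C.subst ((Subst.id 𝓛).consTy (.loc (.const A)))).spawned =
        (Chor.letLoc ρ₁ (.done ρ₂ e) C).spawned := by
  cases h with
  | letLoc hv hsub hsub' hρ hτ hC d₁ d₂ d₁₂ d₂₁ =>
    have hval := 𝓛.locRep_val e A he
    -- the represented location is one of those that the annotation names
    obtain ⟨B, hB, hm⟩ := 𝓛.locTy_sound _ _ _ hval (hv.typed_of_val hval)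
    obtain rfl := 𝓛.locRep_unique e A B he hB
    have hA : A ∈ ρ₁.nl := hρ.mem_nl (hm.of_sub hsub)
    have hn : (TSubst.inst (.loc (.const A) : TArg L 𝓛.Ty)).names ⊆ ρ₁.nl :=
      (TSubst.nl_names_inst_loc A).trans (Set.singleton_subset_iff.2 hA)
    obtain ⟨ρ', h, hn', hs⟩ := hC.subst_type (κ := .loc)
      (TArg.Kinded.loc (ℓ := .const A) trivial)
      (d₂.mono_left hn)
    refine ⟨ρ', h, hn'.trans (Set.union_subset ?_ ?_), ?_⟩
    · simp only [LocSet.nl, LocSet.nl_dropLoc]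
      exact Set.subset_union_right.trans Set.subset_union_left
    · exact hn.trans Set.subset_union_right
    · rw [hs]
      exact (Set.empty_union _).symm

theorem HasType.letSet_preserves {Γ : Ctx 𝓛} {k : SetKind} {C : Chor L 𝓛.Ty 𝓛.Expr}
    {e : 𝓛.Expr} {S : Finset L} {τ : CTy L 𝓛.Ty} {ρ₁ ρ₂ ρ : LocSet L} (he : 𝓛.SetRep e S)
    (h : HasType 𝓛 Γ (.letSet ρ₁ k (.done ρ₂ e) C) τ ρ) :
    ∃ ρ', HasType 𝓛 Γ (C.subst ((Subst.id 𝓛).consTy (.set (.ofFinset S)))) τ ρ' ∧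
      ρ'.nl ⊆ ρ.nl ∧ (C.subst ((Subst.id 𝓛).consTy (.set (.ofFinset S)))).spawned =
        (Chor.letSet ρ₁ k (.done ρ₂ e) C).spawned := by
  cases h with
  | letSet hv hsub hsub' hρ hτ hC d₁ d₂ d₁₂ d₂₁ =>
    have hval := 𝓛.setRep_val e S he
    obtain ⟨S', hS', hm⟩ := 𝓛.locsetTy_sound _ _ _ hval (hv.typed_of_val hval)
    obtain rfl := 𝓛.setRep_unique e S S' he hS'
    have hn : (TSubst.inst (.set (.ofFinset S) : TArg L 𝓛.Ty)).names ⊆ ρ₁.nl := by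
      refine (TSubst.nl_names_inst_set _).trans ?_
      rw [LocSet.nl_ofFinset]
      exact fun A hA => hρ.mem_nl ((hm A hA).of_sub hsub)
    obtain ⟨ρ', h, hn', hs⟩ := hC.subst_type (κ := .set k)
      (TArg.Kinded.set (LocSet.kinded_ofFinset _ S k)) (d₂.mono_left hn)
    refine ⟨ρ', h, hn'.trans (Set.union_subset ?_ ?_), ?_⟩
    · simp only [LocSet.nl, LocSet.nl_dropSet]
      exact Set.subset_union_right.trans Set.subset_union_left
    · exact hn.trans Set.subset_union_right
    · rw [hs]
      exact (Set.empty_union _).symm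

/-- Spawning a location with a new name. -/
theorem HasType.fork_preserves {Γ : Ctx 𝓛} {A B : L} {e : 𝓛.Expr} {C : Chor L 𝓛.Ty 𝓛.Expr}
    {τ : CTy L 𝓛.Ty} {ρ : LocSet L} (he : 𝓛.LocRep e B) (hB : B ∉ C.spawned) (hτ : B ∉ τ.nl)
    (h : HasType 𝓛 Γ (.fork (.const A) C) τ ρ) :
    ∃ ρ', HasType 𝓛 Γ (.killAfter B
        (C.subst (((Subst.id 𝓛).consTy (.loc (.const B))).consEx e))) τ ρ' ∧
      ρ'.nl ⊆ ρ.nl ∪ {B} ∧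
      (C.subst (((Subst.id 𝓛).consTy (.loc (.const B))).consEx e)).spawned = C.spawned := by
  cases h with
  | @fork _ _ _ _ ρ₀ _ hℓ hτ' hC d =>
    have ha : TArg.Kinded 𝓛 Γ.kctx (.loc (.const B)) .loc := TArg.Kinded.loc trivial
    have hw := ((Subst.Wf.id Γ).consTy rfl rfl ha).consEx (e := e)
      (ρ := .union (.sng (.var 0)) (.sng ((LocE.const A).ren (Ren.shift .loc))))
      (t := 𝓛.locTy (.sng (.var 0))) (by
        rw [𝓛.tsub_locTy]; exact 𝓛.locRep_typed _ _ _ he)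
    have e' : (((Subst.id 𝓛).consTy (.loc (.const B))).consEx e).tsubst =
      TSubst.inst (.loc (.const B)) := rfl
    have hs := Chor.spawned_subst hw.spawned C
    obtain ⟨ρ', h, hc⟩ := hC.subst hw (by
      rw [e']
      exact (Set.disjoint_singleton_left.2 hB).mono_left (TSubst.nl_names_inst_loc B))
    have er := CTy.ren_shift_inst (.loc (.const B) : TArg L 𝓛.Ty) τ
    rw [TArg.sort] at er
    rw [e', er] at h
    refine ⟨_, .killAfter h hτ (by rwa [hs]), ?_, hs⟩
    have hn := (LocSet.nl_mono hc).trans (LocSet.nl_subst_names _ _)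
    simp only [LocSet.nl, LocSet.nl_dropLoc]
    refine Set.union_subset (hn.trans (Set.union_subset ?_ ?_)) Set.subset_union_right
    · exact Set.subset_union_right.trans Set.subset_union_left
    · exact (TSubst.nl_names_inst_loc B).trans Set.subset_union_right

end Steps
section Preservation

variable {L : Type u} {𝓛 : LocalLang.{u, v, w} L}

theorem Fixes.union_iff {f : L → L} {S T : Set L} :
    Fixes f (S ∪ T) ↔ Fixes f S ∧ Fixes f T := by
  refine ⟨fun h => ⟨h.mono Set.subset_union_left, h.mono Set.subset_union_right⟩, ?_⟩
  rintro ⟨h₁, h₂⟩ A ((hA | hA) | (hA | hA))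
  · exact h₁ A (.inl hA)
  · exact h₂ A (.inl hA)
  · exact h₁ A (.inr hA)
  · exact h₂ A (.inr hA)

theorem Fixes.locSet_eq {f : L → L} {ρ : LocSet L} (h : Fixes f ρ.nl) : ρ.mapNames f = ρ :=
  LocSet.mapNames_eq fun _ hA => h.eq hA

theorem Fixes.loc_eq {f : L → L} {ℓ : LocE L} (h : Fixes f ℓ.nl) : ℓ.mapNames f = ℓ :=
  LocE.mapNames_eq fun _ hA => h.eq hA

theorem HasType.nl_disjoint {Γ : Ctx 𝓛} {C : Chor L 𝓛.Ty 𝓛.Expr} {τ : CTy L 𝓛.Ty}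
    {ρ : LocSet L} (h : HasType 𝓛 Γ C τ ρ) {N : Set L} (hN : Disjoint C.names N) :
    Disjoint ρ.nl N :=
  hN.mono_left h.nl_subset_names

theorem HasType.spawned_disjoint {Γ : Ctx 𝓛} {C : Chor L 𝓛.Ty 𝓛.Expr} {τ : CTy L 𝓛.Ty}
    {ρ : LocSet L} (h : HasType 𝓛 Γ C τ ρ) {N : Set L} (hN : Disjoint C.names N) :
    Disjoint C.spawned N :=
  hN.mono_left (h.spawned_subset_nl.trans h.nl_subset_names)

/-- Preservation for a step inside an evaluation context, given preservation for the step in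
the hole. -/
theorem HasType.ctx_preserves {f : L → L} (η : Frame 𝓛) {C C' : Chor L 𝓛.Ty 𝓛.Expr}
    {Ω Ω' : Set L}
    (ih : ∀ {Γ : Ctx 𝓛} {τ : CTy L 𝓛.Ty} {ρ : LocSet L}, HasType 𝓛 Γ C τ ρ → ρ.nl ⊆ Ω →
      Fixes f C.names → Disjoint C.names (Ω' \ Ω) → Preserves f Γ C C' τ ρ Ω Ω')
    {Γ : Ctx 𝓛} {τ : CTy L 𝓛.Ty} {ρ : LocSet L} (hC : HasType 𝓛 Γ (η.plug C) τ ρ)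
    (hΩ : ρ.nl ⊆ Ω) (hf : Fixes f (η.plug C).names)
    (hN : Disjoint (η.plug C).names (Ω' \ Ω)) :
    Preserves f Γ (η.plug C) (η.plug C') τ ρ Ω Ω' := by
  cases η with
  | appL ρa C₂ =>
    cases hC with
    | @app _ _ _ τ₁ _ ρl _ ρ₁ ρ₂ h₁ h₂ hk d₁ d₂ d₃ d₄ =>
      simp only [Frame.plug, Chor.names, Set.disjoint_union_left, Fixes.union_iff, LocSet.nl,
        Set.union_subset_iff] at hf hN hΩ
      obtain ⟨⟨fa, f₁⟩, f₂⟩ := hf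
      obtain ⟨⟨na, n₁⟩, n₂⟩ := hN
      obtain ⟨⟨o₁, o₂⟩, oa⟩ := hΩ
      obtain ⟨ρ₁', h₁', E⟩ := ih h₁ o₁ f₁ n₁
      have hk' := hk.mapNames (f := f)
      rw [fa.locSet_eq] at hk'
      refine ⟨_, .app h₁' (h₂.mapNames f₂) hk' (E.disjoint_spawned d₁ na) d₂
        (E.disjoint_nl d₃ (h₂.spawned_disjoint n₂)) (E.disjoint_spawned d₄ (h₂.nl_disjoint n₂)),
        E.frame (S₂ := C₂.spawned) (P₂ := ρ₂.nl ∪ ρa.nl) (Set.disjoint_union_left.2 ⟨d₄, d₁⟩)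
          (h₂.spawned_subset_nl.trans Set.subset_union_left) rfl rfl ?_ ?_⟩ <;>
        simp only [LocSet.nl, Set.union_assoc]
  | appR V ρa =>
    cases hC with
    | @app _ _ _ τ₁ _ ρl _ ρ₁ ρ₂ h₁ h₂ hk d₁ d₂ d₃ d₄ =>
      simp only [Frame.plug, Chor.names, Set.disjoint_union_left, Fixes.union_iff, LocSet.nl,
        Set.union_subset_iff] at hf hN hΩ
      obtain ⟨⟨fa, f₁⟩, f₂⟩ := hf
      obtain ⟨⟨na, n₁⟩, n₂⟩ := hN
      obtain ⟨⟨o₁, o₂⟩, oa⟩ := hΩ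
      obtain ⟨ρ₂', h₂', E⟩ := ih h₂ o₂ f₂ n₂
      have hk' := hk.mapNames (f := f)
      rw [fa.locSet_eq] at hk'
      refine ⟨_, .app (h₁.mapNames f₁) h₂' hk' d₁ (E.disjoint_spawned d₂ na)
        (E.disjoint_spawned d₃ (h₁.nl_disjoint n₁)) (E.disjoint_nl d₄ (h₁.spawned_disjoint n₁)),
        E.frame (S₂ := V.spawned) (P₂ := ρ₁.nl ∪ ρa.nl) (Set.disjoint_union_left.2 ⟨d₃, d₂⟩)
          (h₁.spawned_subset_nl.trans Set.subset_union_left) (Set.union_comm _ _)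
          (Set.union_comm _ _) ?_ ?_⟩ <;>
        simp only [LocSet.nl] <;> ac_rfl
  | tapp ρa a =>
    cases hC with
    | @tapp _ κ _ τ _ ρl ρ₁ ρ₂ _ h₁ ha hk e d =>
      simp only [Frame.plug, Chor.names, Set.disjoint_union_left, Fixes.union_iff, LocSet.nl,
        Set.union_subset_iff] at hf hN hΩ
      obtain ⟨⟨f₁, fρ⟩, fa⟩ := hf
      obtain ⟨⟨n₁, nρ⟩, na⟩ := hN
      obtain ⟨ρ₁', h₁', E⟩ := ih h₁ hΩ.1 f₁ n₁
      have ea : ∀ A ∈ a.names, f A = A := fun A hA => fa.eq hA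
      have hi := TSubst.FixedBy.inst (𝓛 := 𝓛) ea
      have ha' := ha.mapNames (f := f)
      have hk' := hk.mapNames (f := f)
      have hτ := CTy.mapNames_inst τ hi
      rw [hτ] at hk'
      rw [TArg.mapNames_eq ea] at ha' hk' hτ
      unfold Preserves
      rw [hτ]
      refine ⟨_, .tapp h₁' ha' hk' ?_ (E.disjoint_spawned d nρ),
        E.frame_unary (P₂ := ρa.nl) d rfl rfl⟩
      rw [← LocSet.mapNames_subst hi.1 hi.2, ← fρ.locSet_eq, e]
      rfl
  | fold ρa =>
    cases hC with
    | @fold _ _ τ _ ρ₁ h₁ hk d =>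
      simp only [Frame.plug, Chor.names, Set.disjoint_union_left, Fixes.union_iff] at hf hN
      obtain ⟨ρ₁', h₁', E⟩ := ih h₁ hΩ hf.2 hN.2
      have hk' := hk.mapNames (f := f)
      rw [CTy.mapNames_inst _ ⟨fun n => rfl, fun n => rfl⟩] at h₁'
      simp only [CTy.mapNames, TArg.mapNames, hf.1.locSet_eq] at h₁' hk'
      refine ⟨_, ?_, E⟩
      simp only [CTy.mapNames, hf.1.locSet_eq]
      exact .fold h₁' hk' (E.disjoint_spawned d hN.1)
  | unfold ρa =>
    cases hC with
    | @unfold _ _ τ _ ρ₁ h₁ d =>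
      simp only [Frame.plug, Chor.names, Set.disjoint_union_left, Fixes.union_iff, LocSet.nl,
        Set.union_subset_iff] at hf hN hΩ
      obtain ⟨ρ₁', h₁', E⟩ := ih h₁ hΩ.1 hf.2 hN.2
      simp only [CTy.mapNames, hf.1.locSet_eq] at h₁'
      have ht := HasType.unfold h₁' (E.disjoint_spawned d hN.1)
      refine ⟨_, ?_, E.frame_unary (P₂ := ρa.nl) (Q' := (LocSet.union ρ₁' ρa).nl) d rfl rfl⟩
      rw [CTy.mapNames_inst _ ⟨fun n => rfl, fun n => rfl⟩]
      simp only [CTy.mapNames, TArg.mapNames, hf.1.locSet_eq]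
      exact ht
  | pairL ρa C₂ =>
    cases hC with
    | @pair _ _ _ _ _ _ ρ₁ ρ₂ h₁ h₂ hk d₃ d₄ =>
      simp only [Frame.plug, Chor.names, Set.disjoint_union_left, Fixes.union_iff, LocSet.nl,
        Set.union_subset_iff] at hf hN hΩ
      obtain ⟨⟨fa, f₁⟩, f₂⟩ := hf
      obtain ⟨⟨na, n₁⟩, n₂⟩ := hN
      obtain ⟨ρ₁', h₁', E⟩ := ih h₁ hΩ.1 f₁ n₁
      have hk' := hk.mapNames (f := f)
      rw [fa.locSet_eq] at hk'
      exact ⟨_, .pair h₁' (h₂.mapNames f₂) hk' (E.disjoint_nl d₃ (h₂.spawned_disjoint n₂))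
        (E.disjoint_spawned d₄ (h₂.nl_disjoint n₂)),
        E.frame (S₂ := C₂.spawned) (P₂ := ρ₂.nl) d₄ h₂.spawned_subset_nl rfl rfl rfl rfl⟩
  | pairR ρa V =>
    cases hC with
    | @pair _ _ _ _ _ _ ρ₁ ρ₂ h₁ h₂ hk d₃ d₄ =>
      simp only [Frame.plug, Chor.names, Set.disjoint_union_left, Fixes.union_iff, LocSet.nl,
        Set.union_subset_iff] at hf hN hΩ
      obtain ⟨⟨fa, f₁⟩, f₂⟩ := hf
      obtain ⟨⟨na, n₁⟩, n₂⟩ := hN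
      obtain ⟨ρ₂', h₂', E⟩ := ih h₂ hΩ.2 f₂ n₂
      have hk' := hk.mapNames (f := f)
      rw [fa.locSet_eq] at hk'
      exact ⟨_, .pair (h₁.mapNames f₁) h₂' hk' (E.disjoint_spawned d₃ (h₁.nl_disjoint n₁))
        (E.disjoint_nl d₄ (h₁.spawned_disjoint n₁)),
        E.frame (S₂ := V.spawned) (P₂ := ρ₁.nl) d₃ h₁.spawned_subset_nl (Set.union_comm _ _)
          (Set.union_comm _ _) (Set.union_comm _ _) (Set.union_comm _ _)⟩
  | fst ρa =>
    cases hC with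
    | fst h₁ hk d =>
      simp only [Frame.plug, Chor.names, Set.disjoint_union_left, Fixes.union_iff, LocSet.nl,
        Set.union_subset_iff] at hf hN hΩ
      obtain ⟨ρ₁', h₁', E⟩ := ih h₁ hΩ.1 hf.2 hN.2
      have hk' := hk.mapNames (f := f)
      rw [hf.1.locSet_eq] at hk'
      exact ⟨_, .fst h₁' hk' (E.disjoint_spawned d hN.1),
        E.frame_unary (P₂ := ρa.nl) d rfl rfl⟩
  | snd ρa =>
    cases hC with
    | snd h₁ hk d =>
      simp only [Frame.plug, Chor.names, Set.disjoint_union_left, Fixes.union_iff, LocSet.nl,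
        Set.union_subset_iff] at hf hN hΩ
      obtain ⟨ρ₁', h₁', E⟩ := ih h₁ hΩ.1 hf.2 hN.2
      have hk' := hk.mapNames (f := f)
      rw [hf.1.locSet_eq] at hk'
      exact ⟨_, .snd h₁' hk' (E.disjoint_spawned d hN.1),
        E.frame_unary (P₂ := ρa.nl) d rfl rfl⟩
  | inl ρa =>
    cases hC with
    | inl h₁ hk d =>
      simp only [Frame.plug, Chor.names, Set.disjoint_union_left, Fixes.union_iff] at hf hN
      obtain ⟨ρ₁', h₁', E⟩ := ih h₁ hΩ hf.2 hN.2
      have hk' := hk.mapNames (f := f)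
      simp only [CTy.mapNames, hf.1.locSet_eq] at hk'
      refine ⟨_, ?_, E⟩
      simp only [CTy.mapNames, hf.1.locSet_eq]
      exact .inl h₁' hk' (E.disjoint_spawned d hN.1)
  | inr ρa =>
    cases hC with
    | inr h₁ hk d =>
      simp only [Frame.plug, Chor.names, Set.disjoint_union_left, Fixes.union_iff] at hf hN
      obtain ⟨ρ₁', h₁', E⟩ := ih h₁ hΩ hf.2 hN.2
      have hk' := hk.mapNames (f := f)
      simp only [CTy.mapNames, hf.1.locSet_eq] at hk'
      refine ⟨_, ?_, E⟩
      simp only [CTy.mapNames, hf.1.locSet_eq]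
      exact .inr h₁' hk' (E.disjoint_spawned d hN.1)
  | caseOf ρa C₁ C₂ =>
    cases hC with
    | @caseOf _ _ _ _ _ τ₁ τ₂ _ ρ₀ ρ₁ ρ₂ h₀ h₁ h₂ hs d d₁ d₂ d₀₁ d₀₂ d₁₀ d₂₀ =>
      simp only [Frame.plug, Chor.names, Set.disjoint_union_left, Fixes.union_iff, LocSet.nl,
        Set.union_subset_iff] at hf hN hΩ
      obtain ⟨⟨⟨fa, f₀⟩, f₁⟩, f₂⟩ := hf
      obtain ⟨⟨⟨na, n₀⟩, n₁⟩, n₂⟩ := hN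
      obtain ⟨ρ₀', h₀', E⟩ := ih h₀ hΩ.1.1.1 f₀ n₀
      simp only [CTy.mapNames, fa.locSet_eq] at h₀'
      refine ⟨_, .caseOf h₀' (h₁.mapNames f₁) (h₂.mapNames f₂) hs (E.disjoint_spawned d na) d₁ d₂
        (E.disjoint_nl d₀₁ (h₁.spawned_disjoint n₁)) (E.disjoint_nl d₀₂ (h₂.spawned_disjoint n₂))
        (E.disjoint_spawned d₁₀ (h₁.nl_disjoint n₁)) (E.disjoint_spawned d₂₀ (h₂.nl_disjoint n₂)),
        E.frame (S₂ := C₁.spawned ∪ C₂.spawned) (P₂ := ρ₁.nl ∪ ρ₂.nl ∪ ρa.nl)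
          (Set.disjoint_union_left.2 ⟨Set.disjoint_union_left.2 ⟨d₁₀, d₂₀⟩, d⟩)
          ((Set.union_subset_union h₁.spawned_subset_nl h₂.spawned_subset_nl).trans
            Set.subset_union_left) ?_ ?_ ?_ ?_⟩ <;>
        simp only [Frame.plug, Chor.spawned, LocSet.nl, Set.union_assoc]
  | localCase ρa C₁ C₂ =>
    cases hC with
    | @localCase _ _ _ _ _ t t₁ t₂ _ ρ' ρ₀ ρ₁ ρ₂ h₀ hsum hsub h₁ h₂ hs d d₁ d₂ d₀₁ d₀₂ d₁₀ d₂₀ =>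
      simp only [Frame.plug, Chor.names, Set.disjoint_union_left, Fixes.union_iff, LocSet.nl,
        Set.union_subset_iff] at hf hN hΩ
      obtain ⟨⟨⟨fa, f₀⟩, f₁⟩, f₂⟩ := hf
      obtain ⟨⟨⟨na, n₀⟩, n₁⟩, n₂⟩ := hN
      obtain ⟨ρ₀', h₀', E⟩ := ih h₀ hΩ.1.1.1 f₀ n₀
      have h₁' := h₁.mapNames f₁
      have h₂' := h₂.mapNames f₂
      have hsub' := hsub.mapNames (f := f)
      rw [Ctx.mapNames_extLocal, fa.locSet_eq] at h₁' h₂'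
      rw [fa.locSet_eq] at hsub'
      refine ⟨_, .localCase h₀' hsum hsub' h₁' h₂' hs (E.disjoint_spawned d na) d₁ d₂
        (E.disjoint_nl d₀₁ (h₁.spawned_disjoint n₁)) (E.disjoint_nl d₀₂ (h₂.spawned_disjoint n₂))
        (E.disjoint_spawned d₁₀ (h₁.nl_disjoint n₁)) (E.disjoint_spawned d₂₀ (h₂.nl_disjoint n₂)),
        E.frame (S₂ := C₁.spawned ∪ C₂.spawned) (P₂ := ρ₁.nl ∪ ρ₂.nl ∪ ρa.nl)
          (Set.disjoint_union_left.2 ⟨Set.disjoint_union_left.2 ⟨d₁₀, d₂₀⟩, d⟩)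
          ((Set.union_subset_union h₁.spawned_subset_nl h₂.spawned_subset_nl).trans
            Set.subset_union_left) ?_ ?_ ?_ ?_⟩ <;>
        simp only [Frame.plug, Chor.spawned, LocSet.nl, Set.union_assoc]
  | letLocal ρa t C₂ =>
    cases hC with
    | @letLocal _ _ _ _ _ _ ρ' ρ₁ ρ₂ h₁ hsub h₂ d₁ d₂ d₁₂ d₂₁ =>
      simp only [Frame.plug, Chor.names, Set.disjoint_union_left, Fixes.union_iff, LocSet.nl,
        Set.union_subset_iff] at hf hN hΩ
      obtain ⟨⟨fa, f₁⟩, f₂⟩ := hf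
      obtain ⟨⟨na, n₁⟩, n₂⟩ := hN
      obtain ⟨ρ₁', h₁', E⟩ := ih h₁ hΩ.1.1 f₁ n₁
      have h₂' := h₂.mapNames f₂
      have hsub' := hsub.mapNames (f := f)
      rw [Ctx.mapNames_extLocal, fa.locSet_eq] at h₂'
      rw [fa.locSet_eq] at hsub'
      refine ⟨_, .letLocal h₁' hsub' h₂' (E.disjoint_spawned d₁ na) d₂
        (E.disjoint_nl d₁₂ (h₂.spawned_disjoint n₂))
        (E.disjoint_spawned d₂₁ (h₂.nl_disjoint n₂)),
        E.frame (S₂ := C₂.spawned) (P₂ := ρ₂.nl ∪ ρa.nl) (Set.disjoint_union_left.2 ⟨d₂₁, d₁⟩)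
          (h₂.spawned_subset_nl.trans Set.subset_union_left) rfl rfl ?_ ?_⟩ <;>
        simp only [LocSet.nl, Set.union_assoc]
  | letLoc ρa C₂ =>
    cases hC with
    | @letLoc _ _ _ _ _ ρt ρ' ρτ ρ₁ ρ₂ h₁ hsub hsub' hρ hτ h₂ d₁ d₂ d₁₂ d₂₁ =>
      simp only [Frame.plug, Chor.names, Set.disjoint_union_left, Fixes.union_iff, LocSet.nl,
        Set.union_subset_iff] at hf hN hΩ
      obtain ⟨⟨fa, f₁⟩, f₂⟩ := hf
      obtain ⟨⟨na, n₁⟩, n₂⟩ := hN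
      obtain ⟨ρ₁', h₁', E⟩ := ih h₁ hΩ.1.1 f₁ n₁
      have h₂' := h₂.mapNames f₂
      have hsub'' := hsub'.mapNames (f := f)
      rw [Ctx.mapNames_extTy, CTy.mapNames_ren] at h₂'
      rw [fa.locSet_eq] at hsub''
      refine ⟨_, .letLoc h₁' hsub hsub'' hρ hτ.mapNames h₂' (E.disjoint_spawned d₁ na) d₂
        (E.disjoint_nl d₁₂ (h₂.spawned_disjoint n₂))
        (E.disjoint_spawned d₂₁ (h₂.nl_disjoint n₂)),
        E.frame (S₂ := C₂.spawned) (P₂ := ρ₂.nl ∪ ρa.nl) (Set.disjoint_union_left.2 ⟨d₂₁, d₁⟩)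
          (h₂.spawned_subset_nl.trans Set.subset_union_left) rfl rfl ?_ ?_⟩ <;>
        simp only [LocSet.nl, LocSet.nl_dropLoc, Set.union_assoc]
  | letSet ρa k C₂ =>
    cases hC with
    | @letSet _ _ _ _ _ _ ρt ρ' ρτ ρ₁ ρ₂ h₁ hsub hsub' hρ hτ h₂ d₁ d₂ d₁₂ d₂₁ =>
      simp only [Frame.plug, Chor.names, Set.disjoint_union_left, Fixes.union_iff, LocSet.nl,
        Set.union_subset_iff] at hf hN hΩ
      obtain ⟨⟨fa, f₁⟩, f₂⟩ := hf
      obtain ⟨⟨na, n₁⟩, n₂⟩ := hN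
      obtain ⟨ρ₁', h₁', E⟩ := ih h₁ hΩ.1.1 f₁ n₁
      have h₂' := h₂.mapNames f₂
      have hsub'' := hsub'.mapNames (f := f)
      rw [Ctx.mapNames_extTy, CTy.mapNames_ren] at h₂'
      rw [fa.locSet_eq] at hsub''
      refine ⟨_, .letSet h₁' hsub hsub'' hρ hτ.mapNames h₂' (E.disjoint_spawned d₁ na) d₂
        (E.disjoint_nl d₁₂ (h₂.spawned_disjoint n₂))
        (E.disjoint_spawned d₂₁ (h₂.nl_disjoint n₂)),
        E.frame (S₂ := C₂.spawned) (P₂ := ρ₂.nl ∪ ρa.nl) (Set.disjoint_union_left.2 ⟨d₂₁, d₁⟩)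
          (h₂.spawned_subset_nl.trans Set.subset_union_left) rfl rfl ?_ ?_⟩ <;>
        simp only [LocSet.nl, LocSet.nl_dropSet, Set.union_assoc]
  | send ℓ ρa =>
    cases hC with
    | @send _ _ t _ ρ₀ ρ₁ _ h₁ hm hρ d₁ d₂ =>
      simp only [Frame.plug, Chor.names, Set.disjoint_union_left, Fixes.union_iff, LocSet.nl,
        Set.union_subset_iff] at hf hN hΩ
      obtain ⟨⟨fℓ, fa⟩, f₁⟩ := hf
      obtain ⟨⟨nℓ, na⟩, n₁⟩ := hN
      obtain ⟨ρ₁', h₁', E⟩ := ih h₁ hΩ.1.1 f₁ n₁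
      have hm' := hm.mapNames (f := f)
      rw [fℓ.loc_eq] at hm'
      refine ⟨_, ?_, E.frame_unary (P₂ := ℓ.nl ∪ ρa.nl)
        (Q' := (LocSet.union (.union ρ₁' (.sng ℓ)) ρa).nl)
        (Set.disjoint_union_left.2 ⟨d₁, d₂⟩) ?_ ?_⟩
      · simp only [CTy.mapNames, LocSet.mapNames, fa.locSet_eq]
        exact .send h₁' hm' hρ (E.disjoint_spawned d₁ nℓ) (E.disjoint_spawned d₂ na)
      all_goals simp only [LocSet.nl, Set.union_assoc]
  | killAfter B =>
    cases hC with
    | @killAfter _ _ _ _ ρ₀ h₁ hτ hB =>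
      simp only [Frame.plug, Chor.names, Set.disjoint_union_left, Fixes.union_iff, LocSet.nl,
        Set.union_subset_iff] at hf hN hΩ
      obtain ⟨ρ₁', h₁', E⟩ := ih h₁ hΩ.1 hf.2 hN.2
      have dB : Disjoint {B} C.spawned := Set.disjoint_singleton_left.2 hB
      refine ⟨_, .killAfter h₁' (fun h => hτ ?_)
        (Set.disjoint_singleton_left.1 (E.disjoint_spawned dB hN.1)),
        E.frame (S₂ := {B}) (P₂ := {B}) dB Set.Subset.rfl (Set.union_comm _ _)
          (Set.union_comm _ _) rfl rfl⟩
      rw [CTy.nl_mapNames] at h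
      obtain ⟨A, hA, e⟩ := h
      have hAB : f A = A := hf.1 A (.inr e)
      rwa [← e, hAB]

/-- Preservation for a single step.  The map `f` of names moves the names in the typing
derivation out of the way of the name of a spawned location; it has to be the same throughout
the induction, as parts of the derivation that do not take part in the step are mapped too. -/
theorem HasType.preserves {f : L → L} {R : Redex 𝓛} {C C' : Chor L 𝓛.Ty 𝓛.Expr}
    {Ω Ω' : Set L} (hstep : Step 𝓛 R C Ω C' Ω') (hr : ∀ A, f A ∉ Ω' \ Ω)
    {Γ : Ctx 𝓛} {τ : CTy L 𝓛.Ty} {ρ : LocSet L} (hC : HasType 𝓛 Γ C τ ρ)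
    (hΩ : ρ.nl ⊆ Ω) (hf : Fixes f C.names) (hN : Disjoint C.names (Ω' \ Ω)) :
    Preserves f Γ C C' τ ρ Ω Ω' := by
  induction hstep generalizing Γ τ ρ with
  | ctx η _ _ ih => exact hC.ctx_preserves η (ih hr) hΩ hf hN
  | done hs =>
    refine hC.preserves_of_eq _ hf fun h => ?_
    cases h with
    | doneVal _ _ _ hv => exact absurd hs (𝓛.val_not_step _ _ hv)
    | @done _ ρ e t ht hρ he hv =>
      have he' := 𝓛.preservation _ _ _ _ _ he hs
      rename_i e' _ _
      by_cases hv' : 𝓛.Val e'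
      · exact ⟨_, .doneVal ht hρ he' hv', Set.empty_subset _, rfl⟩
      · exact ⟨_, .done ht hρ he' hv', Set.Subset.rfl, rfl⟩
  | app hV => exact hC.preserves_of_eq _ hf fun h => h.app_preserves hV
  | tapp => exact hC.preserves_of_eq _ hf fun h => h.tapp_preserves
  | unfoldFold hV =>
    refine hC.preserves_of_eq _ hf fun h => ?_
    cases h with
    | unfold h _ =>
      cases h with
      | fold h => exact ⟨_, h, Set.subset_union_left, rfl⟩
  | fstPair hV₁ hV₂ =>
    refine hC.preserves_of_eq _ hf fun h => ?_
    cases h with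
    | fst h =>
      cases h with
      | pair h₁ h₂ =>
        refine ⟨_, h₁, Set.subset_union_left.trans Set.subset_union_left, ?_⟩
        simp [Chor.spawned, (h₂.idle_of_isVal hV₂).2]
  | sndPair hV₁ hV₂ =>
    refine hC.preserves_of_eq _ hf fun h => ?_
    cases h with
    | snd h =>
      cases h with
      | pair h₁ h₂ =>
        refine ⟨_, h₂, Set.subset_union_right.trans Set.subset_union_left, ?_⟩
        simp [Chor.spawned, (h₁.idle_of_isVal hV₁).2]
  | caseInl hV =>
    refine hC.preserves_of_eq _ hf fun h => ?_
    cases h with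
    | caseOf h₀ h₁ h₂ hs =>
      cases h₀ with
      | inl h₀ =>
        obtain ⟨ρ', h, hn, hs'⟩ := h₁.subst_val (h₀.typedIdle hV)
        refine ⟨ρ', h, hn.trans fun A hA => .inl (.inl (.inr hA)), ?_⟩
        rw [hs']
        simp [Chor.spawned, (h₀.idle_of_isVal hV).2, hs]
  | caseInr hV =>
    refine hC.preserves_of_eq _ hf fun h => ?_
    cases h with
    | caseOf h₀ h₁ h₂ hs =>
      cases h₀ with
      | inr h₀ =>
        obtain ⟨ρ', h, hn, hs'⟩ := h₂.subst_val (h₀.typedIdle hV)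
        refine ⟨ρ', h, hn.trans fun A hA => .inl (.inr hA), ?_⟩
        rw [hs']
        simp [Chor.spawned, (h₀.idle_of_isVal hV).2, hs]
  | localCaseInl hv hg =>
    refine hC.preserves_of_eq _ hf fun h => ?_
    cases h with
    | localCase h₀ hsum _ h₁ h₂ hs =>
      rcases 𝓛.getCase_spec _ _ _ _ _ hsum hv (h₀.typed_of_val hv) with
        ⟨e, he, _, ht⟩ | ⟨e, he, _, _⟩ <;> rw [hg] at he
      · cases he
        obtain ⟨ρ', h, hn, hs'⟩ := h₁.subst_local ht
        refine ⟨ρ', h, hn.trans fun A hA => .inl (.inl (.inr hA)), ?_⟩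
        rw [hs']
        simp [Chor.spawned, hs]
      · cases he
  | localCaseInr hv hg =>
    refine hC.preserves_of_eq _ hf fun h => ?_
    cases h with
    | localCase h₀ hsum _ h₁ h₂ hs =>
      rcases 𝓛.getCase_spec _ _ _ _ _ hsum hv (h₀.typed_of_val hv) with
        ⟨e, he, _, _⟩ | ⟨e, he, _, ht⟩ <;> rw [hg] at he
      · cases he
      · cases he
        obtain ⟨ρ', h, hn, hs'⟩ := h₂.subst_local ht
        refine ⟨ρ', h, hn.trans fun A hA => .inl (.inr hA), ?_⟩
        rw [hs']
        simp [Chor.spawned, hs]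
  | letVal hv =>
    refine hC.preserves_of_eq _ hf fun h => ?_
    cases h with
    | letLocal h₀ _ h₁ =>
      obtain ⟨ρ', h, hn, hs'⟩ := h₁.subst_local (h₀.typed_of_val hv)
      refine ⟨ρ', h, hn.trans fun A hA => .inl (.inr hA), ?_⟩
      rw [hs']
      simp [Chor.spawned]
  | letLocVal he => exact hC.preserves_of_eq _ hf fun h => h.letLoc_preserves he
  | letSetVal he => exact hC.preserves_of_eq _ hf fun h => h.letSet_preserves he
  | sendVal hv =>
    refine hC.preserves_of_eq _ hf fun h => ?_
    cases h with
    | send h₀ hm hρ =>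
      cases h₀ with
      | doneVal ht hρ' he _ =>
        exact ⟨_, .doneVal ht (.union hρ' hρ)
          (𝓛.typed_of_closed (𝓛.val_closed _ _ _ _ hv he) _) hv, Set.empty_subset _, rfl⟩
      | done _ _ _ hv' => exact absurd hv hv'
  | sync =>
    refine hC.preserves_of_eq _ hf fun h => ?_
    cases h with
    | sync h => exact ⟨_, h, Set.subset_union_right, rfl⟩
  | @syncI _ ℓ _ ρa _ _ _ _ _ _ ih =>
    cases hC with
    | @sync _ _ _ _ _ _ ρ₁ h₁ hℓ hρ d₁ d₂ =>
      simp only [Chor.names, Set.disjoint_union_left, Fixes.union_iff, LocSet.nl,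
        Set.union_subset_iff] at hf hN hΩ
      obtain ⟨ρ₁', h₁', E⟩ := ih hr h₁ hΩ.2 hf.2 hN.2
      exact ⟨_, .sync h₁' hℓ hρ (E.disjoint_spawned d₁ hN.1.1) (E.disjoint_spawned d₂ hN.1.2),
        E.frame_unary (P₂ := ℓ.nl ∪ ρa.nl) (Set.disjoint_union_left.2 ⟨d₁, d₂⟩)
          (Set.union_comm _ _) (Set.union_comm _ _)⟩
  | @caseI _ ρa C₀ C₁ C₁' C₂ C₂' _ _ _ _ _ _ ih₁ ih₂ =>
    cases hC with
    | @caseOf _ _ _ _ _ τ₁ τ₂ _ ρ₀ ρ₁ ρ₂ h₀ h₁ h₂ hs d d₁ d₂ d₀₁ d₀₂ d₁₀ d₂₀ =>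
      simp only [Chor.names, Set.disjoint_union_left, Fixes.union_iff, LocSet.nl,
        Set.union_subset_iff] at hf hN hΩ
      obtain ⟨⟨⟨fa, f₀⟩, f₁⟩, f₂⟩ := hf
      obtain ⟨⟨⟨na, n₀⟩, n₁⟩, n₂⟩ := hN
      obtain ⟨ρ₁', h₁', E₁⟩ := ih₁ hr h₁ hΩ.1.1.2 f₁ n₁
      obtain ⟨ρ₂', h₂', E₂⟩ := ih₂ hr h₂ hΩ.1.2 f₂ n₂
      obtain ⟨hs', E⟩ := E₁.branches E₂ hs
      have h₀' := h₀.mapNames f₀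
      simp only [CTy.mapNames, fa.locSet_eq] at h₀'
      refine ⟨_, .caseOf h₀' h₁' h₂' hs' d (E₁.disjoint_spawned d₁ na)
        (E₂.disjoint_spawned d₂ na) (E₁.disjoint_spawned d₀₁ (h₀.nl_disjoint n₀))
        (E₂.disjoint_spawned d₀₂ (h₀.nl_disjoint n₀))
        (E₁.disjoint_nl d₁₀ (h₀.spawned_disjoint n₀))
        (E₂.disjoint_nl d₂₀ (h₀.spawned_disjoint n₀)),
        E.frame (S₂ := C₀.spawned) (P₂ := ρ₀.nl ∪ ρa.nl) (Set.disjoint_union_left.2 ⟨d₀₁, d₁⟩)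
          (h₀.spawned_subset_nl.trans Set.subset_union_left) ?_ ?_ ?_ ?_⟩
      · rw [Chor.spawned, ← hs, Set.union_assoc, Set.union_self, Set.union_comm]
      · rw [Chor.spawned, ← hs', Set.union_assoc, Set.union_self, Set.union_comm]
      all_goals simp only [LocSet.nl]; ac_rfl
  | @localCaseI _ ρa C₀ C₁ C₁' C₂ C₂' _ _ _ _ _ _ ih₁ ih₂ =>
    cases hC with
    | @localCase _ _ _ _ _ t t₁ t₂ _ ρ' ρ₀ ρ₁ ρ₂ h₀ hsum hsub h₁ h₂ hs d d₁ d₂ d₀₁ d₀₂ d₁₀ d₂₀ =>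
      simp only [Chor.names, Set.disjoint_union_left, Fixes.union_iff, LocSet.nl,
        Set.union_subset_iff] at hf hN hΩ
      obtain ⟨⟨⟨fa, f₀⟩, f₁⟩, f₂⟩ := hf
      obtain ⟨⟨⟨na, n₀⟩, n₁⟩, n₂⟩ := hN
      obtain ⟨ρ₁', h₁', E₁⟩ := ih₁ hr h₁ hΩ.1.1.2 f₁ n₁
      obtain ⟨ρ₂', h₂', E₂⟩ := ih₂ hr h₂ hΩ.1.2 f₂ n₂
      obtain ⟨hs', E⟩ := E₁.branches E₂ hs
      have hsub' := hsub.mapNames (f := f)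
      rw [Ctx.mapNames_extLocal, fa.locSet_eq] at h₁' h₂'
      rw [fa.locSet_eq] at hsub'
      refine ⟨_, .localCase (h₀.mapNames f₀) hsum hsub' h₁' h₂' hs' d (E₁.disjoint_spawned d₁ na)
        (E₂.disjoint_spawned d₂ na) (E₁.disjoint_spawned d₀₁ (h₀.nl_disjoint n₀))
        (E₂.disjoint_spawned d₀₂ (h₀.nl_disjoint n₀))
        (E₁.disjoint_nl d₁₀ (h₀.spawned_disjoint n₀))
        (E₂.disjoint_nl d₂₀ (h₀.spawned_disjoint n₀)),
        E.frame (S₂ := C₀.spawned) (P₂ := ρ₀.nl ∪ ρa.nl) (Set.disjoint_union_left.2 ⟨d₀₁, d₁⟩)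
          (h₀.spawned_subset_nl.trans Set.subset_union_left) ?_ ?_ ?_ ?_⟩
      · rw [Chor.spawned, ← hs, Set.union_assoc, Set.union_self, Set.union_comm]
      · rw [Chor.spawned, ← hs', Set.union_assoc, Set.union_self, Set.union_comm]
      all_goals simp only [LocSet.nl]; ac_rfl
  -- `ctx_preserves` does not need the left part to be a value
  | appI hs _ ih => exact hC.ctx_preserves (.appR _ _) (ih hr) hΩ hf hN
  | pairI hs _ ih => exact hC.ctx_preserves (.pairR _ _) (ih hr) hΩ hf hN
  | @letLocI _ ρa _ C₁ _ _ _ _ _ _ _ _ ih =>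
    cases hC with
    | @letLoc _ _ _ _ _ ρt ρ' ρτ ρ₁ ρ₂ h₁ hsub hsub' hρ hτ h₂ d₁ d₂ d₁₂ d₂₁ =>
      simp only [Chor.names, Set.disjoint_union_left, Fixes.union_iff, LocSet.nl,
        Set.union_subset_iff, LocSet.nl_dropLoc] at hf hN hΩ
      obtain ⟨⟨fa, f₁⟩, f₂⟩ := hf
      obtain ⟨⟨na, n₁⟩, n₂⟩ := hN
      obtain ⟨ρ₂', h₂', E⟩ := ih hr h₂ hΩ.1.2 f₂ n₂
      have hsub'' := hsub'.mapNames (f := f)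
      rw [Ctx.mapNames_extTy, CTy.mapNames_ren] at h₂'
      rw [fa.locSet_eq] at hsub''
      refine ⟨_, .letLoc (h₁.mapNames f₁) hsub hsub'' hρ hτ.mapNames h₂' d₁
        (E.disjoint_spawned d₂ na) (E.disjoint_spawned d₁₂ (h₁.nl_disjoint n₁))
        (E.disjoint_nl d₂₁ (h₁.spawned_disjoint n₁)),
        E.frame (S₂ := C₁.spawned) (P₂ := ρ₁.nl ∪ ρa.nl) (Set.disjoint_union_left.2 ⟨d₁₂, d₂⟩)
          (h₁.spawned_subset_nl.trans Set.subset_union_left) (Set.union_comm _ _)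
          (Set.union_comm _ _) ?_ ?_⟩ <;>
        simp only [LocSet.nl, LocSet.nl_dropLoc] <;> ac_rfl
  | @letSetI _ ρa _ _ C₁ _ _ _ _ _ _ _ _ ih =>
    cases hC with
    | @letSet _ _ _ _ _ _ ρt ρ' ρτ ρ₁ ρ₂ h₁ hsub hsub' hρ hτ h₂ d₁ d₂ d₁₂ d₂₁ =>
      simp only [Chor.names, Set.disjoint_union_left, Fixes.union_iff, LocSet.nl,
        Set.union_subset_iff, LocSet.nl_dropSet] at hf hN hΩ
      obtain ⟨⟨fa, f₁⟩, f₂⟩ := hf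
      obtain ⟨⟨na, n₁⟩, n₂⟩ := hN
      obtain ⟨ρ₂', h₂', E⟩ := ih hr h₂ hΩ.1.2 f₂ n₂
      have hsub'' := hsub'.mapNames (f := f)
      rw [Ctx.mapNames_extTy, CTy.mapNames_ren] at h₂'
      rw [fa.locSet_eq] at hsub''
      refine ⟨_, .letSet (h₁.mapNames f₁) hsub hsub'' hρ hτ.mapNames h₂' d₁
        (E.disjoint_spawned d₂ na) (E.disjoint_spawned d₁₂ (h₁.nl_disjoint n₁))
        (E.disjoint_nl d₂₁ (h₁.spawned_disjoint n₁)),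
        E.frame (S₂ := C₁.spawned) (P₂ := ρ₁.nl ∪ ρa.nl) (Set.disjoint_union_left.2 ⟨d₁₂, d₂⟩)
          (h₁.spawned_subset_nl.trans Set.subset_union_left) (Set.union_comm _ _)
          (Set.union_comm _ _) ?_ ?_⟩ <;>
        simp only [LocSet.nl, LocSet.nl_dropSet] <;> ac_rfl
  | @fork A B e C Ω hB he =>
    have hB' : B ∈ (Ω ∪ {B}) \ Ω := ⟨.inr rfl, hB⟩
    have hBC : B ∉ C.names := fun h => Set.disjoint_left.1 hN (.inr h) hB'
    have hC' := hC.mapNames hf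
    have hBs : B ∉ C.spawned := by
      cases hC with
      | fork _ _ h => exact fun hs => hBC (h.nl_subset_names (h.spawned_subset_nl hs))
    -- `B` may occur in `τ`, but it is not in the range of `f`
    obtain ⟨ρ', h, hn, hs⟩ := hC'.fork_preserves he hBs (by
      rw [CTy.nl_mapNames]
      rintro ⟨A, _, rfl⟩
      exact hr A hB')
    have e₁ : (Ω ∪ {B}) \ Ω = {B} := by
      rw [Set.union_sdiff_left]
      exact sdiff_eq_left.2 (Set.disjoint_singleton_left.2 hB)
    have e₂ : Ω \ (Ω ∪ {B}) = ∅ := Set.sdiff_eq_empty.2 Set.subset_union_left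
    refine ⟨ρ', h, ?_⟩
    rw [e₁, e₂]
    refine ⟨?_, Set.empty_subset _, hn, Set.disjoint_empty _⟩
    simp only [Chor.spawned, hs, Set.sdiff_empty]
    exact Set.union_comm _ _
  | @forkI _ ℓ _ C _ _ _ _ _ _ ih =>
    cases hC with
    | @fork _ _ _ _ ρ₀ _ hℓ hτ h₁ d =>
      simp only [Chor.names, Set.disjoint_union_left, Fixes.union_iff, LocSet.nl,
        Set.union_subset_iff, LocSet.nl_dropLoc] at hf hN hΩ
      obtain ⟨ρ₁', h₁', E⟩ := ih hr h₁ hΩ.2 hf.2 hN.2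
      have e : (ℓ.ren (Ren.shift .loc)).mapNames f = ℓ.ren (Ren.shift .loc) := by
        rw [LocE.mapNames_ren, hf.1.loc_eq]
      rw [Ctx.mapNames_extLocal, Ctx.mapNames_extTy, CTy.mapNames_ren] at h₁'
      simp only [LocSet.mapNames, e] at h₁'
      refine ⟨_, .fork hℓ hτ.mapNames h₁' (E.disjoint_spawned d hN.1),
        E.frame_unary (P₂ := ℓ.nl) d ?_ ?_⟩ <;>
        simp only [LocSet.nl, LocSet.nl_dropLoc, Set.union_comm]
  | @kill A V Ω hV =>
    cases hC with
    | @killAfter _ _ _ _ ρ₀ h₁ hτ hA =>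
      have hAΩ : A ∈ Ω := hΩ (.inr rfl)
      have hi := h₁.idle_of_isVal hV
      have hn : ρ₀.nl ⊆ ∅ := LocSet.nl_mono (ρ' := .empty) hi.1.subset
      simp only [Chor.names, Fixes.union_iff] at hf
      have e₁ : (Ω \ {A}) \ Ω = ∅ := Set.sdiff_eq_empty.2 Set.sdiff_subset
      have e₂ : Ω \ (Ω \ {A}) = {A} :=
        Set.sdiff_sdiff_cancel_left (Set.singleton_subset_iff.2 hAΩ)
      refine ⟨_, h₁.mapNames hf.2, ?_⟩
      rw [e₁, e₂]
      refine ⟨?_, Set.subset_union_left, hn.trans (Set.empty_subset _),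
        (Set.empty_disjoint _).mono_left hn⟩
      simp [Chor.spawned, hi.2]
  | @killI A C Ω hA =>
    cases hC with
    | @killAfter _ _ _ _ ρ₀ h₁ hτ hA' =>
      have hAΩ : A ∈ Ω := hΩ (.inr rfl)
      simp only [Chor.names, Fixes.union_iff] at hf
      have e₁ : (Ω \ {A}) \ Ω = ∅ := Set.sdiff_eq_empty.2 Set.sdiff_subset
      have e₂ : Ω \ (Ω \ {A}) = {A} :=
        Set.sdiff_sdiff_cancel_left (Set.singleton_subset_iff.2 hAΩ)
      refine ⟨_, h₁.mapNames hf.2, ?_⟩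
      rw [e₁, e₂]
      refine ⟨?_, Set.subset_union_left, Set.subset_union_left.trans Set.subset_union_left,
        Set.disjoint_singleton_right.2 fun h => hA (h₁.mem_cloc h)⟩
      simp only [Chor.spawned, Set.union_empty]
      rw [Set.union_sdiff_left]
      exact (sdiff_eq_left.2 (Set.disjoint_singleton_right.2 hA')).symm
  | _ =>
    -- a local `let`, with a step in its body
    rename_i ρa _ C₁ _ _ _ _ _ _ _ ih
    cases hC with
    | @letLocal _ _ _ _ _ _ ρ' ρ₁ ρ₂ h₁ hsub h₂ d₁ d₂ d₁₂ d₂₁ =>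
      simp only [Chor.names, Set.disjoint_union_left, Fixes.union_iff, LocSet.nl,
        Set.union_subset_iff] at hf hN hΩ
      obtain ⟨⟨fa, f₁⟩, f₂⟩ := hf
      obtain ⟨⟨na, n₁⟩, n₂⟩ := hN
      obtain ⟨ρ₂', h₂', E⟩ := ih hr h₂ hΩ.1.2 f₂ n₂
      have hsub' := hsub.mapNames (f := f)
      rw [Ctx.mapNames_extLocal, fa.locSet_eq] at h₂'
      rw [fa.locSet_eq] at hsub'
      refine ⟨_, .letLocal (h₁.mapNames f₁) hsub' h₂' d₁ (E.disjoint_spawned d₂ na)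
        (E.disjoint_spawned d₁₂ (h₁.nl_disjoint n₁))
        (E.disjoint_nl d₂₁ (h₁.spawned_disjoint n₁)),
        E.frame (S₂ := C₁.spawned) (P₂ := ρ₁.nl ∪ ρa.nl) (Set.disjoint_union_left.2 ⟨d₁₂, d₂⟩)
          (h₁.spawned_subset_nl.trans Set.subset_union_left) (Set.union_comm _ _)
          (Set.union_comm _ _) ?_ ?_⟩ <;>
        simp only [LocSet.nl] <;> ac_rfl

end Preservation
section Finiteness

variable {L : Type u} {𝓛 : LocalLang.{u, v, w} L}

/-! ### Finiteness of the sets of names -/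

theorem LocE.finite_nl (ℓ : LocE L) : ℓ.nl.Finite := by
  cases ℓ <;> simp [LocE.nl]

theorem LocSet.finite_nl (ρ : LocSet L) : ρ.nl.Finite := by
  induction ρ with
  | sng ℓ => exact ℓ.finite_nl
  | union _ _ h₁ h₂ => exact h₁.union h₂
  | _ => exact Set.finite_empty

theorem Kind.finite_names (κ : Kind L) : κ.names.Finite := by
  cases κ <;> simp [Kind.names, LocSet.finite_nl]

theorem CTy.finite_names {T : Type v} (τ : CTy L T) : τ.names.Finite := by
  induction τ <;> simp_all [CTy.names, LocSet.finite_nl, Kind.finite_names]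

theorem TArg.finite_names {T : Type v} (a : TArg L T) : a.names.Finite := by
  cases a <;> simp [TArg.names, LocE.finite_nl, LocSet.finite_nl, CTy.finite_names]

theorem Chor.finite_names {T : Type v} {E : Type w} (C : Chor L T E) : C.names.Finite := by
  induction C <;> simp_all [Chor.names, LocE.finite_nl, LocSet.finite_nl, Kind.finite_names,
    TArg.finite_names]

/-- A step spawns finitely many locations, in fact at most one. -/
theorem Step.finite_spawned {R : Redex 𝓛} {C C' : Chor L 𝓛.Ty 𝓛.Expr} {Ω Ω' : Set L}
    (h : Step 𝓛 R C Ω C' Ω') : (Ω' \ Ω).Finite := by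
  induction h with
  | @fork _ B => exact (Set.finite_singleton B).subset fun A hA => hA.1.resolve_left hA.2
  | _ => first | assumption | simp

end Finiteness

section Preservation

variable {L : Type u} {𝓛 : LocalLang.{u, v, w} L}

/-! ### Sequences of reductions -/

/-- Preservation for a step whose new names are fresh.  The type derivation may involve the new
names in types of which there is no trace in the choreography.  There they are replaced by a
name that is not used at all, which exists since there are infinitely many. -/
theorem HasType.preserves_of_fresh [Infinite L] {R : Redex 𝓛} {C C' : Chor L 𝓛.Ty 𝓛.Expr}
    {Ω Ω' : Set L} (hstep : Step 𝓛 R C Ω C' Ω') {Γ : Ctx 𝓛} {τ : CTy L 𝓛.Ty} {ρ : LocSet L}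
    (hC : HasType 𝓛 Γ C τ ρ) (hΩ : ρ.nl ⊆ Ω)
    (hN : Disjoint (Ω' \ Ω) (Γ.names ∪ τ.names ∪ C.names)) :
    ∃ ρ', HasType 𝓛 Γ C' τ ρ' ∧
      Effect (Ω' \ Ω) (Ω \ Ω') C.spawned C'.spawned ρ.nl ρ'.nl := by
  classical
  obtain ⟨B, hB⟩ := (C.finite_names.union hstep.finite_spawned).exists_notMem
  have hfresh : ∀ A ∈ Γ.names ∪ τ.names ∪ C.names, A ∉ Ω' \ Ω :=
    fun A hA hA' => Set.disjoint_left.1 hN hA' hA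
  let f : L → L := fun A => if A ∈ Ω' \ Ω then B else A
  have hf : ∀ A, A ∉ Ω' \ Ω → f A = A := fun A hA => if_neg hA
  have hf' : ∀ A, A ∈ Ω' \ Ω → f A = B := fun A hA => if_pos hA
  have h := hC.preserves (f := f) hstep
    (fun A hA => by
      by_cases h : A ∈ Ω' \ Ω
      · rw [hf' A h] at hA
        exact hB (.inr hA)
      · rw [hf A h] at hA
        exact h hA)
    hΩ
    (fun A hA => by
      by_cases h : A ∈ Ω' \ Ω
      · rw [hf' A h] at hA
        rcases hA with hA | hA
        · exact absurd h (hfresh A (.inr hA))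
        · exact absurd (.inl hA) hB
      · exact hf A h)
    (hN.symm.mono_left Set.subset_union_right)
  rwa [Preserves, Ctx.mapNames_eq fun A hA => hf A (hfresh A (.inl (.inl hA))),
    CTy.mapNames_eq fun A hA => hf A (hfresh A (.inl (.inr hA)))] at h

/-- Along a sequence of reductions, the running locations that have not been spawned stay the
same, and those that do not participate remain so. -/
theorem HasType.steps_preserves [Infinite L] {Γ : Ctx 𝓛} {C C' : Chor L 𝓛.Ty 𝓛.Expr}
    {τ : CTy L 𝓛.Ty} {ρ : LocSet L} {Ω Ω' : Set L} (hC : HasType 𝓛 Γ C τ ρ) (hΩ : ρ.nl ⊆ Ω)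
    (h : Steps 𝓛 (Γ.names ∪ τ.names) C Ω C' Ω') :
    ∃ ρ', HasType 𝓛 Γ C' τ ρ' ∧ ρ'.nl ⊆ Ω' ∧ Ω' \ C'.spawned = Ω \ C.spawned ∧
      Ω \ ρ.nl ⊆ Ω' \ ρ'.nl := by
  induction h with
  | refl => exact ⟨ρ, hC, hΩ, rfl, subset_rfl⟩
  | @tail R C₁ C₂ Ω₁ Ω₂ _ hstep hN ih =>
    obtain ⟨ρ₁, h₁, hΩ₁, hS, hP⟩ := ih
    obtain ⟨ρ₂, h₂, E⟩ := h₁.preserves_of_fresh hstep hΩ₁ hN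
    have hk := E.killed
    have hn := E.nl
    have hnk := E.nl_killed
    have hsn := h₁.spawned_subset_nl
    simp only [Set.subset_def, Set.disjoint_left, Set.mem_sdiff, Set.mem_union]
      at hk hn hnk hsn hΩ₁
    refine ⟨ρ₂, h₂, fun A hA => ?_, ?_, hP.trans fun A hA => ?_⟩
    · grind
    · rw [← hS, E.spawned]
      ext A
      simp only [Set.mem_sdiff, Set.mem_union]
      grind
    · simp only [Set.mem_sdiff] at hA ⊢
      grind

end Preservation

end LambdaFork

theorem mainTheorem5 {L : Type u} [Infinite L] (𝓛 : LambdaFork.LocalLang.{u, v, w} L)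
    (Γ : LambdaFork.Ctx 𝓛) (C C' : LambdaFork.Chor L 𝓛.Ty 𝓛.Expr)
    (τ : LambdaFork.CTy L 𝓛.Ty) (ρ : LambdaFork.LocSet L) (Ω Ω' : Set L)
    (hC : LambdaFork.HasType 𝓛 Γ C τ ρ) (hρ : ρ.nl ⊆ Ω)
    (hsteps : LambdaFork.Steps 𝓛 (Γ.names ∪ τ.names) C Ω C' Ω') :
    ∃ ρ' : LambdaFork.LocSet L,
      LambdaFork.HasType 𝓛 Γ C' τ ρ' ∧
      ρ'.nl ⊆ Ω' ∧
      C'.spawned \ C.spawned = Ω' \ Ω ∧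
      C.spawned \ C'.spawned = Ω \ Ω' ∧
      ρ'.nl \ ρ.nl ⊆ Ω' \ Ω ∧
      Ω \ Ω' ⊆ ρ.nl \ ρ'.nl := by
  obtain ⟨ρ', hC', hρ', hS, hP⟩ := hC.steps_preserves hρ hsteps
  have hsn := hC.spawned_subset_nl
  have hsn' := hC'.spawned_subset_nl
  rw [Set.ext_iff] at hS
  simp only [Set.subset_def, Set.mem_sdiff] at hP hS hsn hsn' hρ hρ'
  refine ⟨ρ', hC', hρ', ?_, ?_, ?_, ?_⟩
  · ext A
    simp only [Set.mem_sdiff]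
    grind
  · ext A
    simp only [Set.mem_sdiff]
    grind
  all_goals
    intro A
    simp only [Set.mem_sdiff]
    grind
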